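/- **Setting.** A Lorentzian pre-length space $(X,d,\ll,\le,\tau)$ is a metric space $(X,d)$ with a preorder $\le$, a transitive relation $\ll$ contained in $\le$, and a function $\tau:X\times X\to[0,\infty]$ that is lower semicontinuous, satisfies $\tau(x,z)\ge\tau(x,y)+\tau(y,z)$ for $x\le y\le z$, vanishes on pairs with $x\not\le y$, and satisfies $\tau(x,y)>0\iff x\ll y$. A causal curve is a non-constant Lipschitz curve $\gamma:[0,1]\to X$ with $\gamma(s)\le\gamma(t)$ for $s<t$; its length is $L_\tau(\gamma)=\inf\sum_i\tau(\gamma(u_i),\gamma(u_{i+1}))$ over all partitions of $[0,1]$; it is a distance realizer from $x=\gamma(0)$ to $y=\gamma(1)$ if $L_\tau(\gamma)=\tau(x,y)$. $X$ is strongly causal if its metric topology is generated by the sets $\{z: x\ll z\ll y\}$, and regular if every distance realizer $\gamma$ between timelike related points is timelike ($\gamma(s)\ll\gamma(t)$ whenever $s<t$ and $\gamma(s)\neq\gamma(t)$). $X$ locally has distance realizers between timelike related points if every point has an open neighbourhood $U$ such that any $x\ll y$ in $U$ are joined by a distance realizer in $X$. Let $K\in\mathbb R$, let $\mathbb L^2_K$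 be the simply connected Lorentzian surface of constant curvature $K$ (Minkowski plane for $K=0$; universal cover of scaled de Sitter space for $K>0$ and of scaled anti-de Sitter space for $K<0$), with time separation $\bar\tau$, and let $D_K=\pi/\sqrt{-K}$ for $K<0$, $D_K=\infty$ for $K\ge0$. A comparison triangle of $x\le y\le z$ with $\tau(x,z)<D_K$ is a triple $\bar x\le\bar y\le\bar z$ in $\mathbb L^2_K$ with the same three time separations. Each of the following conditions asks that $X$ be covered by open sets $U$ such that $(U\times U)\cap\tau^{-1}([0,D_K))$ is open, $\tau$ is continuous on it, and the stated property holds. * **Triangle condition (upper bound $K$).** Any $x\ll y$ in $U$ are joined by a distance realizer contained in $U$. Moreover, for all $x\le y\le z$ in $U$ with $\tau(x,z)<D_K$ and every comparison triangle, whenever $a\ll b$ are two of the vertices, $c$ is the third one, $m$ lies on a distance realizer in $U$ from $a$ to $b$, and $\bar m$ is the comparison point of $m$ (that is, $\bar a\le\bar m\le\bar b$, $\bar\tau(\bar a,\bar m)=\tau(a,m)$, $\bar\tau(\bar m,\bar b)=\tau(m,b)$), one has $\tau(c,m)\ge\bar\tau(\bar c,\bar m)$ and $\tau(m,c)\ge\bar\tau(\bar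 m,\bar c)$. * **Four-point condition (upper bound $K$).** For all $x_1\ll x_2\ll x_3\ll x_4$ in $U$ with $\tau(x_1,x_4)<D_K$: (a) if $\bar x_1\bar x_2\bar x_4$ and $\bar x_1\bar x_3\bar x_4$ are comparison triangles of $x_1x_2x_4$ and $x_1x_3x_4$ with $\bar x_2,\bar x_3$ on opposite sides of the line $\bar x_1\bar x_4$, then $\tau(x_2,x_3)\ge\bar\tau(\bar x_2,\bar x_3)$; (b) if $\bar x_1\bar x_2\bar x_3$ and $\bar x_2\bar x_3\bar x_4$ are comparison triangles of $x_1x_2x_3$ and $x_2x_3x_4$ with $\bar x_1,\bar x_4$ on the same side of the line $\bar x_2\bar x_3$, then $\tau(x_1,x_4)\le\bar\tau(\bar x_1,\bar x_4)$. (Points on the line count as lying on both sides.) * **One-sided $\epsilon$-$\mu$ triangle condition (upper bound $K$).** For all $x\ll y\ll z$ in $U$ with $\tau(x,z)<D_K$ and all $\mu\in(0,1)$ there is $f_\mu:\mathbb R_{\ge0}\to\mathbb R_{\ge0}$ with $\lim_{\epsilon\to0}f_\mu(\epsilon)=0$ such that for every comparison triangle, every two vertices $a\ll b$ with third vertex $c$,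 every $\epsilon>0$, and every $\epsilon$-$\mu$-midpoint $m\in U$ of $a,b$ (that is, $|\tau(a,m)-\mu\tau(a,b)|<\epsilon$ and $|\tau(m,b)-(1-\mu)\tau(a,b)|<\epsilon$) with $c\ll m$ or $m\ll c$, one has $$\tau(c,m)\ge\bar\tau(\bar c,\bar m_\mu)-f_\mu(\epsilon),\qquad \tau(m,c)\ge\bar\tau(\bar m_\mu,\bar c)-f_\mu(\epsilon),$$ where $\bar m_\mu$ is the $\mu$-midpoint of $\bar a,\bar b$ in $\mathbb L^2_K$ (that is, $\bar\tau(\bar a,\bar m_\mu)=\mu\bar\tau(\bar a,\bar b)$ and $\bar\tau(\bar m_\mu,\bar b)=(1-\mu)\bar\tau(\bar a,\bar b)$). **Lemma.** Let $X$ be a Lorentzian pre-length space and $K\in\mathbb R$. If $X$ is strongly causal and regular, the following are equivalent: (i) $X$ satisfies the triangle condition with upper bound $K$; (ii) $X$ satisfies the four-point condition with upper bound $K$, and locally has distance realizers between timelike related points; (iii) $X$ satisfies the one-sided $\epsilon$-$\mu$ triangle condition with upper bound $K$, and locally has distance realizers between timelike related points. Moreover, in an arbitrary Lorentzian pre-length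 space (neither strong causality, regularity, nor existence of distance realizers being assumed) the four-point condition with upper bound $K$ implies the one-sided $\epsilon$-$\mu$ triangle condition with upper bound $K$. -/

import Mathlib

open Set Filter Topology
open scoped NNReal ENNReal

noncomputable section

/-! ### Lorentzian pre-length spaces -/

/-- A Lorentzian pre-length space `(X, d, ≪, ≤, τ)`; the metric `d` is the `MetricSpace` structure,
`causal` is `≤` and `chron` is `≪`. -/
class LorentzianPreLengthSpace (X : Type*) [MetricSpace X] where
  /-- the causal relation `≤` -/
  causal : X → X → Prop
  /-- the timelike relation `≪` -/
  chron : X → X → Prop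
  /-- the time separation function -/
  tau : X → X → ℝ≥0∞
  causal_refl : ∀ x, causal x x
  causal_trans : ∀ x y z, causal x y → causal y z → causal x z
  chron_trans : ∀ x y z, chron x y → chron y z → chron x z
  causal_of_chron : ∀ x y, chron x y → causal x y
  lowerSemicontinuous_tau : LowerSemicontinuous (fun p : X × X => tau p.1 p.2)
  reverse_triangle : ∀ x y z, causal x y → causal y z → tau x y + tau y z ≤ tau x z
  tau_eq_zero : ∀ x y, ¬ causal x y → tau x y = 0
  tau_pos_iff : ∀ x y, 0 < tau x y ↔ chron x y

namespace LorentzianPreLengthSpace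

variable (X : Type*) [MetricSpace X] [LorentzianPreLengthSpace X]

/-- Strong causality: the Alexandrov topology, generated by the timelike diamonds
`I⁺(x) ∩ I⁻(y)`, is the metric topology. -/
def StronglyCausal : Prop :=
  (inferInstance : TopologicalSpace X) =
    TopologicalSpace.generateFrom {S : Set X | ∃ x y : X, S = {z | chron x z ∧ chron z y}}

variable {X}

/-- A future-directed causal curve, parametrized on `[0,1]`. -/
structure IsCausalCurve (γ : ℝ → X) : Prop where
  lipschitz : ∃ C : ℝ≥0, LipschitzOnWith C γ (Icc 0 1)
  nonconstant : ∃ s ∈ Icc (0 : ℝ) 1, ∃ t ∈ Icc (0 : ℝ) 1, γ s ≠ γ t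
  causal : ∀ s ∈ Icc (0 : ℝ) 1, ∀ t ∈ Icc (0 : ℝ) 1, s < t → causal (γ s) (γ t)

/-- The `τ`-length of a curve on `[0,1]`: the infimum of `∑ τ(γ(uᵢ), γ(uᵢ₊₁))` over all partitions
`0 = u₀ ≤ u₁ ≤ ⋯ ≤ uₙ = 1`. -/
def tauLength (γ : ℝ → X) : ℝ≥0∞ :=
  ⨅ (n : ℕ) (u : ℕ → ℝ) (_ : Monotone u ∧ u 0 = 0 ∧ u n = 1),
    ∑ i ∈ Finset.range n, tau (γ (u i)) (γ (u (i + 1)))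

/-- `γ` is a distance realizer from `x` to `y`. -/
structure IsRealizer (γ : ℝ → X) (x y : X) : Prop where
  curve : IsCausalCurve γ
  source : γ 0 = x
  target : γ 1 = y
  length : tauLength γ = tau x y

variable (X)

/-- Regularity: every distance realizer between timelike related points is timelike. The clause
`γ s ≠ γ t` only makes this insensitive to parametrizations that pause. -/
def Regular : Prop :=
  ∀ (x y : X) (γ : ℝ → X), chron x y → IsRealizer γ x y →
    ∀ s ∈ Icc (0 : ℝ) 1, ∀ t ∈ Icc (0 : ℝ) 1, s < t → γ s ≠ γ t → chron (γ s) (γ t)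

/-- Locally, every pair of timelike related points is joined by a distance realizer. -/
def LocallyHasRealizers : Prop :=
  ∀ p : X, ∃ U : Set X, IsOpen U ∧ p ∈ U ∧
    ∀ x ∈ U, ∀ y ∈ U, chron x y → ∃ γ : ℝ → X, IsRealizer γ x y

end LorentzianPreLengthSpace

/-! ### The comparison spaces `𝕃²_K` -/

/-- The diameter bound `D_K`: `π / √(-K)` for `K < 0`, and `∞` for `K ≥ 0`. -/
def diamBound (K : ℝ) : ℝ≥0∞ :=
  if K < 0 then ENNReal.ofReal (Real.pi / √(-K)) else ⊤

/-- The simply connected Lorentzian surface of constant curvature `K`, in global coordinates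
`(t, x) ∈ ℝ²` with `∂ₜ` future directed and with the metric
* `-dt² + dx²` for `K = 0` (Minkowski plane),
* `K⁻¹ (-dt² + cosh² t dx²)` for `K > 0` (scaled de Sitter space, unrolled),
* `(-K)⁻¹ (-cosh² x dt² + dx²)` for `K < 0` (scaled anti-de Sitter space, unrolled).
The curvature only enters through the functions below. -/
abbrev Model : Type := ℝ × ℝ

namespace Model

/-- The standard map of the surface to `ℝ³`, written `(w, t, x)`: onto the affine plane `w = 1` for
`K = 0`, to the pseudosphere `w² + x² - t² = 1` for `K > 0`, and to `w² + t² - x² = 1` for `K < 0`.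
Geodesics are the components of the preimages of the planes through the origin. -/
def emb (K : ℝ) (p : Model) : Fin 3 → ℝ :=
  if K = 0 then ![1, p.1, p.2]
  else if 0 < K then
    ![Real.cosh p.1 * Real.cos p.2, Real.sinh p.1, Real.cosh p.1 * Real.sin p.2]
  else
    ![Real.cosh p.2 * Real.cos p.1, Real.cosh p.2 * Real.sin p.1, Real.sinh p.2]

/-- The ambient bilinear form evaluated on two points (used for `K ≠ 0`). -/
def form (K : ℝ) (p q : Model) : ℝ :=
  if 0 < K then emb K p 0 * emb K q 0 - emb K p 1 * emb K q 1 + emb K p 2 * emb K q 2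
  else emb K p 0 * emb K q 0 + emb K p 1 * emb K q 1 - emb K p 2 * emb K q 2

/-- Gudermannian function, the primitive of `1 / cosh` vanishing at `0`. -/
def gd (s : ℝ) : ℝ := Real.arctan (Real.sinh s)

/-- Coordinates in which the metric is a positive multiple of `-dη² + dξ²`. -/
def conf (K : ℝ) (p : Model) : ℝ × ℝ :=
  if K = 0 then p else if 0 < K then (gd p.1, p.2) else (p.1, gd p.2)

/-- The causal relation of `𝕃²_K`. -/
def causal (K : ℝ) (p q : Model) : Prop :=
  |(conf K q).2 - (conf K p).2| ≤ (conf K q).1 - (conf K p).1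

open Classical in
/-- The time separation of `𝕃²_K`. For `K < 0` it is infinite between causally related points that
lie beyond the light cone refocusing at the antipode. -/
def tau (K : ℝ) (p q : Model) : ℝ≥0∞ :=
  if ¬ causal K p q then 0
  else if K = 0 then ENNReal.ofReal √((q.1 - p.1) ^ 2 - (q.2 - p.2) ^ 2)
  else if 0 < K then ENNReal.ofReal (Real.arcosh (form K p q) / √K)
  else if q.1 - p.1 ≤ Real.pi ∧ -1 ≤ form K p q then
    ENNReal.ofReal (Real.arccos (form K p q) / √(-K))
  else ⊤

/-- For timelike related `p, q`, and `r` causally related to one of them, the sign tells on which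
side of the geodesic line through `p` and `q` the point `r` lies; it is `0` on the line. -/
def side (K : ℝ) (p q r : Model) : ℝ :=
  Matrix.det !![emb K p 0, emb K p 1, emb K p 2;
                emb K q 0, emb K q 1, emb K q 2;
                emb K r 0, emb K r 1, emb K r 2]

/-- `r` and `r'` are not strictly on the same side of the line through `p, q`. -/
def OppositeSides (K : ℝ) (p q r r' : Model) : Prop := side K p q r * side K p q r' ≤ 0

/-- `r` and `r'` are not strictly on different sides of the line through `p, q`. -/
def SameSide (K : ℝ) (p q r r' : Model) : Prop := 0 ≤ side K p q r * side K p q r'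

end Model

/-! ### Midpoints -/

/-- `m` is a `μ`-midpoint of `a` and `b` with respect to the time separation `τ`. -/
def IsMuMidpoint {Y : Type*} (τ : Y → Y → ℝ≥0∞) (μ : ℝ) (a b m : Y) : Prop :=
  τ a m = ENNReal.ofReal μ * τ a b ∧ τ m b = ENNReal.ofReal (1 - μ) * τ a b

/-- `m` is an `ε`-`μ`-midpoint of `a` and `b`: `|τ(a,m) - μ τ(a,b)| < ε` and
`|τ(m,b) - (1-μ) τ(a,b)| < ε`, written without subtraction. -/
def IsEpsMuMidpoint {Y : Type*} (τ : Y → Y → ℝ≥0∞) (ε : ℝ≥0) (μ : ℝ) (a b m : Y) : Prop :=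
  (τ a m < ENNReal.ofReal μ * τ a b + ε ∧ ENNReal.ofReal μ * τ a b < τ a m + ε) ∧
  (τ m b < ENNReal.ofReal (1 - μ) * τ a b + ε ∧ ENNReal.ofReal (1 - μ) * τ a b < τ m b + ε)

/-! ### Upper curvature bounds -/

namespace LorentzianPreLengthSpace

variable {X : Type*} [MetricSpace X] [LorentzianPreLengthSpace X]

/-- `τ` is continuous on `(U × U) ∩ τ⁻¹([0, D_K))` and this set is open. -/
def TauContinuousBelow (K : ℝ) (U : Set X) : Prop :=
  ContinuousOn (fun p : X × X => tau p.1 p.2)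
      {p : X × X | p.1 ∈ U ∧ p.2 ∈ U ∧ tau p.1 p.2 < diamBound K} ∧
    IsOpen {p : X × X | p.1 ∈ U ∧ p.2 ∈ U ∧ tau p.1 p.2 < diamBound K}

/-- `(x', y', z')` is a comparison triangle in `𝕃²_K` for `x ≤ y ≤ z`. -/
structure IsComparisonTriangle (K : ℝ) (x y z : X) (x' y' z' : Model) : Prop where
  causal_xy : Model.causal K x' y'
  causal_yz : Model.causal K y' z'
  tau_xy : Model.tau K x' y' = tau x y
  tau_yz : Model.tau K y' z' = tau y z
  tau_xz : Model.tau K x' z' = tau x z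

/-- The point `m'` lies on the segment from `a'` to `b'` in `𝕃²_K` (the comparison segment of a
timelike side from `a` to `b`) and is the comparison point of `m` on that side. -/
structure IsComparisonPoint (K : ℝ) (a b m : X) (a' b' m' : Model) : Prop where
  causal_am : Model.causal K a' m'
  causal_mb : Model.causal K m' b'
  tau_am : Model.tau K a' m' = tau a m
  tau_mb : Model.tau K m' b' = tau m b

/-- One-sided comparison of all points on timelike sides from `a` to `b` with the vertex `c`. -/
def SideComparison (K : ℝ) (U : Set X) (a b c : X) (a' b' c' : Model) : Prop :=
  chron a b → ∀ γ : ℝ → X, IsRealizer γ a b → (∀ s ∈ Icc (0 : ℝ) 1, γ s ∈ U) →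
    ∀ s ∈ Icc (0 : ℝ) 1, ∀ m' : Model, IsComparisonPoint K a b (γ s) a' b' m' →
      Model.tau K c' m' ≤ tau c (γ s) ∧ Model.tau K m' c' ≤ tau (γ s) c

variable (X)

/-- Timelike upper curvature bound `K` in the sense of the one-sided triangle comparison. -/
def UpperTriangleBound (K : ℝ) : Prop :=
  ∀ p : X, ∃ U : Set X, IsOpen U ∧ p ∈ U ∧ TauContinuousBelow K U ∧
    (∀ x ∈ U, ∀ y ∈ U, chron x y →
      ∃ γ : ℝ → X, IsRealizer γ x y ∧ ∀ s ∈ Icc (0 : ℝ) 1, γ s ∈ U) ∧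
    ∀ x ∈ U, ∀ y ∈ U, ∀ z ∈ U, causal x y → causal y z → tau x z < diamBound K →
      ∀ x' y' z' : Model, IsComparisonTriangle K x y z x' y' z' →
        SideComparison K U x y z x' y' z' ∧
        SideComparison K U y z x y' z' x' ∧
        SideComparison K U x z y x' z' y'

/-- Timelike upper curvature bound `K` in the sense of the four-point condition. -/
def UpperFourPointBound (K : ℝ) : Prop :=
  ∀ p : X, ∃ U : Set X, IsOpen U ∧ p ∈ U ∧ TauContinuousBelow K U ∧
    ∀ x₁ ∈ U, ∀ x₂ ∈ U, ∀ x₃ ∈ U, ∀ x₄ ∈ U,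
      chron x₁ x₂ → chron x₂ x₃ → chron x₃ x₄ → tau x₁ x₄ < diamBound K →
      (∀ y₁ y₂ y₃ y₄ : Model,
        IsComparisonTriangle K x₁ x₂ x₄ y₁ y₂ y₄ → IsComparisonTriangle K x₁ x₃ x₄ y₁ y₃ y₄ →
        Model.OppositeSides K y₁ y₄ y₂ y₃ → Model.tau K y₂ y₃ ≤ tau x₂ x₃) ∧
      (∀ y₁ y₂ y₃ y₄ : Model,
        IsComparisonTriangle K x₁ x₂ x₃ y₁ y₂ y₃ → IsComparisonTriangle K x₂ x₃ x₄ y₂ y₃ y₄ →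
        Model.SameSide K y₂ y₃ y₁ y₄ → tau x₁ x₄ ≤ Model.tau K y₁ y₄)

variable {X}

/-- One-sided comparison, up to the error `f ε`, of all `ε`-`μ`-midpoints of `a ≪ b` that are
timelike related to the vertex `c`. -/
def EpsMuComparison (K : ℝ) (U : Set X) (μ : ℝ) (f : ℝ≥0 → ℝ≥0) (a b c : X)
    (a' b' c' : Model) : Prop :=
  ∀ ε : ℝ≥0, 0 < ε → ∀ m ∈ U, IsEpsMuMidpoint tau ε μ a b m → (chron c m ∨ chron m c) →
    ∀ m' : Model, IsMuMidpoint (Model.tau K) μ a' b' m' →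
      Model.tau K c' m' ≤ tau c m + f ε ∧ Model.tau K m' c' ≤ tau m c + f ε

variable (X)

/-- Timelike upper curvature bound `K` in the sense of the one-sided `ε`-`μ` triangle condition. -/
def UpperEpsMuBound (K : ℝ) : Prop :=
  ∀ p : X, ∃ U : Set X, IsOpen U ∧ p ∈ U ∧ TauContinuousBelow K U ∧
    ∀ x ∈ U, ∀ y ∈ U, ∀ z ∈ U, chron x y → chron y z → tau x z < diamBound K →
      ∀ μ : ℝ, 0 < μ → μ < 1 →
        ∃ f : ℝ≥0 → ℝ≥0, Tendsto f (𝓝[>] 0) (𝓝 0) ∧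
          ∀ x' y' z' : Model, IsComparisonTriangle K x y z x' y' z' →
            EpsMuComparison K U μ f x y z x' y' z' ∧
            EpsMuComparison K U μ f y z x y' z' x' ∧
            EpsMuComparison K U μ f x z y x' z' y'

end LorentzianPreLengthSpace

end

/-! ### Generalized trigonometric functions -/

namespace Model

/-! The model side is reduced to algebra. Instead of a time separation `t` one uses the energy `md K
t`. For model points this is, for `K ≠ 0`, an affine function of the ambient bilinear form on the
quadric, and it makes sense with a sign for spacelike pairs too. The Gram determinant identity
`hh_mul_E` expresses the energy of `r, s` by their energies to two base points `p, q` and by the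
signed volumes `vol`, whose squares are again functions of energies (`vol_sq`). On a segment the
volume vanishes and the identity becomes a Stewart formula (`E_eq_stewart`): the energy between a
point of a timelike segment and any third point is affine in the energies between that point and the
endpoints, with nonnegative weights. The sign of the energy detects causality for points that are
not too far apart (`causal_or_of_E_nonneg`), and nonnegativity of the Gram determinant gives the
reverse triangle inequality of the model (`toReal_add_le`). For `K < 0`, staying below `D_K` is
controlled by the future antipode.

Four-point to `ε`-`μ`: constructing the comparison configuration explicitly turns the two four-point
conditions into inequalities between energies in `X` alone (`four_point_opposite`,
`four_point_same`). If one of the points is an `ε`-`μ`-midpoint of a side, one of the two Gram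
determinants tends to zero with `ε`, so the inequality degenerates to the Stewart formula, which is
the desired comparison. No realizers are needed.

Triangle to four-point: in case (a) the segment `y₂ y₃` crosses the line `y₁ y₄`. A point of a
realizer from `x₁` to `x₄` at the height of the crossing is compared with `x₂` and with `x₃`, and
the reverse triangle inequality in `X` adds the two estimates. In case (b) the diagonals of the
model quadrilateral cross; a point of a realizer from `x₁` to `x₃` is compared with `x₂`, and with
`x₄` through a comparison triangle of `x₁ x₃ x₄`. Stewart's formula, monotone in each vertex energy,
then compares the energies of `x₁, x₄` and `y₁, y₄`. Both arguments need causal relations in `X`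
that only positive model separations provide, so the point is pushed slightly beyond the crossing
and then moved back in a limit; if no room is left on that side, time is reversed.

`ε`-`μ` to triangle: strong causality gives causally convex neighbourhoods, in which realizers stay.
Letting `ε` tend to zero gives the comparison for timelike triangles and points timelike related to
the opposite vertex (`EpsMuComparison.midpoint`). Two cases remain. A point of the long side
unrelated to the vertex is moved along the side until it becomes related; regularity and continuity
exclude a positive model separation (`tau_le_long_side_of_chron`). Null short sides are reached by
approximating the vertex along a timelike realizer (`stewart_le_energy`, `stewart_le_max`). -/

/-- The modified distance function: `md' = sn` and `md 0 = 0`. -/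
noncomputable def md (K t : ℝ) : ℝ :=
  if K = 0 then t ^ 2 / 2 else if 0 < K then (Real.cosh (√K * t) - 1) / K
  else (Real.cos (√(-K) * t) - 1) / K

/-- The generalized sine. -/
noncomputable def sn (K t : ℝ) : ℝ :=
  if K = 0 then t else if 0 < K then Real.sinh (√K * t) / √K else Real.sin (√(-K) * t) / √(-K)

/-- `t` is nonnegative and below the diameter bound. -/
def InRange (K t : ℝ) : Prop := 0 ≤ t ∧ (K < 0 → √(-K) * t < Real.pi)

theorem curvature_cases (K : ℝ) :
    K = 0 ∨ (∃ k : ℝ, 0 < k ∧ K = k ^ 2) ∨ ∃ k : ℝ, 0 < k ∧ K = -k ^ 2 := by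
  rcases lt_trichotomy K 0 with h | h | h
  · refine Or.inr (Or.inr ⟨√(-K), Real.sqrt_pos.2 (by linarith), ?_⟩)
    rw [Real.sq_sqrt (by linarith)]; ring
  · exact Or.inl h
  · exact Or.inr (Or.inl ⟨√K, Real.sqrt_pos.2 h, by rw [Real.sq_sqrt h.le]⟩)

theorem md_flat (t : ℝ) : md 0 t = t ^ 2 / 2 := by simp [md]
theorem sn_flat (t : ℝ) : sn 0 t = t := by simp [sn]

theorem md_pos_curv {k : ℝ} (hk : 0 < k) (t : ℝ) :
    md (k ^ 2) t = (Real.cosh (k * t) - 1) / k ^ 2 := by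
  have : 0 < k ^ 2 := by positivity
  simp [md, this, this.ne', Real.sqrt_sq hk.le]

theorem sn_pos_curv {k : ℝ} (hk : 0 < k) (t : ℝ) : sn (k ^ 2) t = Real.sinh (k * t) / k := by
  have : 0 < k ^ 2 := by positivity
  simp [sn, this, hk.ne', Real.sqrt_sq hk.le]

theorem md_neg_curv {k : ℝ} (hk : 0 < k) (t : ℝ) :
    md (-k ^ 2) t = (Real.cos (k * t) - 1) / (-k ^ 2) := by
  have : 0 < k ^ 2 := by positivity
  have h2 : ¬ (0 < -k ^ 2) := by linarith
  simp [md, h2, hk.ne', Real.sqrt_sq hk.le]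

theorem sn_neg_curv {k : ℝ} (hk : 0 < k) (t : ℝ) : sn (-k ^ 2) t = Real.sin (k * t) / k := by
  have : 0 < k ^ 2 := by positivity
  have h2 : ¬ (0 < -k ^ 2) := by linarith
  simp [sn, h2, hk.ne', Real.sqrt_sq hk.le]

theorem inRange_flat {t : ℝ} : InRange 0 t ↔ 0 ≤ t := by simp [InRange]

theorem inRange_pos_curv {k : ℝ} {t : ℝ} : InRange (k ^ 2) t ↔ 0 ≤ t := by
  have : ¬ (k ^ 2 < 0) := by have := sq_nonneg k; linarith
  simp [InRange, this]

theorem inRange_neg_curv {k : ℝ} (hk : 0 < k) {t : ℝ} :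
    InRange (-k ^ 2) t ↔ 0 ≤ t ∧ k * t < Real.pi := by
  have : 0 < k ^ 2 := by positivity
  have h3 : -k ^ 2 < 0 := by linarith
  rw [InRange, neg_neg, Real.sqrt_sq hk.le]
  exact ⟨fun h => ⟨h.1, h.2 h3⟩, fun h => ⟨h.1, fun _ => h.2⟩⟩

theorem InRange.mono {K s t : ℝ} (ht : InRange K t) (hs : 0 ≤ s) (hst : s ≤ t) : InRange K s :=
  ⟨hs, fun h => lt_of_le_of_lt (mul_le_mul_of_nonneg_left hst (Real.sqrt_nonneg _)) (ht.2 h)⟩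

theorem inRange_iff_lt_diamBound {K t : ℝ} (ht : 0 ≤ t) :
    InRange K t ↔ ENNReal.ofReal t < diamBound K := by
  unfold InRange diamBound
  split_ifs with h
  · have hs : 0 < √(-K) := Real.sqrt_pos.2 (by linarith)
    rw [ENNReal.ofReal_lt_ofReal_iff (by positivity), lt_div_iff₀ hs, mul_comm t]
    simp [h, ht]
  · simp [h, ht]

theorem inRange_toReal {K : ℝ} {a : ℝ≥0∞} (ha : a < diamBound K) : InRange K a.toReal := by
  rw [inRange_iff_lt_diamBound ENNReal.toReal_nonneg, ENNReal.ofReal_toReal ha.ne_top]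
  exact ha

@[simp] theorem md_zero (K : ℝ) : md K 0 = 0 := by simp [md]
@[simp] theorem sn_zero (K : ℝ) : sn K 0 = 0 := by simp [sn]
@[simp] theorem md_neg (K t : ℝ) : md K (-t) = md K t := by simp [md]
@[simp] theorem sn_neg (K t : ℝ) : sn K (-t) = -sn K t := by
  unfold sn; split_ifs <;> simp [neg_div]

theorem continuous_md (K : ℝ) : Continuous (md K) := by
  unfold md; split_ifs <;> fun_prop

theorem continuous_sn (K : ℝ) : Continuous (sn K) := by
  unfold sn; split_ifs <;> fun_prop

theorem md_add (K s t : ℝ) :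
    md K (s + t) = md K s + md K t + K * md K s * md K t + sn K s * sn K t := by
  rcases curvature_cases K with rfl | ⟨k, hk, rfl⟩ | ⟨k, hk, rfl⟩
  · simp only [md_flat, sn_flat]; ring
  · simp only [md_pos_curv hk, sn_pos_curv hk, mul_add, Real.cosh_add]; field_simp; ring
  · simp only [md_neg_curv hk, sn_neg_curv hk, mul_add, Real.cos_add]; field_simp; ring

theorem sn_add (K s t : ℝ) :
    sn K (s + t) = sn K s * (1 + K * md K t) + sn K t * (1 + K * md K s) := by
  rcases curvature_cases K with rfl | ⟨k, hk, rfl⟩ | ⟨k, hk, rfl⟩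
  · simp only [md_flat, sn_flat]; ring
  · simp only [md_pos_curv hk, sn_pos_curv hk, mul_add, Real.sinh_add]; field_simp; ring
  · simp only [md_neg_curv hk, sn_neg_curv hk, mul_add, Real.sin_add]; field_simp; ring

theorem md_sub (K s t : ℝ) :
    md K (s - t) = md K s + md K t + K * md K s * md K t - sn K s * sn K t := by
  rw [sub_eq_add_neg, md_add]; simp; ring

theorem sn_sub (K s t : ℝ) :
    sn K (s - t) = sn K s * (1 + K * md K t) - sn K t * (1 + K * md K s) := by
  rw [sub_eq_add_neg, sn_add]; simp; ring

theorem sn_sq (K t : ℝ) : sn K t ^ 2 = md K t * (2 + K * md K t) := by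
  have h := md_sub K t t
  simp at h
  linear_combination h

theorem md_nonneg (K t : ℝ) : 0 ≤ md K t := by
  rcases curvature_cases K with rfl | ⟨k, hk, rfl⟩ | ⟨k, hk, rfl⟩
  · rw [md_flat]; positivity
  · rw [md_pos_curv hk]
    have := Real.one_le_cosh (k * t)
    exact div_nonneg (by linarith) (by positivity)
  · rw [md_neg_curv hk]
    have := Real.cos_le_one (k * t)
    exact div_nonneg_of_nonpos (by linarith) (by nlinarith)

theorem sn_pos {K t : ℝ} (ht : InRange K t) (h0 : 0 < t) : 0 < sn K t := by
  rcases curvature_cases K with rfl | ⟨k, hk, rfl⟩ | ⟨k, hk, rfl⟩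
  · rwa [sn_flat]
  · rw [sn_pos_curv hk]
    exact div_pos (Real.sinh_pos_iff.2 (by positivity)) hk
  · rw [sn_neg_curv hk]
    rw [inRange_neg_curv hk] at ht
    exact div_pos (Real.sin_pos_of_pos_of_lt_pi (by positivity) ht.2) hk

theorem sn_nonneg {K t : ℝ} (ht : InRange K t) : 0 ≤ sn K t := by
  rcases ht.1.eq_or_lt with h | h
  · simp [← h]
  · exact (sn_pos ht h).le

theorem two_add_mul_md_pos {K t : ℝ} (ht : InRange K t) : 0 < 2 + K * md K t := by
  rcases curvature_cases K with rfl | ⟨k, hk, rfl⟩ | ⟨k, hk, rfl⟩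
  · norm_num
  · have := md_nonneg (k ^ 2) t; positivity
  · rw [md_neg_curv hk, mul_div_cancel₀ _ (by nlinarith [sq_pos_of_pos hk] : -k ^ 2 ≠ 0)]
    rw [inRange_neg_curv hk] at ht
    have h1 : Real.cos Real.pi < Real.cos (k * t) :=
      Real.cos_lt_cos_of_nonneg_of_le_pi (mul_nonneg hk.le ht.1) le_rfl ht.2
    rw [Real.cos_pi] at h1
    linarith

theorem md_lt_md_of_le_pi {K s t : ℝ} (hs : 0 ≤ s) (ht : K < 0 → √(-K) * t ≤ Real.pi)
    (h : s < t) : md K s < md K t := by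
  rcases curvature_cases K with rfl | ⟨k, hk, rfl⟩ | ⟨k, hk, rfl⟩
  · simp only [md_flat]; nlinarith
  · simp only [md_pos_curv hk]
    have : Real.cosh (k * s) < Real.cosh (k * t) := by
      rw [Real.cosh_lt_cosh, abs_of_nonneg (by positivity), abs_of_nonneg (by nlinarith)]
      nlinarith
    exact div_lt_div_of_pos_right (by linarith) (by positivity)
  · simp only [md_neg_curv hk]
    have ht := ht (by nlinarith)
    rw [neg_neg, Real.sqrt_sq hk.le] at ht
    have : Real.cos (k * t) < Real.cos (k * s) :=
      Real.cos_lt_cos_of_nonneg_of_le_pi (by positivity) ht (by nlinarith)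
    rw [div_neg, div_neg, neg_lt_neg_iff]
    exact div_lt_div_of_pos_right (by linarith) (by positivity)

theorem md_lt_md {K s t : ℝ} (hs : 0 ≤ s) (ht : InRange K t) (h : s < t) : md K s < md K t :=
  md_lt_md_of_le_pi hs (fun hK => (ht.2 hK).le) h

theorem md_le_md {K s t : ℝ} (hs : 0 ≤ s) (ht : InRange K t) (h : s ≤ t) : md K s ≤ md K t := by
  rcases h.eq_or_lt with rfl | h
  · rfl
  · exact (md_lt_md hs ht h).le

theorem le_of_md_le {K s t : ℝ} (hs : InRange K s) (ht : 0 ≤ t) (h : md K s ≤ md K t) : s ≤ t := by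
  by_contra hc
  exact absurd (md_lt_md ht hs (not_le.1 hc)) (not_lt.2 h)

theorem md_inj {K s t : ℝ} (hs : InRange K s) (ht : InRange K t) (h : md K s = md K t) : s = t :=
  le_antisymm (le_of_md_le hs ht.1 h.le) (le_of_md_le ht hs.1 h.ge)

theorem md_pos {K t : ℝ} (ht : InRange K t) (h : 0 < t) : 0 < md K t := by
  simpa using md_lt_md le_rfl ht h

/-- For `K < 0` the second condition keeps `e` below `-2 / K`, the energy of antipodal points, where
the range of `md` on `[0, D_K)` ends. For `K ≥ 0` it is automatic. -/
theorem exists_md_eq {K e : ℝ} (he : 0 ≤ e) (h2 : 0 < 2 + K * e) :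
    ∃ t, InRange K t ∧ md K t = e := by
  rcases curvature_cases K with rfl | ⟨k, hk, rfl⟩ | ⟨k, hk, rfl⟩
  · refine ⟨√(2 * e), inRange_flat.2 (Real.sqrt_nonneg _), ?_⟩
    rw [md_flat, Real.sq_sqrt (by linarith)]; ring
  · have h1 : 1 ≤ 1 + k ^ 2 * e := by nlinarith [mul_nonneg (sq_nonneg k) he]
    refine ⟨Real.arcosh (1 + k ^ 2 * e) / k,
      inRange_pos_curv.2 (div_nonneg (Real.arcosh_nonneg h1) hk.le), ?_⟩
    rw [md_pos_curv hk, mul_div_cancel₀ _ hk.ne', Real.cosh_arcosh h1]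
    field_simp; ring
  · have h1 : 1 + -k ^ 2 * e ≤ 1 := by nlinarith [mul_nonneg (sq_nonneg k) he]
    refine ⟨Real.arccos (1 + -k ^ 2 * e) / k, (inRange_neg_curv hk).2
      ⟨div_nonneg (Real.arccos_nonneg _) hk.le, ?_⟩, ?_⟩
    · rw [mul_div_cancel₀ _ hk.ne']
      refine lt_of_le_of_ne (Real.arccos_le_pi _) fun h => ?_
      rw [Real.arccos_eq_pi] at h
      linarith
    · rw [md_neg_curv hk, mul_div_cancel₀ _ hk.ne', Real.cos_arccos (by linarith) h1]
      field_simp; ring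

/-- `h(e) = e (2 + K e)`, so that `h (md t) = (sn t)²`. -/
def hh (K e : ℝ) : ℝ := e * (2 + K * e)

theorem hh_md (K t : ℝ) : hh K (md K t) = sn K t ^ 2 := by rw [sn_sq, hh]

end Model

/-! ### Ambient coordinates and the algebra of configurations -/

namespace Model

/-- Scale between the coordinates of `emb` and unit speed coordinates. -/
noncomputable def scale (K : ℝ) : ℝ := if K = 0 then 1 else √|K|

/-- Scaled ambient coordinates, on the quadric `w² + K (x² - t²) = 1`. -/
noncomputable def ambW (K : ℝ) (p : Model) : ℝ := emb K p 0
noncomputable def ambT (K : ℝ) (p : Model) : ℝ := emb K p 1 / scale K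
noncomputable def ambX (K : ℝ) (p : Model) : ℝ := emb K p 2 / scale K

/-- The energy of a pair of points: `md (τ p q)` for causally related points. -/
noncomputable def E (K : ℝ) (p q : Model) : ℝ :=
  if K = 0 then ((q.1 - p.1) ^ 2 - (q.2 - p.2) ^ 2) / 2 else (form K p q - 1) / K

/-- The signed volume of three points in scaled coordinates. -/
noncomputable def vol (K : ℝ) (p q r : Model) : ℝ :=
  ambW K p * (ambT K q * ambX K r - ambX K q * ambT K r)
    - ambT K p * (ambW K q * ambX K r - ambX K q * ambW K r)
    + ambX K p * (ambW K q * ambT K r - ambT K q * ambW K r)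

theorem scale_flat : scale 0 = 1 := by simp [scale]

theorem scale_pos_curv {k : ℝ} (hk : 0 < k) : scale (k ^ 2) = k := by
  simp [scale, hk.ne', Real.sqrt_sq hk.le]

theorem scale_neg_curv {k : ℝ} (hk : 0 < k) : scale (-k ^ 2) = k := by
  simp [scale, hk.ne', Real.sqrt_sq hk.le]

theorem scale_pos (K : ℝ) : 0 < scale K := by
  rcases curvature_cases K with rfl | ⟨k, hk, rfl⟩ | ⟨k, hk, rfl⟩
  · simp [scale_flat]
  · rwa [scale_pos_curv hk]
  · rwa [scale_neg_curv hk]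

theorem emb_flat (p : Model) : emb 0 p = ![1, p.1, p.2] := by simp [emb]

theorem emb_pos_curv {k : ℝ} (hk : 0 < k) (p : Model) : emb (k ^ 2) p =
    ![Real.cosh p.1 * Real.cos p.2, Real.sinh p.1, Real.cosh p.1 * Real.sin p.2] := by
  have : 0 < k ^ 2 := by positivity
  simp [emb, hk.ne', this]

theorem emb_neg_curv {k : ℝ} (hk : 0 < k) (p : Model) : emb (-k ^ 2) p =
    ![Real.cosh p.2 * Real.cos p.1, Real.cosh p.2 * Real.sin p.1, Real.sinh p.2] := by
  have h2 : ¬ (0 < -k ^ 2) := by nlinarith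
  simp [emb, hk.ne', h2]

theorem form_pos_curv {k : ℝ} (hk : 0 < k) (p q : Model) : form (k ^ 2) p q =
    Real.cosh p.1 * Real.cosh q.1 * Real.cos (q.2 - p.2) - Real.sinh p.1 * Real.sinh q.1 := by
  have : 0 < k ^ 2 := by positivity
  simp only [form, this, if_true, emb_pos_curv hk, Real.cos_sub]
  simp; ring

theorem form_neg_curv {k : ℝ} (hk : 0 < k) (p q : Model) : form (-k ^ 2) p q =
    Real.cosh p.2 * Real.cosh q.2 * Real.cos (q.1 - p.1) - Real.sinh p.2 * Real.sinh q.2 := by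
  have h2 : ¬ (0 < -k ^ 2) := by nlinarith
  simp only [form, h2, if_false, emb_neg_curv hk, Real.cos_sub]
  simp; ring

theorem ambW_flat (p : Model) : ambW 0 p = 1 := by simp [ambW, emb_flat]
theorem ambT_flat (p : Model) : ambT 0 p = p.1 := by simp [ambT, emb_flat, scale_flat]
theorem ambX_flat (p : Model) : ambX 0 p = p.2 := by simp [ambX, emb_flat, scale_flat]

theorem quadric (K : ℝ) (p : Model) : ambW K p ^ 2 + K * (ambX K p ^ 2 - ambT K p ^ 2) = 1 := by
  rcases curvature_cases K with rfl | ⟨k, hk, rfl⟩ | ⟨k, hk, rfl⟩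
  · simp [ambW_flat]
  · simp only [ambW, ambX, ambT, emb_pos_curv hk, scale_pos_curv hk]
    have h1 := Real.cosh_sq p.1
    have h2 := Real.sin_sq_add_cos_sq p.2
    simp; field_simp
    linear_combination (Real.cosh p.1) ^ 2 * h2 + h1
  · simp only [ambW, ambX, ambT, emb_neg_curv hk, scale_neg_curv hk]
    have h1 := Real.cosh_sq p.2
    have h2 := Real.sin_sq_add_cos_sq p.1
    simp; field_simp
    linear_combination (Real.cosh p.2) ^ 2 * h2 + h1

theorem form_eq {K : ℝ} (hK : K ≠ 0) (p q : Model) : form K p q =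
    ambW K p * ambW K q + K * (ambX K p * ambX K q - ambT K p * ambT K q) := by
  rcases curvature_cases K with rfl | ⟨k, hk, rfl⟩ | ⟨k, hk, rfl⟩
  · exact absurd rfl hK
  · have : 0 < k ^ 2 := by positivity
    simp only [form, this, if_true, ambW, ambX, ambT, scale_pos_curv hk]
    field_simp; ring
  · have h2 : ¬ (0 < -k ^ 2) := by nlinarith
    simp only [form, h2, if_false, ambW, ambX, ambT, scale_neg_curv hk]
    field_simp; ring

theorem E_flat (p q : Model) : E 0 p q = ((q.1 - p.1) ^ 2 - (q.2 - p.2) ^ 2) / 2 := by simp [E]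

theorem E_eq_form {K : ℝ} (hK : K ≠ 0) (p q : Model) : E K p q = (form K p q - 1) / K := by
  simp [E, hK]

/-- The bilinear form on scaled ambient coordinates. -/
theorem one_add_mul_E (K : ℝ) (p q : Model) : 1 + K * E K p q =
    ambW K p * ambW K q + K * (ambX K p * ambX K q - ambT K p * ambT K q) := by
  by_cases hK : K = 0
  · subst hK; simp [ambW_flat]
  · rw [E_eq_form hK, ← form_eq hK]; field_simp; ring

theorem form_eq_E {K : ℝ} (hK : K ≠ 0) (p q : Model) : form K p q = 1 + K * E K p q := by
  rw [one_add_mul_E, form_eq hK]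

theorem E_comm (K : ℝ) (p q : Model) : E K p q = E K q p := by
  by_cases hK : K = 0
  · subst hK; simp only [E_flat]; ring
  · have h1 := one_add_mul_E K p q
    have h2 := one_add_mul_E K q p
    exact mul_left_cancel₀ hK (by linear_combination h1 - h2)

theorem E_self (K : ℝ) (p : Model) : E K p p = 0 := by
  by_cases hK : K = 0
  · subst hK; simp [E_flat]
  · exact mul_left_cancel₀ hK (by linear_combination one_add_mul_E K p p + quadric K p)

theorem side_eq_vol (K : ℝ) (p q r : Model) : side K p q r = scale K ^ 2 * vol K p q r := by
  have hs := (scale_pos K).ne'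
  simp only [side, vol, ambW, ambT, ambX, Matrix.det_fin_three]
  simp
  field_simp
  ring

theorem side_mul_nonneg {K : ℝ} {p q r r' : Model} :
    SameSide K p q r r' ↔ 0 ≤ vol K p q r * vol K p q r' := by
  have hs := scale_pos K
  rw [SameSide, side_eq_vol, side_eq_vol, show scale K ^ 2 * vol K p q r * (scale K ^ 2 *
    vol K p q r') = scale K ^ 4 * (vol K p q r * vol K p q r') by ring]
  exact mul_nonneg_iff_of_pos_left (by positivity)

theorem side_mul_nonpos {K : ℝ} {p q r r' : Model} :
    OppositeSides K p q r r' ↔ vol K p q r * vol K p q r' ≤ 0 := by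
  have hs := scale_pos K
  rw [OppositeSides, side_eq_vol, side_eq_vol, show scale K ^ 2 * vol K p q r * (scale K ^ 2 *
    vol K p q r') = scale K ^ 4 * (vol K p q r * vol K p q r') by ring]
  rw [← neg_nonneg, ← mul_neg, mul_nonneg_iff_of_pos_left (by positivity), neg_nonneg]

/-- Time component, up to the factor `sn (τ p q)`, of a point seen from `p` along the line to `q`,
in terms of energies: `g = E p q`, `a = E p r`, `b = E q r`. -/
def tc (K g a b : ℝ) : ℝ := a + g + K * a * g - b

/-- Squared distance to the line, up to the factor `hh g`. -/
def gram (K g a b : ℝ) : ℝ := tc K g a b ^ 2 - hh K g * hh K a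

/-- The energy of two points on a common line through the base, up to the factor `hh g`. -/
def polar (K g a b a' b' : ℝ) : ℝ :=
  hh K g * (a + a' + K * a * a') - tc K g a b * tc K g a' b'

/-- This is the determinant of the mixed Gram matrix of `p, q, r` against `p, q, s`: it factors as
the product of the two volumes times the determinant `-K ^ 2` of the ambient form, and expanding it
in energies gives the other terms. Dividing by `K ^ 2` makes the flat case a separate polynomial
identity. -/
theorem hh_mul_E (K : ℝ) (p q r s : Model) : hh K (E K p q) * E K r s =
    vol K p q r * vol K p q s +
      polar K (E K p q) (E K p r) (E K q r) (E K p s) (E K q s) := by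
  by_cases hK : K = 0
  · subst hK
    simp only [hh, polar, tc, vol, E_flat, ambW_flat, ambT_flat, ambX_flat]; ring
  · have key : K ^ 2 * (vol K p q r * vol K p q s) = -Matrix.det
        !![ambW K p * ambW K p + K * (ambX K p * ambX K p - ambT K p * ambT K p),
           ambW K p * ambW K q + K * (ambX K p * ambX K q - ambT K p * ambT K q),
           ambW K p * ambW K s + K * (ambX K p * ambX K s - ambT K p * ambT K s);
           ambW K p * ambW K q + K * (ambX K p * ambX K q - ambT K p * ambT K q),
           ambW K q * ambW K q + K * (ambX K q * ambX K q - ambT K q * ambT K q),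
           ambW K q * ambW K s + K * (ambX K q * ambX K s - ambT K q * ambT K s);
           ambW K p * ambW K r + K * (ambX K p * ambX K r - ambT K p * ambT K r),
           ambW K q * ambW K r + K * (ambX K q * ambX K r - ambT K q * ambT K r),
           ambW K r * ambW K s + K * (ambX K r * ambX K s - ambT K r * ambT K s)] := by
      rw [Matrix.det_fin_three]; simp [vol]; ring
    simp only [← one_add_mul_E, E_self] at key
    rw [Matrix.det_fin_three] at key
    simp at key
    have hK2 : K ^ 2 ≠ 0 := pow_ne_zero 2 hK
    refine mul_left_cancel₀ hK2 ?_
    simp only [hh, polar, tc]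
    linear_combination -key

theorem vol_sq (K : ℝ) (p q r : Model) :
    vol K p q r ^ 2 = gram K (E K p q) (E K p r) (E K q r) := by
  have h := hh_mul_E K p q r r
  rw [E_self] at h
  simp only [gram, polar, hh, tc] at *
  linear_combination -h

/-- Cramer's rule: the linear dependence of four vectors in `ℝ³`. It is arranged with `p, r` on one
side and `q, s` on the other, so that it describes the crossing of the lines `p r` and `q s`. -/
theorem vol_relation (K : ℝ) (p q r s : Model) :
    (vol K q r s * ambW K p + vol K p q s * ambW K r =
      vol K p r s * ambW K q + vol K p q r * ambW K s) ∧
    (vol K q r s * ambT K p + vol K p q s * ambT K r =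
      vol K p r s * ambT K q + vol K p q r * ambT K s) ∧
    (vol K q r s * ambX K p + vol K p q s * ambX K r =
      vol K p r s * ambX K q + vol K p q r * ambX K s) := by
  refine ⟨?_, ?_, ?_⟩ <;> simp only [vol] <;> ring

/-- Defect of `E p r` over the degenerate value for a chain `p, q, r`. -/
noncomputable def defect (K : ℝ) (p q r : Model) : ℝ :=
  E K p r - E K p q - E K q r - K * E K p q * E K q r

/-- For `K ≠ 0`, `K * defect K y r c` is `⟨y, c⟩ - ⟨y, r⟩ ⟨r, c⟩`, which is linear in the ambient
vector `y` and vanishes at `y = r`. Applied to the dependence of `p, q, r, s` it eliminates the `r`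
term. It is used to transport signs between volumes. -/
theorem vol_defect (K : ℝ) (p q r s c : Model) :
    vol K q r s * defect K p r c =
      vol K p r s * defect K q r c + vol K p q r * defect K s r c := by
  obtain ⟨h1, h2, h3⟩ := vol_relation K p q r s
  by_cases hK : K = 0
  · subst hK
    simp only [defect, vol, E_flat, ambW_flat, ambT_flat, ambX_flat]; ring
  · have e : ∀ y, K * defect K y r c = (1 + K * E K y c) - (1 + K * E K y r) * (1 + K * E K r c) :=
      fun y => by simp only [defect]; ring
    refine mul_left_cancel₀ hK ?_
    have : vol K q r s * (K * defect K p r c) =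
      vol K p r s * (K * defect K q r c) + vol K p q r * (K * defect K s r c) := by
      have hr : 1 + K * E K r r = 1 := by rw [E_self]; ring
      have e0 := e r
      rw [e, e, e]
      rw [hr] at e0
      simp only [one_add_mul_E] at *
      set A := ambW K r * ambW K c + K * (ambX K r * ambX K c - ambT K r * ambT K c)
      linear_combination (ambW K c - ambW K r * A) * h1 +
        (-K * (ambT K c - ambT K r * A)) * h2 + K * (ambX K c - ambX K r * A) * h3
        + vol K p q s * A * hr
    linear_combination this

/-! ### Time reversal -/

/-- Time reversal. -/
def rev (p : Model) : Model := (-p.1, p.2)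

theorem gd_neg (s : ℝ) : gd (-s) = -gd s := by simp [gd]

theorem conf_rev (K : ℝ) (p : Model) : conf K (rev p) = (-(conf K p).1, (conf K p).2) := by
  unfold conf rev; split_ifs <;> simp [gd_neg]

@[simp] theorem causal_rev {K : ℝ} {p q : Model} : causal K (rev p) (rev q) ↔ causal K q p := by
  simp only [causal, conf_rev]
  rw [abs_sub_comm]
  constructor <;> intro h <;> linarith

theorem ambW_rev (K : ℝ) (p : Model) : ambW K (rev p) = ambW K p := by
  simp only [ambW, emb, rev]; split_ifs <;> simp

theorem ambT_rev (K : ℝ) (p : Model) : ambT K (rev p) = -ambT K p := by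
  simp only [ambT, emb, rev]; split_ifs <;> simp [neg_div]

theorem ambX_rev (K : ℝ) (p : Model) : ambX K (rev p) = ambX K p := by
  simp only [ambX, emb, rev]; split_ifs <;> simp

theorem E_rev (K : ℝ) (p q : Model) : E K (rev p) (rev q) = E K p q := by
  by_cases hK : K = 0
  · subst hK; simp only [E_flat, rev]; ring
  · have h1 := one_add_mul_E K p q
    have h2 := one_add_mul_E K (rev p) (rev q)
    simp only [ambW_rev, ambT_rev, ambX_rev] at h2
    exact mul_left_cancel₀ hK (by linear_combination h2 - h1)

@[simp] theorem tau_rev (K : ℝ) (p q : Model) : tau K (rev p) (rev q) = tau K q p := by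
  have hf : K ≠ 0 → form K (rev p) (rev q) = form K q p := fun h => by
    rw [form_eq_E h, form_eq_E h, E_rev, E_comm]
  have ht : (rev q).1 - (rev p).1 = p.1 - q.1 := by simp only [rev]; ring
  have hx : (rev q).2 - (rev p).2 = -(p.2 - q.2) := by simp only [rev]; ring
  by_cases hc : causal K q p
  · have hc' : causal K (rev p) (rev q) := causal_rev.2 hc
    by_cases hK : K = 0
    · rw [tau, tau, if_neg (not_not.2 hc'), if_neg (not_not.2 hc), if_pos hK, if_pos hK, ht, hx,
        neg_sq]
    · simp only [tau, hc, hc', hK, if_false, hf hK, ht]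
  · have hc' : ¬ causal K (rev p) (rev q) := fun h => hc (causal_rev.1 h)
    simp [tau, hc, hc']

end Model

/-! ### Causality and time separation of the model spaces -/

namespace Model

theorem abs_le_of_cos_le {a b : ℝ} (hb : 0 ≤ b) (ha : |a| ≤ Real.pi)
    (h : Real.cos b ≤ Real.cos a) : |a| ≤ b := by
  by_contra hc
  rw [not_le] at hc
  have := Real.cos_lt_cos_of_nonneg_of_le_pi hb ha hc
  rw [Real.cos_abs] at this
  linarith

theorem cos_le_of_abs_le {a b : ℝ} (hb : b ≤ Real.pi) (h : |a| ≤ b) :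
    Real.cos b ≤ Real.cos a := by
  rw [← Real.cos_abs a]
  exact Real.cos_le_cos_of_nonneg_of_le_pi (abs_nonneg a) hb h

theorem zero_le_div_iff {a b : ℝ} (hb : 0 < b) : 0 ≤ a / b ↔ 0 ≤ a := by
  rw [le_div_iff₀ hb, zero_mul]

theorem causal_refl (K : ℝ) (p : Model) : causal K p p := by simp [causal]

theorem causal_trans {K : ℝ} {p q r : Model} (h1 : causal K p q) (h2 : causal K q r) :
    causal K p r := by
  simp only [causal, abs_le] at *
  constructor <;> linarith

theorem cos_gd (s : ℝ) : Real.cos (gd s) = 1 / Real.cosh s := by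
  rw [gd, Real.cos_arctan, add_comm, ← Real.cosh_sq, Real.sqrt_sq (Real.cosh_pos s).le]

theorem sin_gd (s : ℝ) : Real.sin (gd s) = Real.sinh s / Real.cosh s := by
  rw [gd, Real.sin_arctan, add_comm, ← Real.cosh_sq, Real.sqrt_sq (Real.cosh_pos s).le]

theorem gd_lt (s : ℝ) : gd s < Real.pi / 2 := Real.arctan_lt_pi_div_two _
theorem lt_gd (s : ℝ) : -(Real.pi / 2) < gd s := Real.neg_pi_div_two_lt_arctan _

theorem conf_flat (p : Model) : conf 0 p = p := by simp [conf]

theorem conf_pos_curv {k : ℝ} (hk : 0 < k) (p : Model) : conf (k ^ 2) p = (gd p.1, p.2) := by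
  have : 0 < k ^ 2 := by positivity
  simp [conf, hk.ne', this]

theorem conf_neg_curv {k : ℝ} (hk : 0 < k) (p : Model) : conf (-k ^ 2) p = (p.1, gd p.2) := by
  have h2 : ¬ (0 < -k ^ 2) := by nlinarith
  simp [conf, hk.ne', h2]

theorem causal_flat {p q : Model} : causal 0 p q ↔ |q.2 - p.2| ≤ q.1 - p.1 := by
  simp [causal, conf_flat]

theorem causal_pos_curv {k : ℝ} (hk : 0 < k) {p q : Model} :
    causal (k ^ 2) p q ↔ |q.2 - p.2| ≤ gd q.1 - gd p.1 := by
  simp [causal, conf_pos_curv hk]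

theorem causal_neg_curv {k : ℝ} (hk : 0 < k) {p q : Model} :
    causal (-k ^ 2) p q ↔ |gd q.2 - gd p.2| ≤ q.1 - p.1 := by
  simp [causal, conf_neg_curv hk]

theorem cos_gd_pos (s : ℝ) : 0 < Real.cos (gd s) := by
  rw [cos_gd]; have := Real.cosh_pos s; positivity

/-- In conformal coordinates the energy is a difference of cosines of the coordinate differences
times a positive factor, so its sign compares these differences, which is what the causal relation
does. -/
theorem conformal_aux (a b c : ℝ) :
    Real.cosh a * Real.cosh b * Real.cos c - Real.sinh a * Real.sinh b - 1 =
      (Real.cos c - Real.cos (gd b - gd a)) / (Real.cos (gd a) * Real.cos (gd b)) := by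
  have ha := Real.cosh_pos a
  have hb := Real.cosh_pos b
  rw [Real.cos_sub, cos_gd, cos_gd, sin_gd, sin_gd]
  field_simp
  ring

theorem E_pos_curv {k : ℝ} (hk : 0 < k) (p q : Model) : E (k ^ 2) p q =
    (Real.cos (q.2 - p.2) - Real.cos (gd q.1 - gd p.1)) /
      (Real.cos (gd p.1) * Real.cos (gd q.1)) / k ^ 2 := by
  rw [E_eq_form (by positivity), form_pos_curv hk, conformal_aux]

theorem E_neg_curv {k : ℝ} (hk : 0 < k) (p q : Model) : E (-k ^ 2) p q =
    (Real.cos (gd q.2 - gd p.2) - Real.cos (q.1 - p.1)) /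
      (Real.cos (gd p.2) * Real.cos (gd q.2)) / k ^ 2 := by
  have : -k ^ 2 ≠ 0 := by simp [hk.ne']
  rw [E_eq_form this, form_neg_curv hk, conformal_aux, div_neg, ← neg_div, ← neg_div, neg_sub]

/-- The pair of points is so close that causality can be read off from the energy. -/
def Loc (K : ℝ) (p q : Model) : Prop :=
  (0 < K → |q.2 - p.2| ≤ Real.pi) ∧ (K < 0 → |q.1 - p.1| ≤ Real.pi)

theorem abs_gd_sub_le (a b : ℝ) : |gd a - gd b| ≤ Real.pi := by
  rw [abs_le]
  constructor <;> linarith [gd_lt a, gd_lt b, lt_gd a, lt_gd b]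

/-- Under `Loc` both conformal coordinate differences have absolute value at most `π`, where the
cosine is strictly decreasing and the comparison of cosines can be inverted. -/
theorem causal_or_of_E_nonneg {K : ℝ} {p q : Model} (hl : Loc K p q) (hE : 0 ≤ E K p q) :
    causal K p q ∨ causal K q p := by
  rcases curvature_cases K with rfl | ⟨k, hk, rfl⟩ | ⟨k, hk, rfl⟩
  · rw [causal_flat, causal_flat, abs_sub_comm p.2]
    rw [E_flat] at hE
    have : |q.2 - p.2| ≤ |q.1 - p.1| := sq_le_sq.1 (by linarith)
    rcases le_total 0 (q.1 - p.1) with h | h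
    · left; rwa [abs_of_nonneg h] at this
    · right; rw [abs_of_nonpos h] at this; linarith
  · rw [causal_pos_curv hk, causal_pos_curv hk, abs_sub_comm p.2]
    have hl := hl.1 (by positivity)
    rw [E_pos_curv hk, zero_le_div_iff (by positivity),
      zero_le_div_iff (mul_pos (cos_gd_pos _) (cos_gd_pos _)), sub_nonneg,
      ← Real.cos_abs (gd q.1 - gd p.1)] at hE
    have := abs_le_of_cos_le (abs_nonneg _) hl hE
    rcases le_total 0 (gd q.1 - gd p.1) with h | h
    · left; rwa [abs_of_nonneg h] at this
    · right; rw [abs_of_nonpos h] at this; linarith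
  · rw [causal_neg_curv hk, causal_neg_curv hk, abs_sub_comm (gd p.2)]
    have hl := hl.2 (by nlinarith)
    rw [E_neg_curv hk, zero_le_div_iff (by positivity),
      zero_le_div_iff (mul_pos (cos_gd_pos _) (cos_gd_pos _)), sub_nonneg,
      ← Real.cos_abs (q.1 - p.1)] at hE
    have := abs_le_of_cos_le (abs_nonneg _) (abs_gd_sub_le _ _) hE
    rcases le_total 0 (q.1 - p.1) with h | h
    · left; rwa [abs_of_nonneg h] at this
    · right; rw [abs_of_nonpos h] at this; linarith

theorem E_nonneg_of_causal {K : ℝ} {p q : Model} (hc : causal K p q)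
    (hl : K < 0 → q.1 - p.1 ≤ Real.pi) : 0 ≤ E K p q := by
  rcases curvature_cases K with rfl | ⟨k, hk, rfl⟩ | ⟨k, hk, rfl⟩
  · rw [causal_flat] at hc
    have : (q.2 - p.2) ^ 2 ≤ (q.1 - p.1) ^ 2 := sq_le_sq.2 (hc.trans (le_abs_self _))
    rw [E_flat]; linarith
  · rw [causal_pos_curv hk] at hc
    rw [E_pos_curv hk, zero_le_div_iff (by positivity),
      zero_le_div_iff (mul_pos (cos_gd_pos _) (cos_gd_pos _)), sub_nonneg]
    exact cos_le_of_abs_le ((le_abs_self _).trans (abs_gd_sub_le _ _)) hc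
  · rw [causal_neg_curv hk] at hc
    rw [E_neg_curv hk, zero_le_div_iff (by positivity),
      zero_le_div_iff (mul_pos (cos_gd_pos _) (cos_gd_pos _)), sub_nonneg]
    exact cos_le_of_abs_le (hl (by nlinarith)) hc

/-! ### Antipodes in negative curvature -/

/-- The antipode in the future, in negative curvature. -/
noncomputable def anti (p : Model) : Model := (p.1 + Real.pi, -p.2)

theorem E_anti {K : ℝ} (hK : K < 0) (p q : Model) : E K (anti p) q = -2 / K - E K p q := by
  obtain rfl | ⟨k, hk, rfl⟩ | ⟨k, hk, rfl⟩ := curvature_cases K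
  · exact absurd hK (lt_irrefl _)
  · nlinarith
  · rw [E_eq_form hK.ne, E_eq_form hK.ne, form_neg_curv hk, form_neg_curv hk]
    simp only [anti, Real.cosh_neg, Real.sinh_neg]
    rw [show q.1 - (p.1 + Real.pi) = q.1 - p.1 - Real.pi by ring, Real.cos_sub_pi]
    field_simp; ring

theorem causal_anti_iff {K : ℝ} (hK : K < 0) {p q : Model} :
    causal K q (anti p) ↔ |gd p.2 + gd q.2| ≤ p.1 + Real.pi - q.1 := by
  obtain rfl | ⟨k, hk, rfl⟩ | ⟨k, hk, rfl⟩ := curvature_cases K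
  · exact absurd hK (lt_irrefl _)
  · nlinarith
  · rw [causal_neg_curv hk]
    simp only [anti, gd_neg]
    rw [← abs_neg, show -(-gd p.2 - gd q.2) = gd p.2 + gd q.2 by ring]

theorem causal_anti_anti {K : ℝ} (hK : K < 0) {p q : Model} (h : causal K p q) :
    causal K (anti p) (anti q) := by
  obtain rfl | ⟨k, hk, rfl⟩ | ⟨k, hk, rfl⟩ := curvature_cases K
  · exact absurd hK (lt_irrefl _)
  · nlinarith
  · rw [causal_neg_curv hk] at *
    simp only [anti, gd_neg]
    rw [← abs_neg, show -(-gd q.2 - -gd p.2) = gd q.2 - gd p.2 by ring]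
    linarith

/-! ### Monotonicity of the energy along causal chains -/

/-- Monotonicity of `a ↦ sin a / cos (θ + a)` after clearing denominators: the difference of the two
sides is `sin (a' - a) * cos θ`. -/
theorem sin_mul_cos_le {θ a a' : ℝ} (ha : a ≤ a') (h : a' - a ≤ Real.pi) (hθ : 0 ≤ Real.cos θ) :
    Real.sin a * Real.cos (θ + a') ≤ Real.sin a' * Real.cos (θ + a) := by
  have h1 : 0 ≤ Real.sin (a' - a) := Real.sin_nonneg_of_nonneg_of_le_pi (by linarith) h
  have h2 := mul_nonneg h1 hθ
  rw [Real.sin_sub] at h2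
  rw [Real.cos_add, Real.cos_add]
  linear_combination h2

/-- With `X` the product of `sin a / cos (θ + a)` and `sin b / cos (θ + b)`, the quotient equals `X
/ (1 - X)`, because the denominator is `cos (θ + a) * cos (θ + b) - sin a * sin b`. Each factor of
`X` is monotone. -/
theorem ratio_mono_pos {θ a b a' b' : ℝ} (ha : 0 ≤ a) (haa : a ≤ a') (hb : 0 ≤ b) (hbb : b ≤ b')
    (h1 : -(Real.pi / 2) < θ) (h2 : θ + a' + b' < Real.pi / 2) :
    Real.sin a * Real.sin b / (Real.cos θ * Real.cos (θ + a + b)) ≤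
      Real.sin a' * Real.sin b' / (Real.cos θ * Real.cos (θ + a' + b')) := by
  have hc : ∀ x, θ ≤ x → x ≤ θ + a' + b' → 0 < Real.cos x := fun x hx hx' =>
    Real.cos_pos_of_mem_Ioo ⟨by linarith, by linarith⟩
  have hs : ∀ x, 0 ≤ x → x ≤ a' + b' → 0 ≤ Real.sin x := fun x hx hx' =>
    Real.sin_nonneg_of_nonneg_of_le_pi hx (by linarith)
  have h0 := hc θ le_rfl (by linarith)
  have hi : ∀ a b, Real.cos θ * Real.cos (θ + a + b) =
      Real.cos (θ + a) * Real.cos (θ + b) - Real.sin a * Real.sin b := fun a b => by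
    simp only [Real.cos_add, Real.sin_add]
    linear_combination (-Real.sin a * Real.sin b) * Real.sin_sq_add_cos_sq θ
  rw [div_le_div_iff₀ (mul_pos h0 (hc _ (by linarith) (by linarith)))
    (mul_pos h0 (hc _ (by linarith) (by linarith))), hi, hi]
  have e1 := sin_mul_cos_le (θ := θ) haa (by linarith) h0.le
  have e2 := sin_mul_cos_le (θ := θ) hbb (by linarith) h0.le
  have := mul_le_mul e1 e2 (mul_nonneg (hs _ hb (by linarith)) (hc _ (by linarith) (by linarith)).le)
    (mul_nonneg (hs _ (by linarith) (by linarith)) (hc _ (by linarith) (by linarith)).le)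
  linear_combination this

/-- The same with `X / (1 + X)`, where the second factor of `X` is `sin b / cos (-θ + b)`. Cross
multiplication also covers vanishing cosines in `X`. -/
theorem ratio_mono_neg {θ a b a' b' : ℝ} (ha : 0 ≤ a) (haa : a ≤ a') (hb : 0 ≤ b) (hbb : b ≤ b')
    (h1 : a' + θ ≤ Real.pi / 2) (h2 : b' - θ ≤ Real.pi / 2)
    (hθ : -(Real.pi / 2) < θ) (hθ' : θ < Real.pi / 2)
    (h3 : 0 < Real.cos (θ + a - b)) (h3' : 0 < Real.cos (θ + a' - b')) :
    Real.sin a * Real.sin b / (Real.cos θ * Real.cos (θ + a - b)) ≤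
      Real.sin a' * Real.sin b' / (Real.cos θ * Real.cos (θ + a' - b')) := by
  have hc : ∀ x, 0 ≤ x → x ≤ a' → 0 ≤ Real.cos (θ + x) := fun x hx hx' =>
    Real.cos_nonneg_of_neg_pi_div_two_le_of_le (by linarith) (by linarith)
  have hc' : ∀ x, 0 ≤ x → x ≤ b' → 0 ≤ Real.cos (-θ + x) := fun x hx hx' =>
    Real.cos_nonneg_of_neg_pi_div_two_le_of_le (by linarith) (by linarith)
  have h0 : 0 < Real.cos θ := Real.cos_pos_of_mem_Ioo ⟨hθ, hθ'⟩
  have hi : ∀ a b, Real.cos θ * Real.cos (θ + a - b) =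
      Real.cos (θ + a) * Real.cos (-θ + b) + Real.sin a * Real.sin b := fun a b => by
    simp only [Real.cos_add, Real.sin_add, Real.cos_sub, Real.cos_neg, Real.sin_neg]
    linear_combination (Real.sin a * Real.sin b) * Real.sin_sq_add_cos_sq θ
  rw [div_le_div_iff₀ (mul_pos h0 h3) (mul_pos h0 h3'), hi, hi]
  have e1 := sin_mul_cos_le (θ := θ) haa (by linarith) h0.le
  have e2 := sin_mul_cos_le (θ := -θ) hbb (by linarith) (by rw [Real.cos_neg]; exact h0.le)
  have := mul_le_mul e1 e2
    (mul_nonneg (Real.sin_nonneg_of_nonneg_of_le_pi hb (by linarith)) (hc' _ (by linarith) le_rfl))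
    (mul_nonneg (Real.sin_nonneg_of_nonneg_of_le_pi (by linarith) (by linarith))
      (hc _ (by linarith) haa))
  linear_combination this

theorem cos_sub_cos_eq (x y : ℝ) :
    Real.cos x - Real.cos y = 2 * (Real.sin ((y + x) / 2) * Real.sin ((y - x) / 2)) := by
  rw [Real.cos_sub_cos, show (x - y) / 2 = -((y - x) / 2) by ring, Real.sin_neg, add_comm]; ring

/-- The energy from a fixed point grows along causal chains. -/
theorem E_mono_right {K : ℝ} {p q r : Model} (h1 : causal K p q) (h2 : causal K q r)
    (h3 : K < 0 → causal K r (anti p)) : E K p q ≤ E K p r := by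
  rcases curvature_cases K with rfl | ⟨k, hk, rfl⟩ | ⟨k, hk, rfl⟩
  · rw [causal_flat, abs_le] at h1 h2
    rw [E_flat, E_flat]
    have : (q.1 - p.1 + (q.2 - p.2)) * (q.1 - p.1 - (q.2 - p.2)) ≤
        (r.1 - p.1 + (r.2 - p.2)) * (r.1 - p.1 - (r.2 - p.2)) :=
      mul_le_mul (by linarith) (by linarith) (by linarith) (by linarith)
    linarith
  · rw [causal_pos_curv hk, abs_le] at h1 h2
    rw [E_pos_curv hk, E_pos_curv hk, cos_sub_cos_eq, cos_sub_cos_eq]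
    refine div_le_div_of_nonneg_right ?_ (by positivity)
    rw [mul_div_assoc 2, mul_div_assoc 2]
    -- The arguments are half the null coordinates seen from `p`; both increase along a causal
    -- curve.
    have := ratio_mono_pos (θ := gd p.1) (a := (gd q.1 - gd p.1 + (q.2 - p.2)) / 2)
      (a' := (gd r.1 - gd p.1 + (r.2 - p.2)) / 2) (b := (gd q.1 - gd p.1 - (q.2 - p.2)) / 2)
      (b' := (gd r.1 - gd p.1 - (r.2 - p.2)) / 2) (by linarith) (by linarith) (by linarith)
      (by linarith) (lt_gd _) (by linarith [gd_lt r.1])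
    rw [show gd p.1 + (gd q.1 - gd p.1 + (q.2 - p.2)) / 2 + (gd q.1 - gd p.1 - (q.2 - p.2)) / 2
      = gd q.1 by ring, show gd p.1 + (gd r.1 - gd p.1 + (r.2 - p.2)) / 2 +
      (gd r.1 - gd p.1 - (r.2 - p.2)) / 2 = gd r.1 by ring] at this
    linarith
  · have hn : -k ^ 2 < 0 := by nlinarith
    have h3 := h3 hn
    rw [causal_anti_iff hn, abs_le] at h3
    rw [causal_neg_curv hk, abs_le] at h1 h2
    rw [E_neg_curv hk, E_neg_curv hk, cos_sub_cos_eq, cos_sub_cos_eq]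
    refine div_le_div_of_nonneg_right ?_ (by positivity)
    rw [mul_div_assoc 2, mul_div_assoc 2]
    have e1 : gd p.2 + (q.1 - p.1 + (gd q.2 - gd p.2)) / 2 - (q.1 - p.1 - (gd q.2 - gd p.2)) / 2
      = gd q.2 := by ring
    have e2 : gd p.2 + (r.1 - p.1 + (gd r.2 - gd p.2)) / 2 - (r.1 - p.1 - (gd r.2 - gd p.2)) / 2
      = gd r.2 := by ring
    have := ratio_mono_neg (θ := gd p.2) (a := (q.1 - p.1 + (gd q.2 - gd p.2)) / 2)
      (a' := (r.1 - p.1 + (gd r.2 - gd p.2)) / 2) (b := (q.1 - p.1 - (gd q.2 - gd p.2)) / 2)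
      (b' := (r.1 - p.1 - (gd r.2 - gd p.2)) / 2) (by linarith) (by linarith) (by linarith)
      (by linarith) (by linarith) (by linarith) (lt_gd _) (gd_lt _)
      (by rw [e1]; exact cos_gd_pos _) (by rw [e2]; exact cos_gd_pos _)
    rw [e1, e2] at this
    linarith

theorem E_mono_left {K : ℝ} {p q r : Model} (h1 : causal K p q) (h2 : causal K q r)
    (h3 : K < 0 → causal K r (anti p)) : E K q r ≤ E K p r := by
  have := E_mono_right (causal_rev.2 h2) (causal_rev.2 h1) (fun hK => by
    have h := h3 hK
    rw [causal_anti_iff hK] at *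
    simp only [rev]
    rw [add_comm (gd r.2)]; linarith)
  rwa [E_rev, E_rev, E_comm K r q, E_comm K r p] at this

/-! ### Time separation and energy -/

theorem tau_eq_zero {K : ℝ} {p q : Model} (h : ¬ causal K p q) : tau K p q = 0 := by
  simp [tau, h]

theorem causal_of_tau_pos {K : ℝ} {p q : Model} (h : 0 < tau K p q) : causal K p q := by
  by_contra hc
  rw [tau_eq_zero hc] at h
  exact lt_irrefl _ h

/-- For `K < 0` the energy is periodic in the time coordinate; lying before the antipode of `p`
selects the sheet on which it determines the separation. -/
theorem tau_eq_of_E {K t : ℝ} {p q : Model} (hc : causal K p q)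
    (ha : K < 0 → causal K q (anti p)) (ht : InRange K t) (hE : E K p q = md K t) :
    tau K p q = ENNReal.ofReal t := by
  rcases curvature_cases K with rfl | ⟨k, hk, rfl⟩ | ⟨k, hk, rfl⟩
  · rw [E_flat, md_flat] at hE
    simp only [tau, hc, not_true, if_false, if_true]
    rw [show (q.1 - p.1) ^ 2 - (q.2 - p.2) ^ 2 = t ^ 2 by linarith, Real.sqrt_sq ht.1]
  · have h0 : 0 < k ^ 2 := by positivity
    simp only [tau, hc, not_true, if_false, h0.ne', h0, if_true]
    rw [form_eq_E h0.ne', hE, md_pos_curv hk, mul_div_cancel₀ _ h0.ne', Real.sqrt_sq hk.le,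
      add_sub_cancel, Real.arcosh_cosh (mul_nonneg hk.le ht.1), mul_div_cancel_left₀ _ hk.ne']
  · have h0 : -k ^ 2 < 0 := by nlinarith
    have ha := ha h0
    rw [causal_anti_iff h0] at ha
    have hf : form (-k ^ 2) p q = Real.cos (k * t) := by
      rw [form_eq_E h0.ne, hE, md_neg_curv hk, mul_div_cancel₀ _ h0.ne]; ring
    have hcond : q.1 - p.1 ≤ Real.pi ∧ -1 ≤ Real.cos (k * t) :=
      ⟨by linarith [abs_nonneg (gd p.2 + gd q.2)], Real.neg_one_le_cos _⟩
    rw [inRange_neg_curv hk] at ht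
    simp only [tau, hc, not_true, if_false, h0.ne, not_lt.2 h0.le, hf, hcond, and_self, if_true,
      neg_neg]
    rw [Real.sqrt_sq hk.le, Real.arccos_cos (mul_nonneg hk.le ht.1) ht.2.le,
      mul_div_cancel_left₀ _ hk.ne']

theorem tau_ne_top_of_nonneg {K : ℝ} (hK : 0 ≤ K) (p q : Model) : tau K p q ≠ ⊤ := by
  rcases hK.eq_or_lt with rfl | h
  · simp only [tau]; split_ifs <;> simp
  · simp only [tau, h.ne', h, if_true, if_false]; split_ifs <;> simp

/-- Below `D_K` the finite branch of the time separation applies, where the form is at least `-1`.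
This says that the energy between `q` and the antipode is nonnegative, and the bound on the time
coordinate then yields causality. -/
theorem causal_anti_of_tau_lt {K : ℝ} {p q : Model} (hc : causal K p q)
    (h : tau K p q < diamBound K) (hK : K < 0) : causal K q (anti p) := by
  have hne : K ≠ 0 := hK.ne
  simp only [tau, hc, not_true, if_false, hne, not_lt.2 hK.le] at h
  split_ifs at h with hcond
  · obtain ⟨h1, h2⟩ := hcond
    have hE : 0 ≤ E K q (anti p) := by
      rw [E_comm, E_anti hK, E_eq_form hne, ← sub_div]
      exact div_nonneg_of_nonpos (by linarith) hK.le
    obtain ⟨k, hk, rfl⟩ : ∃ k : ℝ, 0 < k ∧ K = -k ^ 2 := by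
      obtain rfl | ⟨k, hk, rfl⟩ | h := curvature_cases K
      · exact absurd hK (lt_irrefl _)
      · nlinarith
      · exact h
    have h0 : 0 ≤ q.1 - p.1 := by
      rw [causal_neg_curv hk] at hc; exact (abs_nonneg _).trans hc
    rw [E_neg_curv hk, zero_le_div_iff (by positivity),
      zero_le_div_iff (mul_pos (cos_gd_pos _) (cos_gd_pos _)), sub_nonneg] at hE
    rw [causal_neg_curv hk]
    exact abs_le_of_cos_le (by simp only [anti]; linarith) (abs_gd_sub_le _ _) hE
  · exact absurd h (by simp)

theorem two_add_mul_E_pos {K : ℝ} {p q : Model} (hc : causal K p q)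
    (h : tau K p q < diamBound K) : 0 < 2 + K * E K p q := by
  rcases lt_or_ge K 0 with hK | hK
  · have hne : K ≠ 0 := hK.ne
    have := causal_anti_of_tau_lt hc h hK
    simp only [tau, hc, not_true, if_false, hne, not_lt.2 hK.le, diamBound, hK, if_true] at h
    split_ifs at h with hcond
    · have hs : 0 < √(-K) := Real.sqrt_pos.2 (by linarith)
      rw [ENNReal.ofReal_lt_ofReal_iff (by positivity), div_lt_div_iff_of_pos_right hs] at h
      have h3 : form K p q ≠ -1 := fun h' => by rw [h', Real.arccos_neg_one] at h; linarith
      have := lt_of_le_of_ne hcond.2 h3.symm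
      rw [form_eq_E hne] at this
      linarith
    · exact absurd h (by simp)
  · have := E_nonneg_of_causal hc (fun h => absurd h (not_lt.2 hK))
    positivity

theorem E_nonneg_of_tau_lt {K : ℝ} {p q : Model} (hc : causal K p q)
    (h : tau K p q < diamBound K) : 0 ≤ E K p q :=
  E_nonneg_of_causal hc fun hK => by
    have := causal_anti_of_tau_lt hc h hK
    rw [causal_anti_iff hK] at this
    linarith [abs_nonneg (gd p.2 + gd q.2)]

theorem E_eq_md {K : ℝ} {p q : Model} (hc : causal K p q) (h : tau K p q < diamBound K) :
    E K p q = md K (tau K p q).toReal := by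
  obtain ⟨t, ht, hE⟩ := exists_md_eq (E_nonneg_of_tau_lt hc h) (two_add_mul_E_pos hc h)
  rw [tau_eq_of_E hc (causal_anti_of_tau_lt hc h) ht hE.symm, ENNReal.toReal_ofReal ht.1, hE]

theorem md_anti_sub {K : ℝ} (hK : K < 0) (s : ℝ) :
    md K (Real.pi / √(-K) - s) = -2 / K - md K s := by
  obtain rfl | ⟨k, hk, rfl⟩ | ⟨k, hk, rfl⟩ := curvature_cases K
  · exact absurd hK (lt_irrefl _)
  · nlinarith
  · rw [neg_neg, Real.sqrt_sq hk.le, md_neg_curv hk, md_neg_curv hk, mul_sub,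
      mul_div_cancel₀ _ hk.ne', Real.cos_pi_sub]
    field_simp; ring

theorem tau_lt_of_near {K : ℝ} {p q : Model} (hc : causal K p q)
    (ha : K < 0 → causal K q (anti p)) (h2 : 0 < 2 + K * E K p q) : tau K p q < diamBound K := by
  obtain ⟨t, ht, hE⟩ := exists_md_eq (K := K) (E_nonneg_of_causal hc fun hK => by
    have := ha hK
    rw [causal_anti_iff hK] at this
    linarith [abs_nonneg (gd p.2 + gd q.2)]) h2
  rw [tau_eq_of_E hc ha ht hE.symm, ← inRange_iff_lt_diamBound ht.1]
  exact ht

theorem two_add_mul_pos_of_le {K e e' : ℝ} (he : 0 ≤ e) (h : e ≤ e') (h2 : 0 < 2 + K * e') :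
    0 < 2 + K * e := by
  rcases lt_or_ge K 0 with hK | hK
  · nlinarith
  · positivity

theorem tau_lt_left {K : ℝ} {p q r : Model} (h1 : causal K p q) (h2 : causal K q r)
    (h : tau K p r < diamBound K) : tau K p q < diamBound K := by
  have ha := causal_anti_of_tau_lt (causal_trans h1 h2) h
  have ha' : K < 0 → causal K q (anti p) := fun hK => causal_trans h2 (ha hK)
  refine tau_lt_of_near h1 ha' ?_
  refine two_add_mul_pos_of_le (E_nonneg_of_causal h1 fun hK => ?_) (E_mono_right h1 h2 ha)
    (two_add_mul_E_pos (causal_trans h1 h2) h)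
  have := ha' hK
  rw [causal_anti_iff hK] at this
  linarith [abs_nonneg (gd p.2 + gd q.2)]

theorem tau_lt_right {K : ℝ} {p q r : Model} (h1 : causal K p q) (h2 : causal K q r)
    (h : tau K p r < diamBound K) : tau K q r < diamBound K := by
  have := tau_lt_left (causal_rev.2 h2) (causal_rev.2 h1) (by rwa [tau_rev])
  rwa [tau_rev] at this

theorem inRange_tau {K : ℝ} {p q : Model} (h : tau K p q < diamBound K) :
    InRange K (tau K p q).toReal := inRange_toReal h

/-- The reverse triangle inequality of the model space. It rests on `vol_sq`: a Gram determinant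
that is a square cannot be negative. -/
theorem toReal_add_le {K : ℝ} {p q r : Model} (h1 : causal K p q) (h2 : causal K q r)
    (h : tau K p r < diamBound K) :
    (tau K p q).toReal + (tau K q r).toReal ≤ (tau K p r).toReal := by
  have ha := causal_anti_of_tau_lt (causal_trans h1 h2) h
  have hpq := tau_lt_left h1 h2 h
  have hqr := tau_lt_right h1 h2 h
  have es := E_eq_md h1 hpq
  have et := E_eq_md h2 hqr
  have er := E_eq_md (causal_trans h1 h2) h
  have m1 := E_mono_right h1 h2 ha
  have m2 := E_mono_left h1 h2 ha
  have hs := inRange_tau hpq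
  have ht := inRange_tau hqr
  have hr := inRange_tau h
  have hv := vol_sq K q p r
  rw [E_comm K q p] at hv
  set s := (tau K p q).toReal
  set t := (tau K q r).toReal
  set ρ := (tau K p r).toReal
  rw [es, et, er] at hv
  rw [es, er] at m1
  rw [et, er] at m2
  have hsum : md K (s + t) ≤ md K ρ := by
    rcases hs.1.eq_or_lt with h0 | h0
    · rw [← h0, zero_add]; exact m2
    rcases ht.1.eq_or_lt with h0' | h0'
    · rw [← h0', add_zero]; exact m1
    have hss := mul_nonneg (sn_nonneg hs) (sn_nonneg ht)
    -- By the addition formulas this leaves `md (s + t) ≤ md ρ` or `md ρ ≤ md (s - t)`. The second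
    -- is incompatible with `md s, md t ≤ md ρ` when `s` and `t` are positive.
    have hsq : (sn K s * sn K t) ^ 2 ≤ (md K ρ - md K s - md K t - K * md K s * md K t) ^ 2 := by
      have := sq_nonneg (vol K q p r)
      rw [hv, gram, hh_md, hh_md, tc] at this
      linear_combination this
    rw [sq_le_sq, abs_of_nonneg hss] at hsq
    rcases le_abs.1 hsq with h' | h'
    · rw [md_add]; linarith
    · exfalso
      have h4 : md K ρ ≤ md K (s - t) := by rw [md_sub]; linarith
      rcases le_total s t with hst | hst
      · have := md_lt_md (s := t - s) (by linarith) ht (by linarith)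
        rw [← neg_sub, md_neg] at h4
        linarith
      · have := md_lt_md (s := s - t) (by linarith) hs (by linarith)
        linarith
  rcases lt_or_ge K 0 with hK | hK
  · have hsq : 0 < √(-K) := Real.sqrt_pos.2 (by linarith)
    -- To invert `md` at `s + t`, this sum must lie in the range. The chain `q ≤ r ≤ anti p` bounds
    -- `t` by `D_K - s`, and equality would force the antipodal energy, which `ρ` does not reach.
    have m3 : E K q r ≤ E K q (anti p) :=
      E_mono_right h2 (ha hK) (fun hK => causal_anti_anti hK h1)
    have hs' := hs.2 hK
    have hle : t ≤ Real.pi / √(-K) - s := by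
      refine le_of_md_le ht ?_ ?_
      · rw [sub_nonneg, le_div_iff₀ hsq]; linarith
      · rw [md_anti_sub hK, ← es, ← E_anti hK, E_comm, ← et]; exact m3
    rcases hle.eq_or_lt with he | hl
    · exfalso
      have h5 : md K (s + t) = -2 / K := by
        rw [he, add_sub_cancel]
        simpa using md_anti_sub hK 0
      have := two_add_mul_md_pos hr
      rw [h5] at hsum
      have h6 : K * md K ρ ≤ K * (-2 / K) := mul_le_mul_of_nonpos_left hsum hK.le
      rw [mul_div_cancel₀ _ hK.ne] at h6
      linarith
    · refine le_of_md_le ⟨add_nonneg hs.1 ht.1, fun _ => ?_⟩ hr.1 hsum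
      have : s + t < Real.pi / √(-K) := by linarith
      rw [lt_div_iff₀ hsq] at this
      linarith
  · exact le_of_md_le ⟨add_nonneg hs.1 ht.1, fun h => absurd h (not_lt.2 hK)⟩ hr.1 hsum

/-- For `K < 0` two causal steps may together pass the antipode, after which the energy no longer
measures the separation. If `r` came after `anti p`, monotonicity seen from `q` would give `md (D_K
- τ(p, q)) ≤ md (τ(q, r))`, against `τ(p, q) + τ(q, r) ≤ ρ < D_K`. -/
theorem tau_lt_of_E_le {K ρ : ℝ} {p q r : Model} (h1 : causal K p q) (h2 : causal K q r)
    (hpq : tau K p q < diamBound K) (hqr : tau K q r < diamBound K) (hρ : InRange K ρ)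
    (hs : (tau K p q).toReal + (tau K q r).toReal ≤ ρ) (hE : E K p r ≤ md K ρ) :
    tau K p r < diamBound K := by
  rcases lt_or_ge K 0 with hK | hK
  · have a1 := causal_anti_of_tau_lt h1 hpq hK
    have a2 := causal_anti_of_tau_lt h2 hqr hK
    have hpos : 0 < 2 + K * E K p r := by
      have := two_add_mul_md_pos hρ
      nlinarith
    have hEa : 0 < E K r (anti p) := by
      rw [E_comm, E_anti hK, sub_pos, lt_div_iff_of_neg hK]; linarith
    have hloc : Loc K r (anti p) := by
      refine ⟨fun h => absurd h (not_lt.2 hK.le), fun _ => ?_⟩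
      obtain ⟨k, hk, rfl⟩ : ∃ k : ℝ, 0 < k ∧ K = -k ^ 2 := by
        obtain rfl | ⟨k, hk, rfl⟩ | h := curvature_cases K
        · exact absurd hK (lt_irrefl _)
        · nlinarith
        · exact h
      rw [causal_anti_iff hK] at a1 a2
      rw [causal_neg_curv hk] at h1 h2
      have := abs_nonneg (gd q.2 - gd p.2)
      have := abs_nonneg (gd r.2 - gd q.2)
      have := abs_nonneg (gd p.2 + gd q.2)
      have := abs_nonneg (gd q.2 + gd r.2)
      simp only [anti]
      rw [abs_le]; constructor <;> linarith
    have hra : causal K r (anti p) := by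
      rcases causal_or_of_E_nonneg hloc hEa.le with h | h
      · exact h
      · exfalso
        have m : E K q (anti p) ≤ E K q r := E_mono_right a1 h (fun _ => a2)
        rw [E_comm, E_anti hK, E_eq_md h1 hpq, E_eq_md h2 hqr, ← md_anti_sub hK] at m
        have hsq : 0 < √(-K) := Real.sqrt_pos.2 (by linarith)
        have hlt : (tau K p q).toReal + (tau K q r).toReal < Real.pi / √(-K) := by
          rw [lt_div_iff₀ hsq]
          have := hρ.2 hK
          nlinarith
        have hq := inRange_tau hqr
        have h9 := md_lt_md_of_le_pi (K := K) hq.1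
          (t := Real.pi / √(-K) - (tau K p q).toReal) (fun _ => by
            rw [mul_sub, mul_div_cancel₀ _ hsq.ne']
            linarith [mul_nonneg hsq.le (inRange_tau hpq).1]) (by linarith)
        linarith
    exact tau_lt_of_near (causal_trans h1 h2) (fun _ => hra) hpos
  · rw [diamBound, if_neg (not_lt.2 hK)]
    exact lt_top_iff_ne_top.2 (tau_ne_top_of_nonneg hK p r)

end Model

/-! ### Segments and configurations in the model spaces -/

namespace Model

theorem causal_anti_of_loc {K : ℝ} {p q : Model} (hc : causal K p q) (hl : Loc K p q)
    (h2 : 0 ≤ 2 + K * E K p q) (hK : K < 0) : causal K q (anti p) := by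
  obtain ⟨k, hk, rfl⟩ : ∃ k : ℝ, 0 < k ∧ K = -k ^ 2 := by
    obtain rfl | ⟨k, hk, rfl⟩ | h := curvature_cases K
    · exact absurd hK (lt_irrefl _)
    · nlinarith
    · exact h
  have hE : 0 ≤ E (-k ^ 2) q (anti p) := by
    rw [E_comm, E_anti hK, sub_nonneg, le_div_iff_of_neg hK]; linarith
  have hl := (le_abs_self _).trans (hl.2 hK)
  rw [E_neg_curv hk, zero_le_div_iff (by positivity),
    zero_le_div_iff (mul_pos (cos_gd_pos _) (cos_gd_pos _)), sub_nonneg] at hE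
  rw [causal_neg_curv hk]
  exact abs_le_of_cos_le (by simp only [anti]; linarith) (abs_gd_sub_le _ _) hE

theorem tau_eq_of_loc {K t : ℝ} {p q : Model} (hc : causal K p q) (hl : Loc K p q)
    (ht : InRange K t) (hE : E K p q = md K t) : tau K p q = ENNReal.ofReal t :=
  tau_eq_of_E hc (causal_anti_of_loc hc hl (by rw [hE]; exact (two_add_mul_md_pos ht).le)) ht hE

theorem tau_toReal_of_loc {K t : ℝ} {p q : Model} (hc : causal K p q) (hl : Loc K p q)
    (ht : InRange K t) (hE : E K p q = md K t) :
    tau K p q < diamBound K ∧ (tau K p q).toReal = t := by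
  rw [tau_eq_of_loc hc hl ht hE, ENNReal.toReal_ofReal ht.1, ← inRange_iff_lt_diamBound ht.1]
  exact ⟨ht, rfl⟩

theorem gd_injective : Function.Injective gd := fun _ _ h =>
  Real.sinh_injective (Real.arctan_injective h)

theorem causal_antisymm {K : ℝ} {p q : Model} (h1 : causal K p q) (h2 : causal K q p) : p = q := by
  have hc : conf K p = conf K q := by
    simp only [causal, abs_le] at h1 h2
    ext <;> linarith
  unfold conf at hc
  split_ifs at hc
  · exact hc
  · rw [Prod.mk.injEq] at hc
    exact Prod.ext (gd_injective hc.1) hc.2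
  · rw [Prod.mk.injEq] at hc
    exact Prod.ext hc.1 (gd_injective hc.2)

theorem loc_self (K : ℝ) (p : Model) : Loc K p p := by simp [Loc, Real.pi_pos.le]

theorem tau_self (K : ℝ) (p : Model) : tau K p p = 0 := by
  have := tau_eq_of_loc (t := 0) (causal_refl K p) (loc_self K p)
    ⟨le_rfl, fun _ => by simp [Real.pi_pos]⟩ (by rw [E_self, md_zero])
  simpa using this

theorem tau_eq_zero_of_causal {K : ℝ} {p q : Model} (h : causal K q p) : tau K p q = 0 := by
  by_cases hc : causal K p q
  · rw [causal_antisymm hc h, tau_self]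
  · exact tau_eq_zero hc

/-- For `K > 0` the conformal time has total width `π`; for `K < 0` the diamond ends before the
antipode of its lower tip. Hence energies decide causality inside any diamond shorter than `D_K`. -/
theorem loc_of_diamond {K : ℝ} {a b p q : Model} (h1 : causal K a p) (h2 : causal K p b)
    (h3 : causal K a q) (h4 : causal K q b) (h : tau K a b < diamBound K) : Loc K p q := by
  refine ⟨fun hK => ?_, fun hK => ?_⟩
  · obtain rfl | ⟨k, hk, rfl⟩ | ⟨k, hk, rfl⟩ := curvature_cases K
    · exact absurd hK (lt_irrefl _)
    · simp only [causal_pos_curv hk, abs_le] at *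
      constructor <;> linarith [gd_lt b.1, lt_gd a.1]
    · nlinarith
  · have := causal_anti_of_tau_lt (causal_trans h1 h2) h hK
    rw [causal_anti_iff hK] at this
    have := abs_nonneg (gd a.2 + gd b.2)
    obtain rfl | ⟨k, hk, rfl⟩ | ⟨k, hk, rfl⟩ := curvature_cases K
    · exact absurd hK (lt_irrefl _)
    · nlinarith
    · simp only [causal_neg_curv hk, abs_le] at *
      constructor <;> linarith

theorem toReal_tau_eq {K : ℝ} {p q : Model} {t : ℝ} (hc : causal K p q)
    (h : tau K p q < diamBound K) (ht : InRange K t) (hE : E K p q = md K t) :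
    (tau K p q).toReal = t :=
  md_inj (inRange_tau h) ht (by rw [← E_eq_md hc h, hE])

/-! #### Points on segments -/

/-- With zero volume the Gram identity reads `tc ^ 2 = (sn l * sn s) ^ 2`. The reverse triangle
inequality makes `tc` nonnegative, so the root gives `md t = md (l - s)`. -/
theorem additive_of_vol_eq_zero {K : ℝ} {a b m : Model} (h1 : causal K a m) (h2 : causal K m b)
    (h : tau K a b < diamBound K) (hv : vol K a b m = 0) :
    (tau K a m).toReal + (tau K m b).toReal = (tau K a b).toReal := by
  have ham := tau_lt_left h1 h2 h
  have hmb := tau_lt_right h1 h2 h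
  have hs := vol_sq K a b m
  have hle := toReal_add_le h1 h2 h
  have rs := inRange_tau ham
  have rt := inRange_tau hmb
  have rl := inRange_tau h
  rw [hv, E_eq_md (causal_trans h1 h2) h, E_eq_md h1 ham, E_comm K b m, E_eq_md h2 hmb] at hs
  set s := (tau K a m).toReal
  set t := (tau K m b).toReal
  set l := (tau K a b).toReal
  have rls : InRange K (l - s) := rl.mono (by linarith [rt.1]) (by linarith [rs.1])
  have hβ := md_le_md rt.1 rls (by linarith)
  rw [md_sub] at hβ
  have hp := mul_nonneg (sn_nonneg rl) (sn_nonneg rs)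
  rw [gram, hh_md, hh_md] at hs
  have htc : tc K (md K l) (md K s) (md K t) = sn K l * sn K s := by
    have h0 : 0 ≤ tc K (md K l) (md K s) (md K t) := by rw [tc]; linarith
    refine (pow_left_inj₀ h0 hp two_ne_zero).1 ?_
    rw [mul_pow]; linarith
  have : md K t = md K (l - s) := by rw [md_sub]; rw [tc] at htc; linarith
  linarith [md_inj rt rls this]

theorem vol_eq_zero_of_additive {K : ℝ} {a b m : Model} (h1 : causal K a m) (h2 : causal K m b)
    (h : tau K a b < diamBound K)
    (hadd : (tau K a m).toReal + (tau K m b).toReal = (tau K a b).toReal) :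
    vol K a b m = 0 := by
  have ham := tau_lt_left h1 h2 h
  have hmb := tau_lt_right h1 h2 h
  have hs := vol_sq K a b m
  rw [E_eq_md (causal_trans h1 h2) h, E_eq_md h1 ham, E_comm K b m, E_eq_md h2 hmb,
    eq_sub_iff_add_eq'.2 hadd, gram, hh_md, hh_md, tc, md_sub] at hs
  refine pow_eq_zero_iff two_ne_zero |>.1 ?_
  rw [hs]; ring

/-- The energy between a point `c` and the point at distance `s` on a segment of length `l` whose
endpoints have energies `a` and `b` to `c`. -/
noncomputable def stewart (K l s a b : ℝ) : ℝ :=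
  (sn K (l - s) * a + sn K s * b + sn K l * md K s - sn K s * md K l) / sn K l

theorem polar_of_additive {K l s a b : ℝ} (hl : sn K l ≠ 0) :
    polar K (md K l) (md K s) (md K (l - s)) a b = sn K l ^ 2 * stewart K l s a b := by
  rw [polar, hh_md, tc, md_sub, stewart, sn_sub, tc]
  field_simp
  ring

/-- Additivity kills the volume of `m` over `a b`, so `hh_mul_E` contains no term depending on the
side of `c`. -/
theorem E_eq_stewart {K : ℝ} {a b m : Model} (h1 : causal K a m) (h2 : causal K m b)
    (h : tau K a b < diamBound K) (h0 : 0 < (tau K a b).toReal)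
    (hadd : (tau K a m).toReal + (tau K m b).toReal = (tau K a b).toReal) (c : Model) :
    E K m c = stewart K (tau K a b).toReal (tau K a m).toReal (E K a c) (E K b c) := by
  have hsn := sn_pos (inRange_tau h) h0
  have hv := vol_eq_zero_of_additive h1 h2 h hadd
  have key := hh_mul_E K a b m c
  rw [hv, zero_mul, zero_add, E_eq_md (causal_trans h1 h2) h, E_eq_md h1 (tau_lt_left h1 h2 h),
    E_comm K b m, E_eq_md h2 (tau_lt_right h1 h2 h), eq_sub_iff_add_eq'.2 hadd,
    polar_of_additive hsn.ne', hh_md] at key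
  exact mul_left_cancel₀ (pow_ne_zero 2 hsn.ne') key

theorem exists_polar {w x C : ℝ} (hC : 0 < C) (h : w ^ 2 + x ^ 2 = C ^ 2) (hw : 0 ≤ w) :
    ∃ θ, |θ| ≤ Real.pi / 2 ∧ C * Real.cos θ = w ∧ C * Real.sin θ = x := by
  have hx : |x / C| ≤ 1 := by
    rw [abs_div, abs_of_pos hC, div_le_one hC]
    exact abs_le_of_sq_le_sq (by nlinarith) hC.le
  rw [abs_le] at hx
  refine ⟨Real.arcsin (x / C), abs_le.2 ⟨Real.neg_pi_div_two_le_arcsin _,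
    Real.arcsin_le_pi_div_two _⟩, ?_, ?_⟩
  · rw [Real.cos_arcsin, show 1 - (x / C) ^ 2 = (w / C) ^ 2 by field_simp; linarith,
      Real.sqrt_sq (by positivity)]
    field_simp
  · rw [Real.sin_arcsin hx.1 hx.2]; field_simp

/-- A nonnegative combination of two points of a hyperboloid, in polar coordinates. -/
theorem exists_hyperboloid_comb {a₁ b₁ a₂ b₂ l n : ℝ} (hl : 0 ≤ l) (hn : 0 ≤ n)
    (hb : |b₂ - b₁| ≤ Real.pi)
    (h : (l * (Real.cosh a₁ * Real.cos b₁) + n * (Real.cosh a₂ * Real.cos b₂)) ^ 2 +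
      (l * (Real.cosh a₁ * Real.sin b₁) + n * (Real.cosh a₂ * Real.sin b₂)) ^ 2 =
      1 + (l * Real.sinh a₁ + n * Real.sinh a₂) ^ 2) :
    ∃ a b, Real.sinh a = l * Real.sinh a₁ + n * Real.sinh a₂ ∧
      Real.cosh a * Real.cos b = l * (Real.cosh a₁ * Real.cos b₁) + n * (Real.cosh a₂ * Real.cos b₂) ∧
      Real.cosh a * Real.sin b = l * (Real.cosh a₁ * Real.sin b₁) + n * (Real.cosh a₂ * Real.sin b₂) ∧
      |b - b₁| ≤ Real.pi ∧ |b₂ - b| ≤ Real.pi := by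
  -- Rotating by the mean angle makes the cosine component of the combination nonnegative. Its angle
  -- is then within `π / 2` of the mean, hence within `π` of both given angles, which fixes the
  -- sheet of the covering.
  set c := (b₁ + b₂) / 2 with hc
  set δ := (b₂ - b₁) / 2 with hδ
  have e1 : b₁ = c - δ := by rw [hc, hδ]; ring
  have e2 : b₂ = c + δ := by rw [hc, hδ]; ring
  have hd : |δ| ≤ Real.pi / 2 := by
    rw [hδ, abs_div, abs_two]; linarith
  rw [abs_le] at hd
  have hcos : 0 ≤ Real.cos δ := Real.cos_nonneg_of_neg_pi_div_two_le_of_le hd.1 hd.2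
  have p1 := Real.cosh_pos a₁
  have p2 := Real.cosh_pos a₂
  set T := l * Real.sinh a₁ + n * Real.sinh a₂
  have hca : Real.cosh (Real.arsinh T) ^ 2 = 1 + T ^ 2 := by
    rw [Real.cosh_sq, Real.sinh_arsinh, add_comm]
  obtain ⟨θ, hθ, ht1, ht2⟩ := exists_polar (w := (l * Real.cosh a₁ + n * Real.cosh a₂) * Real.cos δ)
    (x := (-l * Real.cosh a₁ + n * Real.cosh a₂) * Real.sin δ) (Real.cosh_pos (Real.arsinh T)) (by
      rw [hca, ← h, e1, e2, Real.cos_sub, Real.cos_add, Real.sin_sub, Real.sin_add]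
      linear_combination (-(((l * Real.cosh a₁ + n * Real.cosh a₂) * Real.cos δ) ^ 2 +
        ((-l * Real.cosh a₁ + n * Real.cosh a₂) * Real.sin δ) ^ 2)) * Real.sin_sq_add_cos_sq c)
    (by positivity)
  rw [abs_le] at hθ
  refine ⟨Real.arsinh T, c + θ, Real.sinh_arsinh T, ?_, ?_, ?_, ?_⟩
  · rw [Real.cos_add, e1, e2, Real.cos_sub, Real.cos_add]
    linear_combination Real.cos c * ht1 - Real.sin c * ht2
  · rw [Real.sin_add, e1, e2, Real.sin_sub, Real.sin_add]
    linear_combination Real.sin c * ht1 + Real.cos c * ht2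
  · rw [e1, abs_le]; constructor <;> linarith
  · rw [e2, abs_le]; constructor <;> linarith

theorem abs_angle_le {K : ℝ} {p q : Model} (hc : causal K p q) (h : tau K p q < diamBound K) :
    Loc K p q := loc_of_diamond (causal_refl K p) hc hc (causal_refl K q) h

/-- Ambient combination with the coefficients of the point at distance `r` on a segment. -/
def IsComb (K : ℝ) (p q m : Model) (l n : ℝ) : Prop :=
  ambW K m = l * ambW K p + n * ambW K q ∧ ambT K m = l * ambT K p + n * ambT K q ∧
    ambX K m = l * ambX K p + n * ambX K q

/-- The condition `h1` puts the combination on the quadric. In the flat case it only says `(l + n) ^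
2 = 1`, so `h0` has to fix the sign. -/
theorem exists_isComb {K : ℝ} {p q : Model} (hc : causal K p q) (h : tau K p q < diamBound K)
    {l n : ℝ} (hl : 0 ≤ l) (hn : 0 ≤ n) (h0 : K = 0 → l + n = 1)
    (h1 : l ^ 2 + n ^ 2 + 2 * l * n * (1 + K * E K p q) = 1) :
    ∃ m, IsComb K p q m l n ∧ Loc K p m ∧ Loc K m q := by
  have hloc := abs_angle_le hc h
  have hp := quadric K p
  have hq := quadric K q
  rw [one_add_mul_E] at h1
  have hsum : (l * ambW K p + n * ambW K q) ^ 2 + K * ((l * ambX K p + n * ambX K q) ^ 2 -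
      (l * ambT K p + n * ambT K q) ^ 2) = 1 := by
    linear_combination h1 + l ^ 2 * hp + n ^ 2 * hq
  rcases curvature_cases K with rfl | ⟨k, hk, rfl⟩ | ⟨k, hk, rfl⟩
  · refine ⟨(l * p.1 + n * q.1, l * p.2 + n * q.2), ?_, ?_, ?_⟩
    · simp [IsComb, ambW_flat, ambT_flat, ambX_flat, h0 rfl]
    · simp [Loc]
    · simp [Loc]
  · simp only [ambW, ambX, ambT, emb_pos_curv hk, scale_pos_curv hk] at hsum
    simp at hsum
    field_simp at hsum
    obtain ⟨a, b, ha, hb1, hb2, hb3, hb4⟩ := exists_hyperboloid_comb (a₁ := p.1) (b₁ := p.2)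
      (a₂ := q.1) (b₂ := q.2) hl hn (hloc.1 (by positivity)) (by linear_combination hsum)
    refine ⟨(a, b), ?_, ?_, ?_⟩
    · simp only [IsComb, ambW, ambX, ambT, emb_pos_curv hk, scale_pos_curv hk]
      simp [ha, hb1, hb2]; constructor <;> ring
    · exact ⟨fun _ => hb3, fun h => by nlinarith⟩
    · exact ⟨fun _ => hb4, fun h => by nlinarith⟩
  · simp only [ambW, ambX, ambT, emb_neg_curv hk, scale_neg_curv hk] at hsum
    simp at hsum
    field_simp at hsum
    obtain ⟨a, b, ha, hb1, hb2, hb3, hb4⟩ := exists_hyperboloid_comb (a₁ := p.2) (b₁ := p.1)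
      (a₂ := q.2) (b₂ := q.1) hl hn (hloc.2 (by nlinarith)) (by linear_combination hsum)
    refine ⟨(b, a), ?_, ?_, ?_⟩
    · simp only [IsComb, ambW, ambX, ambT, emb_neg_curv hk, scale_neg_curv hk]
      simp [ha, hb1, hb2]; constructor <;> ring
    · exact ⟨fun h => by nlinarith, fun _ => hb3⟩
    · exact ⟨fun h => by nlinarith, fun _ => hb4⟩

/-- For `K ≠ 0` the energy is recovered from the bilinear form. For `K = 0` the first formula is
void and the energy is quadratic in the coordinates, which produces the extra product term. -/
theorem IsComb.E_eq {K : ℝ} {p q m : Model} {l n : ℝ} (hm : IsComb K p q m l n)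
    (h0 : K = 0 → l + n = 1)
    (h1 : l ^ 2 + n ^ 2 + 2 * l * n * (1 + K * E K p q) = 1) (c : Model) :
    K * E K m c = l * (1 + K * E K p c) + n * (1 + K * E K q c) - 1 ∧
    (K = 0 → E K m c = l * E K p c + n * E K q c - l * n * E K p q) := by
  obtain ⟨e1, e2, e3⟩ := hm
  constructor
  · have := one_add_mul_E K m c
    rw [e1, e2, e3] at this
    rw [one_add_mul_E, one_add_mul_E]
    linear_combination this
  · rintro rfl
    simp only [ambW_flat, ambT_flat, ambX_flat] at *
    have hn : n = 1 - l := by linarith [h0 trivial]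
    subst hn
    simp only [E_flat, e2, e3]
    ring

/-- Points at prescribed distance on a timelike segment. -/
theorem exists_segment_point {K : ℝ} {p q : Model} (hc : causal K p q)
    (h : tau K p q < diamBound K) (hpos : 0 < (tau K p q).toReal) {r : ℝ} (hr0 : 0 ≤ r)
    (hr1 : r ≤ (tau K p q).toReal) :
    ∃ m, causal K p m ∧ causal K m q ∧ (tau K p m).toReal = r ∧
      (tau K m q).toReal = (tau K p q).toReal - r ∧
      IsComb K p q m (sn K ((tau K p q).toReal - r) / sn K (tau K p q).toReal)
        (sn K r / sn K (tau K p q).toReal) := by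
  have hE := E_eq_md hc h
  have rl := inRange_tau h
  set l := (tau K p q).toReal with hl
  have hsn := sn_pos rl hpos
  rcases hr0.eq_or_lt with rfl | hr0'
  · refine ⟨p, causal_refl K p, hc, by simp [tau_self], by simp [hl], ?_⟩
    simp [IsComb, hsn.ne']
  rcases hr1.eq_or_lt with rfl | hr1'
  · refine ⟨q, hc, causal_refl K q, rfl, by simp [tau_self], ?_⟩
    simp [IsComb, hsn.ne']
  have rr : InRange K r := rl.mono hr0 hr1
  have rlr : InRange K (l - r) := rl.mono (by linarith) (by linarith)
  have h0 : K = 0 → sn K (l - r) / sn K l + sn K r / sn K l = 1 := by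
    rintro rfl
    simp only [sn_flat] at *
    field_simp; ring
  have h1 : (sn K (l - r) / sn K l) ^ 2 + (sn K r / sn K l) ^ 2 +
      2 * (sn K (l - r) / sn K l) * (sn K r / sn K l) * (1 + K * E K p q) = 1 := by
    rw [hE]
    field_simp
    rw [sn_sub]
    linear_combination (1 + K * md K r) ^ 2 * sn_sq K l + (-(1 + K * md K l) ^ 2 + 1) * sn_sq K r
      - sn_sq K l
  obtain ⟨m, hm, l1, l2⟩ := exists_isComb hc h (div_nonneg (sn_nonneg rlr) hsn.le)
    (div_nonneg (sn_nonneg rr) hsn.le) h0 h1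
  have hEc := fun c => hm.E_eq h0 h1 c
  have hpm : E K p m = md K r := by
    rw [E_comm]
    by_cases hK : K = 0
    · rw [(hEc p).2 hK, E_self, E_comm K q p, hE]
      subst hK
      simp only [sn_flat, md_flat]
      field_simp; ring
    · refine mul_left_cancel₀ hK ?_
      rw [(hEc p).1, E_self, E_comm K q p, hE, sn_sub]
      field_simp; ring
  have hmq : E K m q = md K (l - r) := by
    by_cases hK : K = 0
    · rw [(hEc q).2 hK, E_self, hE]
      subst hK
      simp only [sn_flat, md_flat]
      field_simp; ring
    · refine mul_left_cancel₀ hK ?_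
      rw [(hEc q).1, E_self, hE, sn_sub, md_sub]
      field_simp
      linear_combination K * sn K r * sn_sq K l
  -- The energy only gives causality in one of the two directions; the wrong one contradicts the
  -- reverse triangle inequality because `r > 0`. The next relation is symmetric.
  have c1 : causal K p m := by
    rcases causal_or_of_E_nonneg l1 (by rw [hpm]; exact md_nonneg _ _) with h' | h'
    · exact h'
    · exfalso
      have := tau_toReal_of_loc (causal_trans h' hc) l2 rlr hmq
      have := toReal_add_le h' hc this.1
      have : 0 ≤ (tau K m p).toReal := ENNReal.toReal_nonneg
      linarith
  have c2 : causal K m q := by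
    rcases causal_or_of_E_nonneg l2 (by rw [hmq]; exact md_nonneg _ _) with h' | h'
    · exact h'
    · exfalso
      have := tau_toReal_of_loc (causal_trans hc h') l1 rr hpm
      have := toReal_add_le hc h' this.1
      have : 0 ≤ (tau K q m).toReal := ENNReal.toReal_nonneg
      linarith
  exact ⟨m, c1, c2, (tau_toReal_of_loc c1 l1 rr hpm).2, (tau_toReal_of_loc c2 l2 rlr hmq).2, hm⟩

theorem vol_comb {K : ℝ} {p q m : Model} {l n : ℝ} (hm : IsComb K p q m l n) (a b : Model) :
    vol K a b m = l * vol K a b p + n * vol K a b q := by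
  obtain ⟨e1, e2, e3⟩ := hm
  simp only [vol, e1, e2, e3]; ring

/-- Points of a segment have ambient weights proportional to `sn (l - r)` and `sn r`. As `r` runs
over the segment, every ratio of nonnegative weights occurs, by the intermediate value theorem. This
realizes a positive linear relation by a point of the segment. -/
theorem exists_ratio {K l a b : ℝ} (hl : InRange K l) (h0 : 0 < l) (ha : 0 ≤ a) (hb : 0 ≤ b)
    (hab : 0 < a + b) : ∃ r N, 0 ≤ r ∧ r ≤ l ∧ 0 < N ∧ N * sn K (l - r) = a ∧ N * sn K r = b := by
  have hsn := sn_pos hl h0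
  have hcont : ContinuousOn (fun r => a * sn K r - b * sn K (l - r)) (Icc 0 l) := by
    have := continuous_sn K
    fun_prop
  have := intermediate_value_Icc h0.le hcont
  obtain ⟨r, hr, hr'⟩ := this (show (0 : ℝ) ∈ _ from by
    simp only [sn_zero, sub_self, sub_zero, mul_zero, zero_sub]
    exact ⟨by have := mul_nonneg hb hsn.le; linarith, by positivity⟩)
  simp only at hr'
  have r1 : InRange K r := hl.mono hr.1 hr.2
  have r2 : InRange K (l - r) := hl.mono (by linarith [hr.2]) (by linarith [hr.1])
  have hp : 0 < sn K (l - r) + sn K r := by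
    rcases hr.1.eq_or_lt with h | h
    · rw [← h]; simpa using hsn
    · linarith [sn_pos r1 h, sn_nonneg r2]
  refine ⟨r, (a + b) / (sn K (l - r) + sn K r), hr.1, hr.2, by positivity, ?_, ?_⟩
  · field_simp; linarith
  · field_simp; linarith

/-- For `K ≠ 0` the ambient map is periodic in the unrolled coordinate; `Loc` bounds the difference
by `π`, less than a period. -/
theorem eq_of_amb_eq {K : ℝ} {p q : Model} (hl : Loc K p q) (h1 : ambW K p = ambW K q)
    (h2 : ambT K p = ambT K q) (h3 : ambX K p = ambX K q) : p = q := by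
  rcases curvature_cases K with rfl | ⟨k, hk, rfl⟩ | ⟨k, hk, rfl⟩
  · simp only [ambT_flat, ambX_flat] at h2 h3
    exact Prod.ext h2 h3
  · simp only [ambW, ambX, ambT, emb_pos_curv hk, scale_pos_curv hk] at h1 h2 h3
    simp [div_left_inj' hk.ne'] at h1 h2 h3
    have hl := hl.1 (by positivity)
    rw [h2] at h1 h3
    have h1 := mul_left_cancel₀ (Real.cosh_pos _).ne' h1
    have h3 := mul_left_cancel₀ (Real.cosh_pos _).ne' h3
    have hcos : Real.cos (q.2 - p.2) = 1 := by
      rw [Real.cos_sub, h1, h3]; nlinarith [Real.sin_sq_add_cos_sq q.2]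
    rw [abs_le] at hl
    have := (Real.cos_eq_one_iff_of_lt_of_lt (by linarith [Real.pi_pos])
      (by linarith [Real.pi_pos])).1 hcos
    exact Prod.ext h2 (by linarith)
  · simp only [ambW, ambX, ambT, emb_neg_curv hk, scale_neg_curv hk] at h1 h2 h3
    simp [div_left_inj' hk.ne'] at h1 h2 h3
    have hl := hl.2 (by nlinarith)
    rw [h3] at h1 h2
    have h1 := mul_left_cancel₀ (Real.cosh_pos _).ne' h1
    have h2 := mul_left_cancel₀ (Real.cosh_pos _).ne' h2
    have hcos : Real.cos (q.1 - p.1) = 1 := by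
      rw [Real.cos_sub, h1, h2]; nlinarith [Real.sin_sq_add_cos_sq q.1]
    rw [abs_le] at hl
    have := (Real.cos_eq_one_iff_of_lt_of_lt (by linarith [Real.pi_pos])
      (by linarith [Real.pi_pos])).1 hcos
    exact Prod.ext (by linarith) h3

end Model

/-! ### Construction of configurations -/

namespace Model

/-- The geodesic `x = 0`, parametrized by arclength. -/
noncomputable def axis (K c : ℝ) : Model := (scale K * c, 0)

theorem ambW_axis (K c : ℝ) : ambW K (axis K c) = 1 + K * md K c := by
  rcases curvature_cases K with rfl | ⟨k, hk, rfl⟩ | ⟨k, hk, rfl⟩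
  · simp [ambW_flat]
  · simp [ambW, emb_pos_curv hk, axis, scale_pos_curv hk, md_pos_curv hk]; field_simp; ring
  · simp [ambW, emb_neg_curv hk, axis, scale_neg_curv hk, md_neg_curv hk]; field_simp; ring

theorem ambT_axis (K c : ℝ) : ambT K (axis K c) = sn K c := by
  rcases curvature_cases K with rfl | ⟨k, hk, rfl⟩ | ⟨k, hk, rfl⟩
  · simp [ambT_flat, axis, scale_flat, sn_flat]
  · simp [ambT, emb_pos_curv hk, axis, scale_pos_curv hk, sn_pos_curv hk]
  · simp [ambT, emb_neg_curv hk, axis, scale_neg_curv hk, sn_neg_curv hk]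

theorem ambX_axis (K c : ℝ) : ambX K (axis K c) = 0 := by
  rcases curvature_cases K with rfl | ⟨k, hk, rfl⟩ | ⟨k, hk, rfl⟩
  · simp [ambX_flat, axis]
  · simp [ambX, emb_pos_curv hk, axis]
  · simp [ambX, emb_neg_curv hk, axis]

theorem axis_zero (K : ℝ) : axis K 0 = (0, 0) := by simp [axis]

theorem rev_axis (K c : ℝ) : rev (axis K c) = axis K (-c) := by simp [rev, axis]

theorem E_axis {K a t : ℝ} {r : Model} (hW : ambW K r = 1 + K * a) (hT : ambT K r = t)
    (ht : t ^ 2 - ambX K r ^ 2 = hh K a) (c : ℝ) :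
    E K (axis K c) r = a + md K c + K * a * md K c - sn K c * t := by
  by_cases hK : K = 0
  · subst hK
    rw [ambX_flat, hh] at ht
    rw [ambT_flat] at hT
    simp only [E_flat, axis, scale_flat, md_flat, sn_flat, hT]
    linear_combination ht / 2
  · refine mul_left_cancel₀ hK ?_
    have := one_add_mul_E K (axis K c) r
    rw [ambW_axis, ambT_axis, ambX_axis, hW, hT] at this
    linear_combination this

theorem vol_axis (K c : ℝ) (r : Model) : vol K (axis K 0) (axis K c) r = sn K c * ambX K r := by
  simp only [vol, ambW_axis, ambT_axis, ambX_axis, sn_zero, md_zero]; ring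

/-- The equation `h` places `(1 + K * md s, t, x)` on the quadric, and polar coordinates invert the
ambient map. The final clause records that the chosen preimage is on the right sheet for comparison
with the axis. -/
theorem exists_future_point {K s t x : ℝ} (hs : InRange K s) (hx : |x| ≤ t)
    (h : t ^ 2 - x ^ 2 = sn K s ^ 2) :
    ∃ r, causal K (axis K 0) r ∧ ambW K r = 1 + K * md K s ∧ ambT K r = t ∧ ambX K r = x ∧
      ∀ c, InRange K c → Loc K (axis K c) r := by
  have ht : 0 ≤ t := (abs_nonneg x).trans hx
  rcases curvature_cases K with rfl | ⟨k, hk, rfl⟩ | ⟨k, hk, rfl⟩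
  · refine ⟨(t, x), ?_, by simp [ambW_flat], by simp [ambT_flat], by simp [ambX_flat], ?_⟩
    · rw [axis_zero, causal_flat]; simpa using hx
    · simp [Loc]
  · rw [sn_pos_curv hk] at h
    field_simp at h
    have hC : Real.cosh (Real.arsinh (k * t)) ^ 2 = 1 + (k * t) ^ 2 := by
      rw [Real.cosh_sq, Real.sinh_arsinh, add_comm]
    have hCp := Real.cosh_pos (Real.arsinh (k * t))
    obtain ⟨θ, h1, h2, h3⟩ := exists_polar (w := Real.cosh (k * s)) (x := k * x) hCp (by
      rw [hC, Real.cosh_sq]; linear_combination -h) (Real.cosh_pos _).le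
    refine ⟨(Real.arsinh (k * t), θ), ?_, ?_, ?_, ?_, fun c _ => ⟨fun _ => ?_, fun h => ?_⟩⟩
    · rw [axis_zero, causal_pos_curv hk]
      have hg : 0 ≤ gd (Real.arsinh (k * t)) := by
        rw [gd, Real.sinh_arsinh]; exact Real.arctan_nonneg.2 (by positivity)
      have hg0 : gd 0 = 0 := by simp [gd]
      simp only [hg0, sub_zero]
      refine abs_le_of_cos_le hg (by linarith [Real.pi_pos]) ?_
      rw [cos_gd, div_le_iff₀ hCp, mul_comm, h2]
      exact Real.one_le_cosh _
    · rw [md_pos_curv hk]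
      simp [-Real.cosh_arsinh, ambW, emb_pos_curv hk, h2]; field_simp; ring
    · simp [ambT, emb_pos_curv hk, scale_pos_curv hk]; field_simp
    · simp [-Real.cosh_arsinh, ambX, emb_pos_curv hk, scale_pos_curv hk, h3]; field_simp
    · simp only [axis, sub_zero]; linarith [Real.pi_pos]
    · nlinarith
  · rw [sn_neg_curv hk] at h
    field_simp at h
    have hC : Real.cosh (Real.arsinh (k * x)) ^ 2 = 1 + (k * x) ^ 2 := by
      rw [Real.cosh_sq, Real.sinh_arsinh, add_comm]
    have hCp := Real.cosh_pos (Real.arsinh (k * x))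
    -- Here `cos (k * s)` can be negative while `t` is not, so the angle is measured from the time
    -- direction, and the time coordinate `π / 2 - θ` lies in `[0, π]`.
    obtain ⟨θ, h1, h2, h3⟩ := exists_polar (w := k * t) (x := Real.cos (k * s)) hCp (by
      rw [hC, Real.cos_sq']; linear_combination h) (by positivity)
    rw [abs_le] at h1
    refine ⟨(Real.pi / 2 - θ, Real.arsinh (k * x)), ?_, ?_, ?_, ?_,
      fun c hc => ⟨fun h => ?_, fun h => ?_⟩⟩
    · rw [axis_zero, causal_neg_curv hk]
      have hg0 : gd 0 = 0 := by simp [gd]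
      simp only [hg0, sub_zero]
      refine abs_le_of_cos_le (by linarith) ?_ ?_
      · have := abs_gd_sub_le (Real.arsinh (k * x)) 0
        rwa [hg0, sub_zero] at this
      · rw [cos_gd, le_div_iff₀ hCp, mul_comm, Real.cos_pi_div_two_sub, h3]
        exact Real.cos_le_one _
    · rw [md_neg_curv hk]
      simp [-Real.cosh_arsinh, ambW, emb_neg_curv hk, Real.cos_pi_div_two_sub, h3]; field_simp; ring
    · simp [-Real.cosh_arsinh, ambT, emb_neg_curv hk, scale_neg_curv hk, Real.sin_pi_div_two_sub, h2]
      field_simp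
    · simp [ambX, emb_neg_curv hk, scale_neg_curv hk]; field_simp
    · nlinarith
    · rw [inRange_neg_curv hk] at hc
      have := mul_nonneg hk.le hc.1
      simp only [axis, scale_neg_curv hk]
      rw [abs_le]; constructor <;> linarith [hc.2]

theorem inRange_zero (K : ℝ) : InRange K 0 := ⟨le_rfl, fun _ => by simp [Real.pi_pos]⟩

theorem causal_axis {K c : ℝ} (hc : InRange K c) : causal K (axis K 0) (axis K c) ∧
    tau K (axis K 0) (axis K c) < diamBound K ∧ (tau K (axis K 0) (axis K c)).toReal = c := by
  obtain ⟨r, h1, h2, h3, h4, h5⟩ := exists_future_point (x := 0) hc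
    (by simpa using sn_nonneg hc) (by ring)
  have hr : r = axis K c := by
    refine (eq_of_amb_eq (h5 c hc) ?_ ?_ ?_).symm
    · rw [ambW_axis, h2]
    · rw [ambT_axis, h3]
    · rw [ambX_axis, h4]
  subst hr
  have hE := E_axis (a := md K c) (t := sn K c) (ambW_axis K c) (ambT_axis K c)
    (by rw [ambX_axis, hh_md]; ring) 0
  simp only [md_zero, sn_zero, mul_zero, add_zero, zero_mul, sub_zero] at hE
  exact ⟨h1, tau_toReal_of_loc h1 (h5 0 (inRange_zero K)) hc hE⟩

/-- A point in the future of the origin with prescribed energies to two points of the axis, on a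
prescribed side of the axis. -/
theorem exists_point_future {K l a e ε : ℝ} (hl : InRange K l) (hl0 : 0 < l) (ha : InRange K a)
    (he : e ≤ md K (l - a)) (hε : ε ^ 2 = 1) :
    ∃ z, causal K (axis K 0) z ∧ tau K (axis K 0) z < diamBound K ∧
      (tau K (axis K 0) z).toReal = a ∧ E K (axis K l) z = e ∧ Loc K (axis K l) z ∧
      vol K (axis K 0) (axis K l) z = ε * √(gram K (md K l) (md K a) e) := by
  have hsn := sn_pos hl hl0
  have hsa := sn_nonneg ha
  rw [md_sub] at he
  -- The hypothesis on `e` is the reverse triangle inequality in energies. It makes the Gram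
  -- determinant nonnegative and the time coordinate `tc / sn l` nonnegative, so that it dominates
  -- the space coordinate.
  have htc : sn K l * sn K a ≤ tc K (md K l) (md K a) e := by rw [tc]; linarith
  have hg : 0 ≤ gram K (md K l) (md K a) e := by
    rw [gram, hh_md, hh_md, ← mul_pow, sub_nonneg]
    exact pow_le_pow_left₀ (by positivity) htc 2
  have hsq := Real.sq_sqrt hg
  have ht : (tc K (md K l) (md K a) e / sn K l) ^ 2 -
      (ε * √(gram K (md K l) (md K a) e) / sn K l) ^ 2 = sn K a ^ 2 := by
    rw [div_pow, div_pow, mul_pow, hε, hsq, gram, hh_md, hh_md]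
    field_simp; ring
  obtain ⟨z, h1, h2, h3, h4, h5⟩ := exists_future_point ha
    (abs_le_of_sq_le_sq (by nlinarith [sq_nonneg (sn K a)])
      (div_nonneg (le_trans (by positivity) htc) hsn.le)) ht
  have hEc := E_axis (a := md K a) h2 h3 (by rw [h4, ht, hh_md])
  have hE0 := hEc 0
  simp only [md_zero, sn_zero, mul_zero, add_zero, zero_mul, sub_zero] at hE0
  obtain ⟨h6, h7⟩ := tau_toReal_of_loc h1 (h5 0 (inRange_zero K)) ha hE0
  refine ⟨z, h1, h6, h7, ?_, h5 l hl, ?_⟩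
  · rw [hEc l, mul_div_cancel₀ _ hsn.ne', tc]; ring
  · rw [vol_axis, h4, mul_div_cancel₀ _ hsn.ne']

/-- A point in the past of the origin with prescribed energies to two points of the axis. -/
theorem exists_point_past {K l a e : ℝ} (hl : InRange K l) (hl0 : 0 < l) (ha : InRange K a)
    (he : md K (a + l) ≤ e) :
    ∃ z, causal K z (axis K 0) ∧ tau K z (axis K 0) < diamBound K ∧
      (tau K z (axis K 0)).toReal = a ∧ E K z (axis K l) = e ∧
      vol K (axis K 0) (axis K l) z = √(gram K (md K l) (md K a) e) := by
  have hsn := sn_pos hl hl0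
  have hsa := sn_nonneg ha
  rw [md_add] at he
  have htc : sn K l * sn K a ≤ -tc K (md K l) (md K a) e := by rw [tc]; linarith
  have hg : 0 ≤ gram K (md K l) (md K a) e := by
    rw [gram, hh_md, hh_md, ← mul_pow, sub_nonneg, ← neg_sq (tc _ _ _ _)]
    exact pow_le_pow_left₀ (by positivity) htc 2
  have hsq := Real.sq_sqrt hg
  have ht : (-tc K (md K l) (md K a) e / sn K l) ^ 2 -
      (√(gram K (md K l) (md K a) e) / sn K l) ^ 2 = sn K a ^ 2 := by
    rw [div_pow, div_pow, hsq, gram, hh_md, hh_md]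
    field_simp; ring
  -- The point is built in the future of the origin with the sign of `tc` reversed and then
  -- reflected; the axis point at `l` corresponds to the one at `-l`.
  obtain ⟨z, h1, h2, h3, h4, h5⟩ := exists_future_point ha
    (abs_le_of_sq_le_sq (by nlinarith [sq_nonneg (sn K a)])
      (div_nonneg (le_trans (by positivity) htc) hsn.le)) ht
  have hEc := E_axis (a := md K a) h2 h3 (by rw [h4, ht, hh_md])
  have hE0 := hEc 0
  simp only [md_zero, sn_zero, mul_zero, add_zero, zero_mul, sub_zero] at hE0
  obtain ⟨h6, h7⟩ := tau_toReal_of_loc h1 (h5 0 (inRange_zero K)) ha hE0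
  have hr0 : axis K 0 = rev (axis K 0) := by rw [rev_axis, neg_zero]
  refine ⟨rev z, ?_, ?_, ?_, ?_, ?_⟩
  · rw [hr0, causal_rev]; exact h1
  · rw [hr0, tau_rev]; exact h6
  · rw [hr0, tau_rev]; exact h7
  · have : axis K l = rev (axis K (-l)) := by rw [rev_axis, neg_neg]
    rw [this, E_rev, E_comm, hEc (-l), md_neg, sn_neg, neg_mul, mul_div_cancel₀ _ hsn.ne', tc]; ring
  · rw [vol_axis, ambX_rev, h4, mul_div_cancel₀ _ hsn.ne']

/-- The third vertex of a triangle over a side on the axis, between its endpoints. -/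
theorem exists_point_between {K l a b ε : ℝ} (hl : InRange K l) (hl0 : 0 < l) (ha : 0 ≤ a)
    (hb : 0 < b) (hab : a + b ≤ l) (hε : ε ^ 2 = 1) :
    ∃ z, causal K (axis K 0) z ∧ causal K z (axis K l) ∧
      (tau K (axis K 0) z).toReal = a ∧ (tau K z (axis K l)).toReal = b ∧
      vol K (axis K 0) (axis K l) z = ε * √(gram K (md K l) (md K a) (md K b)) := by
  have ra : InRange K a := hl.mono ha (by linarith)
  have rb : InRange K b := hl.mono hb.le (by linarith)
  obtain ⟨c1, c2, c3⟩ := causal_axis hl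
  obtain ⟨z, h1, h2, h3, h4, h5, h6⟩ := exists_point_future hl hl0 ra
    (md_le_md hb.le (hl.mono (by linarith) (by linarith)) (by linarith : b ≤ l - a)) hε
  have h7 : causal K z (axis K l) := by
    rcases causal_or_of_E_nonneg h5 (by rw [h4]; exact md_nonneg _ _) with h | h
    · have := toReal_add_le c1 h h2
      have hn : 0 ≤ (tau K (axis K l) z).toReal := ENNReal.toReal_nonneg
      linarith
    · exact h
  refine ⟨z, h1, h7, h3, ?_, h6⟩
  exact toReal_tau_eq h7 (tau_lt_right h1 h7 c2) rb (by rw [E_comm, h4])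

/-- The future vertex of a triangle over a side on the axis. -/
theorem exists_point_beyond {K l a b ε : ℝ} (hl0 : 0 < l) (ha : InRange K a)
    (hb : 0 < b) (hab : l + b ≤ a) (hε : ε ^ 2 = 1) :
    ∃ z, causal K (axis K l) z ∧ tau K (axis K 0) z < diamBound K ∧
      (tau K (axis K 0) z).toReal = a ∧ (tau K (axis K l) z).toReal = b ∧
      vol K (axis K 0) (axis K l) z = ε * √(gram K (md K l) (md K a) (md K b)) := by
  have rl : InRange K l := ha.mono hl0.le (by linarith)
  have rb : InRange K b := ha.mono hb.le (by linarith)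
  obtain ⟨c1, c2, c3⟩ := causal_axis rl
  obtain ⟨z, h1, h2, h3, h4, h5, h6⟩ := exists_point_future (e := md K b) rl hl0 ha
    (by rw [← neg_sub, md_neg]
        exact md_le_md hb.le (ha.mono (by linarith) (by linarith)) (by linarith : b ≤ a - l)) hε
  have h7 : causal K (axis K l) z := by
    rcases causal_or_of_E_nonneg h5 (by rw [h4]; exact md_nonneg _ _) with h | h
    · exact h
    · have := toReal_add_le h1 h c2
      have hn : 0 ≤ (tau K z (axis K l)).toReal := ENNReal.toReal_nonneg
      linarith
  exact ⟨z, h7, h2, h3, toReal_tau_eq h7 (tau_lt_right c1 h7 h2) rb h4, h6⟩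

end Model

/-! ### The four-point condition in terms of energies -/

namespace Model

theorem gram_comm (K g a b : ℝ) : gram K g a b = gram K g b a := by
  simp only [gram, tc, hh]; ring

theorem polar_swap (K g a b a' b' : ℝ) : polar K g a b a' b' = polar K g b a b' a' := by
  simp only [polar, tc, hh]; ring

theorem polar_comm (K g a b a' b' : ℝ) : polar K g a b a' b' = polar K g a' b' a b := by
  simp only [polar, tc, hh]; ring

/-- Degenerate triangles have zero Gram determinant. This is why the four-point inequalities lose
their square root terms in the midpoint limit. -/
theorem gram_of_additive (K l s : ℝ) : gram K (md K l) (md K s) (md K (l - s)) = 0 := by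
  rw [gram, hh_md, hh_md, tc, md_sub]; ring

theorem gram_of_additive_side (K l s : ℝ) : gram K (md K (l - s)) (md K s) (md K l) = 0 := by
  have := gram_of_additive K l s
  simp only [gram, tc, hh] at *
  linear_combination this

theorem stewart_symm (K l s a b : ℝ) : stewart K l s a b = stewart K l (l - s) b a := by
  simp only [stewart, sub_sub_cancel]
  congr 1
  rw [md_sub, sn_sub]
  linear_combination sn K s * sn_sq K l

theorem tau_le_of_diamond {K : ℝ} {a b p q : Model} (h1 : causal K a p) (h4 : causal K q b)
    (h : tau K a b < diamBound K) : tau K p q ≤ tau K a b := by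
  by_cases hc : causal K p q
  · have h2 := tau_lt_right h1 (causal_trans hc h4) h
    have h3 := tau_lt_left hc h4 h2
    rw [← ENNReal.toReal_le_toReal h3.ne_top h.ne_top]
    have := toReal_add_le h1 (causal_trans hc h4) h
    have := toReal_add_le hc h4 h2
    have : 0 ≤ (tau K a p).toReal := ENNReal.toReal_nonneg
    have : 0 ≤ (tau K q b).toReal := ENNReal.toReal_nonneg
    linarith
  · rw [tau_eq_zero hc]; exact zero_le

/-- A quantitative inverse for `md`: a small loss in energy costs at most `η` in time separation,
uniformly in `t`. -/
theorem exists_md_slack {K t₀ η : ℝ} (h0 : InRange K t₀) (hη : 0 < η) :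
    ∃ η' > 0, ∀ t, 0 ≤ t → md K t₀ - η' ≤ md K t → t₀ ≤ t + η := by
  by_cases h : t₀ ≤ η
  · exact ⟨1, one_pos, fun t ht _ => by linarith⟩
  · push Not at h
    have hr : InRange K (t₀ - η) := h0.mono (by linarith) (by linarith)
    refine ⟨md K t₀ - md K (t₀ - η), sub_pos.2 (md_lt_md hr.1 h0 (by linarith)), fun t ht hle => ?_⟩
    by_contra hc
    have := md_lt_md ht hr (by linarith)
    linarith

/-- At `(s, l - s)` the Gram determinant vanishes and the left side is `sn l ^ 2` times the Stewart
value; the rest is continuity in `(p, q)`. The unknown energy `e` only occurs linearly on the right,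
so one neighbourhood serves for all `e`. -/
theorem polar_bound_near_midpoint {K l s α β G η : ℝ} (hl : InRange K l) (hs0 : 0 < s) (hsl : s < l)
    (hη : 0 < η) :
    ∃ δ > 0, ∀ p q, |p - s| < δ → |q - (l - s)| < δ → ∀ e,
      polar K (md K l) (md K p) (md K q) α β - √(gram K (md K l) (md K p) (md K q)) * G ≤
        hh K (md K l) * e → stewart K l s α β - η ≤ e := by
  have hsn := sn_pos hl (hs0.trans hsl)
  have hcont : Continuous fun z : ℝ × ℝ =>
      polar K (md K l) (md K z.1) (md K z.2) α β -
        √(gram K (md K l) (md K z.1) (md K z.2)) * G := by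
    have := continuous_md K
    unfold polar gram tc hh
    fun_prop
  have h0 : sn K l ^ 2 * (stewart K l s α β - η) <
      polar K (md K l) (md K s) (md K (l - s)) α β -
        √(gram K (md K l) (md K s) (md K (l - s))) * G := by
    rw [polar_of_additive hsn.ne', gram_of_additive]
    simp only [Real.sqrt_zero, zero_mul, sub_zero]
    have := pow_pos hsn 2
    nlinarith
  have := (hcont.tendsto (s, l - s)).eventually (lt_mem_nhds h0)
  obtain ⟨δ, hδ, hb⟩ := Metric.eventually_nhds_iff.1 this
  refine ⟨δ, hδ, fun p q hp hq e he => ?_⟩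
  have hb := hb (y := (p, q)) (by
    rw [Prod.dist_eq]; exact max_lt (by rwa [Real.dist_eq]) (by rwa [Real.dist_eq]))
  simp only at hb
  rw [hh_md] at he
  have : sn K l ^ 2 * (stewart K l s α β - η) < sn K l ^ 2 * e := by linarith
  exact (lt_of_mul_lt_mul_left this (by positivity)).le

theorem polar_side (K l s ζ w ω : ℝ) (hl : sn K l ≠ 0) :
    polar K (md K (l - s)) (md K s) (md K l) w ω - hh K (md K (l - s)) * ζ =
      sn K (l - s) * sn K l * (w - stewart K l s ζ ω) := by
  have h1 : tc K (md K (l - s)) (md K s) (md K l) = -(sn K s * sn K (l - s)) := by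
    have := md_add K s (l - s)
    rw [add_sub_cancel] at this
    rw [tc]; linear_combination -this
  rw [polar, h1, hh_md, tc, stewart]
  have h2 := sn_add K s (l - s)
  rw [add_sub_cancel] at h2
  have h3 := md_add K s (l - s)
  rw [add_sub_cancel] at h3
  field_simp
  rw [h2, h3]
  linear_combination (-sn K (l - s) ^ 2) * sn_sq K s

/-- Here the unknown energy `w` also occurs under a square root and in the polar term, so continuity
must be uniform in `w`. A violating `w` would lie in the compact interval from `0` to `stewart - η`,
on which the strict inequality holds uniformly near the limit. -/
theorem polar_bound_near_side_midpoint {K l s ζ ω η : ℝ} (hl : InRange K l) (hs0 : 0 < s)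
    (hsl : s < l) (hη : 0 < η) :
    ∃ δ > 0, ∀ p q, |p - s| < δ → |q - (l - s)| < δ → ∀ w, 0 ≤ w →
      hh K (md K q) * ζ ≤ √(gram K (md K q) (md K p) (md K l)) * √(gram K (md K q) w ω) +
        polar K (md K q) (md K p) (md K l) w ω → stewart K l s ζ ω - η ≤ w := by
  have hsn := sn_pos hl (hs0.trans hsl)
  have hsn' := sn_pos (hl.mono (by linarith) (by linarith) : InRange K (l - s)) (by linarith)
  have hcont : Continuous fun z : (ℝ × ℝ) × ℝ =>
      √(gram K (md K z.1.2) (md K z.1.1) (md K l)) * √(gram K (md K z.1.2) z.2 ω) +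
        polar K (md K z.1.2) (md K z.1.1) (md K l) z.2 ω - hh K (md K z.1.2) * ζ := by
    have := continuous_md K
    unfold polar gram tc hh
    fun_prop
  have key : ∀ w ∈ Icc 0 (stewart K l s ζ ω - η), ∀ᶠ z : (ℝ × ℝ) × ℝ in 𝓝 ((s, l - s), w),
      √(gram K (md K z.1.2) (md K z.1.1) (md K l)) * √(gram K (md K z.1.2) z.2 ω) +
        polar K (md K z.1.2) (md K z.1.1) (md K l) z.2 ω - hh K (md K z.1.2) * ζ < 0 := by
    intro w hw
    refine (hcont.tendsto ((s, l - s), w)).eventually (gt_mem_nhds ?_)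
    simp only [gram_of_additive_side, Real.sqrt_zero, zero_mul, zero_add]
    rw [polar_side _ _ _ _ _ _ hsn.ne']
    exact mul_neg_of_pos_of_neg (mul_pos hsn' hsn) (by linarith [hw.2])
  have := isCompact_Icc.eventually_forall_of_forall_eventually (P := fun (z : ℝ × ℝ) w =>
    √(gram K (md K z.2) (md K z.1) (md K l)) * √(gram K (md K z.2) w ω) +
        polar K (md K z.2) (md K z.1) (md K l) w ω - hh K (md K z.2) * ζ < 0) key
  obtain ⟨δ, hδ, hb⟩ := Metric.eventually_nhds_iff.1 this
  refine ⟨δ, hδ, fun p q hp hq w hw hle => ?_⟩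
  by_contra hc
  have hb := hb (y := (p, q)) (by
    rw [Prod.dist_eq]; exact max_lt (by rwa [Real.dist_eq]) (by rwa [Real.dist_eq])) w ⟨hw, by linarith⟩
  simp only at hb
  linarith

end Model

/-! ### Elimination of the comparison configurations -/

namespace LorentzianPreLengthSpace

open Model (md sn InRange gram polar hh stewart)

variable {X : Type*} [MetricSpace X] [LorentzianPreLengthSpace X]

theorem tau_pos_of_chron {x y : X} (h : chron x y) : 0 < tau x y := (tau_pos_iff x y).2 h

theorem toReal_tau_pos {x y : X} (h : chron x y) (ht : tau x y ≠ ⊤) : 0 < (tau x y).toReal :=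
  ENNReal.toReal_pos (tau_pos_of_chron h).ne' ht

theorem tau_le_of_causal_right {x y z : X} (h1 : causal x y) (h2 : causal y z) :
    tau x y ≤ tau x z := le_self_add.trans (reverse_triangle x y z h1 h2)

theorem tau_le_of_causal_left {x y z : X} (h1 : causal x y) (h2 : causal y z) :
    tau y z ≤ tau x z := le_add_self.trans (reverse_triangle x y z h1 h2)

theorem toReal_tau_add_le {x y z : X} (h1 : causal x y) (h2 : causal y z) (h : tau x z ≠ ⊤) :
    (tau x y).toReal + (tau y z).toReal ≤ (tau x z).toReal := by
  rw [← ENNReal.toReal_add (ne_top_of_le_ne_top h (tau_le_of_causal_right h1 h2))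
    (ne_top_of_le_ne_top h (tau_le_of_causal_left h1 h2))]
  exact ENNReal.toReal_mono h (reverse_triangle x y z h1 h2)

/-- The energy of a pair of points. -/
noncomputable def energy (K : ℝ) (x y : X) : ℝ := md K (tau x y).toReal

theorem eq_of_toReal_eq {a b : ℝ≥0∞} (ha : a ≠ ⊤) (hb : b ≠ ⊤) (h : a.toReal = b.toReal) : a = b :=
  (ENNReal.toReal_eq_toReal_iff' ha hb).1 h

/-- The explicit configuration has `y₁ y₄` on the axis and `y₂, y₃` with volumes of opposite sign.
By `hh_mul_E` the left side is `hh` times the model energy of `y₂, y₃`. -/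
theorem four_point_opposite {K : ℝ} {x₁ x₂ x₃ x₄ : X} (h12 : chron x₁ x₂) (h23 : chron x₂ x₃)
    (h34 : chron x₃ x₄) (h : tau x₁ x₄ < diamBound K)
    (H : ∀ y₁ y₂ y₃ y₄ : Model,
        IsComparisonTriangle K x₁ x₂ x₄ y₁ y₂ y₄ → IsComparisonTriangle K x₁ x₃ x₄ y₁ y₃ y₄ →
        Model.OppositeSides K y₁ y₄ y₂ y₃ → Model.tau K y₂ y₃ ≤ tau x₂ x₃) :
    polar K (energy K x₁ x₄) (energy K x₁ x₂) (energy K x₂ x₄) (energy K x₁ x₃) (energy K x₃ x₄) -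
      √(gram K (energy K x₁ x₄) (energy K x₁ x₂) (energy K x₂ x₄)) *
        √(gram K (energy K x₁ x₄) (energy K x₁ x₃) (energy K x₃ x₄)) ≤
      hh K (energy K x₁ x₄) * energy K x₂ x₃ := by
  have c12 := causal_of_chron _ _ h12
  have c23 := causal_of_chron _ _ h23
  have c34 := causal_of_chron _ _ h34
  have c24 := causal_trans _ _ _ c23 c34
  have c13 := causal_trans _ _ _ c12 c23
  have t24 := (tau_le_of_causal_left c12 c24).trans_lt h
  have t12 := (tau_le_of_causal_right c12 c24).trans_lt h
  have t34 := (tau_le_of_causal_left c13 c34).trans_lt h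
  have t13 := (tau_le_of_causal_right c13 c34).trans_lt h
  have t23 := (tau_le_of_causal_left c12 c23).trans_lt t13
  have p12 := toReal_tau_pos h12 t12.ne_top
  have p23 := toReal_tau_pos h23 t23.ne_top
  have p34 := toReal_tau_pos h34 t34.ne_top
  have a124 := toReal_tau_add_le c12 c24 h.ne_top
  have a134 := toReal_tau_add_le c13 c34 h.ne_top
  have a123 := toReal_tau_add_le c12 c23 t13.ne_top
  have a234 := toReal_tau_add_le c23 c34 t24.ne_top
  have rl := Model.inRange_toReal h
  set l := (tau x₁ x₄).toReal with hl
  have hl0 : 0 < l := by linarith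
  obtain ⟨b1, b2, b3⟩ := Model.causal_axis rl
  obtain ⟨y₂, u1, u2, u3, u4, u5⟩ := Model.exists_point_between (ε := 1) rl hl0 p12.le
    (p23.trans_le (by linarith)) a124 (by norm_num)
  obtain ⟨y₃, v1, v2, v3, v4, v5⟩ := Model.exists_point_between (ε := -1) rl hl0
    (p12.le.trans (by linarith)) p34 a134 (by norm_num)
  have e14 : Model.tau K (Model.axis K 0) (Model.axis K l) = tau x₁ x₄ :=
    eq_of_toReal_eq b2.ne_top h.ne_top b3
  have mu1 := Model.tau_lt_left u1 u2 b2
  have mu2 := Model.tau_lt_right u1 u2 b2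
  have mv1 := Model.tau_lt_left v1 v2 b2
  have mv2 := Model.tau_lt_right v1 v2 b2
  have key := H (Model.axis K 0) y₂ y₃ (Model.axis K l)
    ⟨u1, u2, eq_of_toReal_eq mu1.ne_top t12.ne_top u3, eq_of_toReal_eq mu2.ne_top t24.ne_top u4, e14⟩
    ⟨v1, v2, eq_of_toReal_eq mv1.ne_top t13.ne_top v3, eq_of_toReal_eq mv2.ne_top t34.ne_top v4, e14⟩
    (by rw [Model.side_mul_nonpos, u5, v5]
        have := mul_nonneg (Real.sqrt_nonneg (gram K (md K l) (md K (tau x₁ x₂).toReal)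
          (md K (tau x₂ x₄).toReal))) (Real.sqrt_nonneg (gram K (md K l) (md K (tau x₁ x₃).toReal)
          (md K (tau x₃ x₄).toReal)))
        linarith)
  have hE := Model.hh_mul_E K (Model.axis K 0) (Model.axis K l) y₂ y₃
  rw [Model.E_comm K (Model.axis K l) y₂, Model.E_comm K (Model.axis K l) y₃, u5, v5, Model.E_eq_md b1 b2, Model.E_eq_md u1 mu1, Model.E_eq_md u2 mu2,
    Model.E_eq_md v1 mv1, Model.E_eq_md v2 mv2, b3, u3, u4, v3, v4] at hE
  -- The hypothesis compares separations, which vanish for spacelike pairs, whereas the energy may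
  -- be negative. Assuming the contrary makes the model energy nonnegative, hence the pair causal,
  -- in the order dictated by `τ(x₁, x₂) < τ(x₁, x₃)`.
  have hfin : Model.E K y₂ y₃ ≤ energy K x₂ x₃ := by
    by_contra hc
    push Not at hc
    have hE0 : 0 ≤ Model.E K y₂ y₃ := (Model.md_nonneg _ _).trans hc.le
    have hcaus : Model.causal K y₂ y₃ := by
      rcases Model.causal_or_of_E_nonneg (Model.loc_of_diamond u1 u2 v1 v2 b2) hE0 with h' | h'
      · exact h'
      · exfalso
        have := Model.toReal_add_le v1 h' mu1
        have : 0 ≤ (Model.tau K y₃ y₂).toReal := ENNReal.toReal_nonneg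
        linarith
    have m23 := Model.tau_lt_left hcaus v2 mu2
    rw [Model.E_eq_md hcaus m23] at hc
    have := ENNReal.toReal_mono t23.ne_top key
    exact absurd (Model.md_le_md ENNReal.toReal_nonneg (Model.inRange_toReal t23) this)
      (not_le.2 hc)
  have hh0 : 0 ≤ hh K (md K l) := by rw [Model.hh_md]; positivity
  have := mul_le_mul_of_nonneg_left hfin hh0
  simp only [energy] at *
  rw [← hl]
  linarith

/-- Now `y₂ y₃` lies on the axis, with `y₁` in its past and `y₄` in its future, and both volumes are
nonnegative. The right side is `hh` times the model energy of `y₁, y₄`. -/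
theorem four_point_same {K : ℝ} {x₁ x₂ x₃ x₄ : X} (h12 : chron x₁ x₂) (h23 : chron x₂ x₃)
    (h34 : chron x₃ x₄) (h : tau x₁ x₄ < diamBound K)
    (H : ∀ y₁ y₂ y₃ y₄ : Model,
        IsComparisonTriangle K x₁ x₂ x₃ y₁ y₂ y₃ → IsComparisonTriangle K x₂ x₃ x₄ y₂ y₃ y₄ →
        Model.SameSide K y₂ y₃ y₁ y₄ → tau x₁ x₄ ≤ Model.tau K y₁ y₄) :
    hh K (energy K x₂ x₃) * energy K x₁ x₄ ≤
      √(gram K (energy K x₂ x₃) (energy K x₁ x₂) (energy K x₁ x₃)) *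
        √(gram K (energy K x₂ x₃) (energy K x₂ x₄) (energy K x₃ x₄)) +
      polar K (energy K x₂ x₃) (energy K x₁ x₂) (energy K x₁ x₃) (energy K x₂ x₄)
        (energy K x₃ x₄) := by
  have c12 := causal_of_chron _ _ h12
  have c23 := causal_of_chron _ _ h23
  have c34 := causal_of_chron _ _ h34
  have c24 := causal_trans _ _ _ c23 c34
  have c13 := causal_trans _ _ _ c12 c23
  have t24 := (tau_le_of_causal_left c12 c24).trans_lt h
  have t12 := (tau_le_of_causal_right c12 c24).trans_lt h
  have t34 := (tau_le_of_causal_left c13 c34).trans_lt h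
  have t13 := (tau_le_of_causal_right c13 c34).trans_lt h
  have t23 := (tau_le_of_causal_left c12 c23).trans_lt t13
  have p12 := toReal_tau_pos h12 t12.ne_top
  have p23 := toReal_tau_pos h23 t23.ne_top
  have p34 := toReal_tau_pos h34 t34.ne_top
  have a124 := toReal_tau_add_le c12 c24 h.ne_top
  have a123 := toReal_tau_add_le c12 c23 t13.ne_top
  have a234 := toReal_tau_add_le c23 c34 t24.ne_top
  have rl := Model.inRange_toReal t23
  have r12 := Model.inRange_toReal t12
  have r13 := Model.inRange_toReal t13
  set l := (tau x₂ x₃).toReal with hl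
  obtain ⟨b1, b2, b3⟩ := Model.causal_axis rl
  obtain ⟨y₄, v1, v2, v3, v4, v5⟩ := Model.exists_point_beyond (ε := 1) p23
    (Model.inRange_toReal t24) p34 a234 (by norm_num)
  obtain ⟨y₁, u1, u2, u3, u4, u5⟩ := Model.exists_point_past (e := md K (tau x₁ x₃).toReal) rl p23
    r12 (Model.md_le_md (by linarith [r12.1]) r13 a123)
  -- The construction prescribes only the energy of `y₁, y₃`; that it corresponds to a separation
  -- below `D_K` has to be deduced.
  have m13 : Model.tau K y₁ (Model.axis K l) < diamBound K :=
    Model.tau_lt_of_E_le u1 b1 u2 b2 r13 (by rw [u3, b3]; exact a123) u4.le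
  have m13' := Model.toReal_tau_eq (Model.causal_trans u1 b1) m13 r13 u4
  have m34 := Model.tau_lt_right b1 v1 v2
  have e23 := eq_of_toReal_eq b2.ne_top t23.ne_top b3
  have key := H y₁ (Model.axis K 0) (Model.axis K l) y₄
    ⟨u1, b1, eq_of_toReal_eq u2.ne_top t12.ne_top u3, e23,
      eq_of_toReal_eq m13.ne_top t13.ne_top m13'⟩
    ⟨b1, v1, e23, eq_of_toReal_eq m34.ne_top t34.ne_top v4,
      eq_of_toReal_eq v2.ne_top t24.ne_top v3⟩
    (by rw [Model.side_mul_nonneg, u5, v5]; positivity)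
  have hE := Model.hh_mul_E K (Model.axis K 0) (Model.axis K l) y₁ y₄
  have c04 := Model.causal_trans b1 v1
  rw [Model.E_comm K (Model.axis K 0) y₁, Model.E_comm K (Model.axis K l) y₁, u5, v5,
    Model.E_eq_md b1 b2, Model.E_eq_md u1 u2, u4, Model.E_eq_md c04 v2, Model.E_eq_md v1 m34, b3,
    u3, v3, v4] at hE
  -- A priori `y₁` and `y₄` may be at separation `D_K` or more. The contrary assumption bounds their
  -- energy and thereby brings them below `D_K`.
  have hfin : energy K x₁ x₄ ≤ Model.E K y₁ y₄ := by
    by_contra hc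
    push Not at hc
    have r14 := Model.inRange_toReal h
    have m14 : Model.tau K y₁ y₄ < diamBound K :=
      Model.tau_lt_of_E_le u1 c04 u2 v2 r14 (by rw [u3, v3]; exact a124) hc.le
    rw [Model.E_eq_md (Model.causal_trans u1 c04) m14] at hc
    have := ENNReal.toReal_mono m14.ne_top key
    exact absurd (Model.md_le_md ENNReal.toReal_nonneg (Model.inRange_toReal m14) this)
      (not_le.2 hc)
  have hh0 : 0 ≤ hh K (md K l) := by rw [Model.hh_md]; positivity
  have := mul_le_mul_of_nonneg_left hfin hh0
  simp only [energy] at *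
  rw [← hl]
  linarith

end LorentzianPreLengthSpace

/-! ### From the four-point condition to the `ε`-`μ` triangle condition -/

/-- The tolerance must be chosen before any comparison triangle is given. It depends on the model
separation only through its energy `e`, and if `e` is not an energy in range the claim is vacuous.
-/
theorem Model.exists_md_slack_of_eq {K : ℝ} (e : ℝ) {η : ℝ} (hη : 0 < η) :
    ∃ η' > 0, ∀ t₀, InRange K t₀ → md K t₀ = e → ∀ t, 0 ≤ t → e - η' ≤ md K t → t₀ ≤ t + η := by
  by_cases h : ∃ t₀, InRange K t₀ ∧ md K t₀ = e
  · obtain ⟨t₀, h0, rfl⟩ := h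
    obtain ⟨η', h1, h2⟩ := exists_md_slack h0 hη
    refine ⟨η', h1, fun t₁ h3 h4 => ?_⟩
    rw [md_inj h3 h0 h4]
    exact h2
  · exact ⟨1, one_pos, fun t₀ h1 h2 => absurd ⟨t₀, h1, h2⟩ h⟩

/-- The modulus is the infimum of the admissible errors plus `ε`; the summand `ε` makes it
admissible although the infimum need not be attained. -/
theorem exists_modulus {P : ℝ≥0 → ℝ≥0 → Prop} (hmono : ∀ ε δ δ', δ ≤ δ' → P ε δ → P ε δ')
    (hbound : ∀ ε, ∃ B, P ε B)
    (hlim : ∀ η : ℝ≥0, 0 < η → ∃ δ : ℝ, 0 < δ ∧ ∀ ε : ℝ≥0, (ε : ℝ) < δ → P ε η) :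
    ∃ f : ℝ≥0 → ℝ≥0, Tendsto f (𝓝[>] 0) (𝓝 0) ∧ ∀ ε, 0 < ε → P ε (f ε) := by
  refine ⟨fun ε => sInf {δ | P ε δ} + ε, ?_, fun ε hε => ?_⟩
  · rw [tendsto_order]
    refine ⟨fun a ha => absurd ha not_lt_zero, fun a ha => ?_⟩
    obtain ⟨δ, hδ, h⟩ := hlim (a / 2) (by positivity)
    have h1 : ∀ᶠ ε : ℝ≥0 in 𝓝[>] 0, (ε : ℝ) < δ := by
      refine (NNReal.continuous_coe.tendsto 0 |>.mono_left nhdsWithin_le_nhds).eventually_lt_const ?_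
      simpa using hδ
    have h2 : ∀ᶠ ε : ℝ≥0 in 𝓝[>] 0, ε < a / 2 :=
      (tendsto_id.mono_left nhdsWithin_le_nhds).eventually_lt_const (by positivity)
    filter_upwards [h1, h2] with ε e1 e2
    calc sInf {δ | P ε δ} + ε < a / 2 + a / 2 :=
          add_lt_add_of_le_of_lt (csInf_le (OrderBot.bddBelow _) (h ε e1)) e2
      _ = a := add_halves a
  · obtain ⟨B, hB⟩ := hbound ε
    obtain ⟨δ, h1, h2⟩ := exists_lt_of_csInf_lt ⟨B, hB⟩
      (lt_add_of_pos_right (sInf {δ | P ε δ}) hε)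
    exact hmono _ _ _ h2.le h1

theorem ENNReal.le_add_coe_of_toReal {a b : ℝ≥0∞} {η : ℝ≥0} (ha : a ≠ ⊤)
    (h : b ≠ ⊤ → a.toReal ≤ b.toReal + η) : a ≤ b + η := by
  by_cases hb : b = ⊤
  · simp [hb]
  · rw [← ENNReal.toReal_le_toReal ha (ENNReal.add_ne_top.2 ⟨hb, ENNReal.coe_ne_top⟩),
      ENNReal.toReal_add hb ENNReal.coe_ne_top]
    simpa using h hb

theorem IsMuMidpoint.model_spec {K μ : ℝ} {a b m : Model}
    (h : IsMuMidpoint (Model.tau K) μ a b m) (h0 : 0 < μ) (h1 : μ < 1) (hp : 0 < Model.tau K a b) :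
    Model.causal K a m ∧ Model.causal K m b ∧
      (Model.tau K a m).toReal = μ * (Model.tau K a b).toReal ∧
      (Model.tau K m b).toReal = (Model.tau K a b).toReal - μ * (Model.tau K a b).toReal := by
  obtain ⟨e1, e2⟩ := h
  refine ⟨Model.causal_of_tau_pos ?_, Model.causal_of_tau_pos ?_, ?_, ?_⟩
  · rw [e1]; exact ENNReal.mul_pos (by simpa using h0) hp.ne'
  · rw [e2]; exact ENNReal.mul_pos (by simpa using h1) hp.ne'
  · rw [e1, ENNReal.toReal_mul, ENNReal.toReal_ofReal h0.le]
  · rw [e2, ENNReal.toReal_mul, ENNReal.toReal_ofReal (by linarith)]; ring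

theorem abs_toReal_sub_lt {a b : ℝ≥0∞} {ε : ℝ≥0} (hb : b ≠ ⊤) (h1 : a < b + ε) (h2 : b < a + ε) :
    a ≠ ⊤ ∧ |a.toReal - b.toReal| < ε := by
  have ha : a ≠ ⊤ := h1.ne_top
  refine ⟨ha, ?_⟩
  have e1 := ENNReal.toReal_strict_mono (ENNReal.add_ne_top.2 ⟨hb, ENNReal.coe_ne_top⟩) h1
  have e2 := ENNReal.toReal_strict_mono (ENNReal.add_ne_top.2 ⟨ha, ENNReal.coe_ne_top⟩) h2
  rw [ENNReal.toReal_add hb ENNReal.coe_ne_top, ENNReal.coe_toReal] at e1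
  rw [ENNReal.toReal_add ha ENNReal.coe_ne_top, ENNReal.coe_toReal] at e2
  rw [abs_lt]; constructor <;> linarith

theorem IsEpsMuMidpoint.spec {Y : Type*} {τ : Y → Y → ℝ≥0∞} {ε : ℝ≥0} {μ : ℝ} {a b m : Y}
    (h : IsEpsMuMidpoint τ ε μ a b m) (h0 : 0 < μ) (h1 : μ < 1) (hab : τ a b ≠ ⊤) :
    τ a m ≠ ⊤ ∧ τ m b ≠ ⊤ ∧ |(τ a m).toReal - μ * (τ a b).toReal| < ε ∧
      |(τ m b).toReal - ((τ a b).toReal - μ * (τ a b).toReal)| < ε := by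
  obtain ⟨⟨a1, a2⟩, b1, b2⟩ := h
  have A := abs_toReal_sub_lt (ENNReal.mul_ne_top ENNReal.ofReal_ne_top hab) a1 a2
  have B := abs_toReal_sub_lt (ENNReal.mul_ne_top ENNReal.ofReal_ne_top hab) b1 b2
  rw [ENNReal.toReal_mul, ENNReal.toReal_ofReal h0.le] at A
  rw [ENNReal.toReal_mul, ENNReal.toReal_ofReal (by linarith), sub_mul, one_mul] at B
  exact ⟨A.1, B.1, A.2, B.2⟩

namespace LorentzianPreLengthSpace

open Model (md sn InRange gram polar hh stewart)

variable {X : Type*} [MetricSpace X] [LorentzianPreLengthSpace X]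

theorem chron_of_toReal_pos {x y : X} (h : 0 < (tau x y).toReal) : chron x y :=
  (tau_pos_iff x y).1 (ENNReal.toReal_pos_iff.1 h).1

/-- The four-point condition for points of `U`. -/
def FourPointOn (K : ℝ) (U : Set X) : Prop :=
  ∀ x₁ ∈ U, ∀ x₂ ∈ U, ∀ x₃ ∈ U, ∀ x₄ ∈ U,
    chron x₁ x₂ → chron x₂ x₃ → chron x₃ x₄ → tau x₁ x₄ < diamBound K →
    (∀ y₁ y₂ y₃ y₄ : Model,
      IsComparisonTriangle K x₁ x₂ x₄ y₁ y₂ y₄ → IsComparisonTriangle K x₁ x₃ x₄ y₁ y₃ y₄ →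
      Model.OppositeSides K y₁ y₄ y₂ y₃ → Model.tau K y₂ y₃ ≤ tau x₂ x₃) ∧
    (∀ y₁ y₂ y₃ y₄ : Model,
      IsComparisonTriangle K x₁ x₂ x₃ y₁ y₂ y₃ → IsComparisonTriangle K x₂ x₃ x₄ y₂ y₃ y₄ →
      Model.SameSide K y₂ y₃ y₁ y₄ → tau x₁ x₄ ≤ Model.tau K y₁ y₄)

/-- The comparison of `ε`-`μ`-midpoints for fixed `ε` and fixed error `δ`. -/
def EpsMuEstimate (K : ℝ) (U : Set X) (μ : ℝ) (ε δ : ℝ≥0) (a b c : X) (a' b' c' : Model) : Prop :=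
  ∀ m ∈ U, IsEpsMuMidpoint tau ε μ a b m → (chron c m ∨ chron m c) →
    ∀ m' : Model, IsMuMidpoint (Model.tau K) μ a' b' m' →
      Model.tau K c' m' ≤ tau c m + δ ∧ Model.tau K m' c' ≤ tau m c + δ

theorem EpsMuEstimate.mono {K : ℝ} {U : Set X} {μ : ℝ} {ε δ δ' : ℝ≥0} {a b c : X} {a' b' c' : Model}
    (h : EpsMuEstimate K U μ ε δ a b c a' b' c') (hd : δ ≤ δ') :
    EpsMuEstimate K U μ ε δ' a b c a' b' c' := fun m hm h1 h2 m' h3 =>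
  ⟨(h m hm h1 h2 m' h3).1.trans (by gcongr), (h m hm h1 h2 m' h3).2.trans (by gcongr)⟩

theorem IsComparisonTriangle.bounds {K : ℝ} {x y z : X} {x' y' z' : Model}
    (ht : IsComparisonTriangle K x y z x' y' z') (h : tau x z < diamBound K) :
    Model.tau K x' z' < diamBound K ∧ Model.tau K x' y' < diamBound K ∧
      Model.tau K y' z' < diamBound K ∧ Model.E K x' z' = energy K x z ∧
      Model.E K x' y' = energy K x y ∧ Model.E K y' z' = energy K y z := by
  have h1 : Model.tau K x' z' < diamBound K := by rwa [ht.tau_xz]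
  have h2 := Model.tau_lt_left ht.causal_xy ht.causal_yz h1
  have h3 := Model.tau_lt_right ht.causal_xy ht.causal_yz h1
  refine ⟨h1, h2, h3, ?_, ?_, ?_⟩
  · rw [Model.E_eq_md (Model.causal_trans ht.causal_xy ht.causal_yz) h1, ht.tau_xz, energy]
  · rw [Model.E_eq_md ht.causal_xy h2, ht.tau_xy, energy]
  · rw [Model.E_eq_md ht.causal_yz h3, ht.tau_yz, energy]

variable {K : ℝ} {U : Set X} {x y z : X}

/-- Same-side condition for the chain `x ≪ m ≪ y ≪ z` over the base `m y`. The triangle `x m y`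
degenerates as `ε` tends to zero. -/
theorem estimate_past_side (H : FourPointOn K U) (hx : x ∈ U) (hy : y ∈ U) (hz : z ∈ U)
    (hxy : chron x y) (hyz : chron y z) (h : tau x z < diamBound K) {μ : ℝ} (h0 : 0 < μ)
    (h1 : μ < 1) {η : ℝ≥0} (hη : 0 < η) :
    ∃ δ : ℝ, 0 < δ ∧ ∀ ε : ℝ≥0, (ε : ℝ) < δ → ∀ x' y' z', IsComparisonTriangle K x y z x' y' z' →
      EpsMuEstimate K U μ ε η x y z x' y' z' := by
  have cxy := causal_of_chron _ _ hxy
  have cyz := causal_of_chron _ _ hyz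
  have txy := (tau_le_of_causal_right cxy cyz).trans_lt h
  have pxy := toReal_tau_pos hxy txy.ne_top
  obtain ⟨η', hη', hs⟩ := Model.exists_md_slack_of_eq (K := K)
    (stewart K (tau x y).toReal (μ * (tau x y).toReal) (energy K x z) (energy K y z))
    (η := η) (by exact_mod_cast hη)
  have p1 : 0 < μ * (tau x y).toReal := by positivity
  have p2 : μ * (tau x y).toReal < (tau x y).toReal := by nlinarith
  obtain ⟨δ, hδ, hb⟩ := Model.polar_bound_near_side_midpoint (ζ := energy K x z)
    (ω := energy K y z) (Model.inRange_toReal txy) p1 p2 hη'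
  -- The last two bounds keep `τ(x, m)` and `τ(m, y)` positive, so that `m` is timelike between `x`
  -- and `y`.
  refine ⟨min δ (min (μ * (tau x y).toReal) ((tau x y).toReal - μ * (tau x y).toReal)),
    lt_min hδ (lt_min p1 (by linarith)), fun ε hε x' y' z' ht m hm hmid _ m' hm' => ?_⟩
  rw [lt_min_iff, lt_min_iff] at hε
  obtain ⟨q1, q2, q3, q4⟩ := hmid.spec h0 h1 txy.ne_top
  obtain ⟨b1, b2, b3, b4, b5, b6⟩ := ht.bounds h
  have hp' : 0 < Model.tau K x' y' := by rw [ht.tau_xy]; exact tau_pos_of_chron hxy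
  obtain ⟨r1, r2, r3, r4⟩ := hm'.model_spec h0 h1 hp'
  have cm'z := Model.causal_trans r2 ht.causal_yz
  refine ⟨by rw [Model.tau_eq_zero_of_causal cm'z]; exact zero_le, ?_⟩
  have tmz' := Model.tau_lt_right r1 cm'z b1
  refine ENNReal.le_add_coe_of_toReal tmz'.ne_top fun _ => ?_
  have hxm : chron x m := chron_of_toReal_pos (by rw [abs_lt] at q3; linarith [hε.2.1])
  have hmy : chron m y := chron_of_toReal_pos (by rw [abs_lt] at q4; linarith [hε.2.2])
  have key := four_point_same hxm hmy hyz h (H x hx m hm y hy z hz hxm hmy hyz h).2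
  have key := hb _ _ (q3.trans hε.1) (q4.trans hε.1) _ (Model.md_nonneg _ _) key
  refine hs _ (Model.inRange_tau tmz') ?_ _ ENNReal.toReal_nonneg key
  rw [← Model.E_eq_md cm'z tmz', Model.E_eq_stewart r1 r2 b2
    (ENNReal.toReal_pos hp'.ne' b2.ne_top) (by rw [r3, r4]; ring), r3, ht.tau_xy, b4, b6]

/-- The mirror image: the chain is `x ≪ y ≪ m ≪ z` over the base `y m`, and the triangle `y m z`
degenerates. The symmetries of `polar` and `gram` bring it to the form of the past side. -/
theorem estimate_future_side (H : FourPointOn K U) (hx : x ∈ U) (hy : y ∈ U) (hz : z ∈ U)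
    (hxy : chron x y) (hyz : chron y z) (h : tau x z < diamBound K) {μ : ℝ} (h0 : 0 < μ)
    (h1 : μ < 1) {η : ℝ≥0} (hη : 0 < η) :
    ∃ δ : ℝ, 0 < δ ∧ ∀ ε : ℝ≥0, (ε : ℝ) < δ → ∀ x' y' z', IsComparisonTriangle K x y z x' y' z' →
      EpsMuEstimate K U μ ε η y z x y' z' x' := by
  have cxy := causal_of_chron _ _ hxy
  have cyz := causal_of_chron _ _ hyz
  have tyz := (tau_le_of_causal_left cxy cyz).trans_lt h
  have pyz := toReal_tau_pos hyz tyz.ne_top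
  obtain ⟨η', hη', hs⟩ := Model.exists_md_slack_of_eq (K := K)
    (stewart K (tau y z).toReal ((tau y z).toReal - μ * (tau y z).toReal) (energy K x z)
      (energy K x y)) (η := η) (by exact_mod_cast hη)
  have p1 : 0 < μ * (tau y z).toReal := by positivity
  have p2 : μ * (tau y z).toReal < (tau y z).toReal := by nlinarith
  obtain ⟨δ, hδ, hb⟩ := Model.polar_bound_near_side_midpoint (ζ := energy K x z)
    (ω := energy K x y) (Model.inRange_toReal tyz) (sub_pos.2 p2) (sub_lt_self _ p1) hη'
  refine ⟨min δ (min (μ * (tau y z).toReal) ((tau y z).toReal - μ * (tau y z).toReal)),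
    lt_min hδ (lt_min p1 (by linarith)), fun ε hε x' y' z' ht m hm hmid _ m' hm' => ?_⟩
  rw [lt_min_iff, lt_min_iff] at hε
  obtain ⟨q1, q2, q3, q4⟩ := hmid.spec h0 h1 tyz.ne_top
  obtain ⟨b1, b2, b3, b4, b5, b6⟩ := ht.bounds h
  have hp' : 0 < Model.tau K y' z' := by rw [ht.tau_yz]; exact tau_pos_of_chron hyz
  obtain ⟨r1, r2, r3, r4⟩ := hm'.model_spec h0 h1 hp'
  have cxm' := Model.causal_trans ht.causal_xy r1
  refine ⟨?_, by rw [Model.tau_eq_zero_of_causal cxm']; exact zero_le⟩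
  have txm' := Model.tau_lt_left cxm' r2 b1
  refine ENNReal.le_add_coe_of_toReal txm'.ne_top fun _ => ?_
  have hym : chron y m := chron_of_toReal_pos (by rw [abs_lt] at q3; linarith [hε.2.1])
  have hmz : chron m z := chron_of_toReal_pos (by rw [abs_lt] at q4; linarith [hε.2.2])
  have key := four_point_same hxy hym hmz h (H x hx y hy m hm z hz hxy hym hmz h).2
  rw [Model.polar_comm, Model.polar_swap, Model.gram_comm K (energy K y m) (energy K x y),
    Model.gram_comm K (energy K y m) (energy K y z), mul_comm (√_) (√_)] at key
  have key := hb _ _ (q4.trans hε.1) (by rw [sub_sub_cancel]; exact q3.trans hε.1) _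
    (Model.md_nonneg _ _) key
  refine hs _ (Model.inRange_tau txm') ?_ _ ENNReal.toReal_nonneg key
  rw [← Model.E_eq_md cxm' txm', Model.E_comm, Model.E_eq_stewart r1 r2 b3
    (ENNReal.toReal_pos hp'.ne' b3.ne_top) (by rw [r3, r4]; ring), r3, ht.tau_yz,
    Model.E_comm K y', Model.E_comm K z', b4, b5, Model.stewart_symm]

/-- Opposite-sides condition over the base `x z`, with the chain ordered by the relation between `m`
and `y`. The degenerating triangle is `x m z`. -/
theorem estimate_long_side (H : FourPointOn K U) (hx : x ∈ U) (hy : y ∈ U) (hz : z ∈ U)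
    (hxy : chron x y) (hyz : chron y z) (h : tau x z < diamBound K) {μ : ℝ} (h0 : 0 < μ)
    (h1 : μ < 1) {η : ℝ≥0} (hη : 0 < η) :
    ∃ δ : ℝ, 0 < δ ∧ ∀ ε : ℝ≥0, (ε : ℝ) < δ → ∀ x' y' z', IsComparisonTriangle K x y z x' y' z' →
      EpsMuEstimate K U μ ε η x z y x' z' y' := by
  have cxy := causal_of_chron _ _ hxy
  have cyz := causal_of_chron _ _ hyz
  have pxz := toReal_tau_pos (chron_trans _ _ _ hxy hyz) h.ne_top
  obtain ⟨η', hη', hs⟩ := Model.exists_md_slack_of_eq (K := K)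
    (stewart K (tau x z).toReal (μ * (tau x z).toReal) (energy K x y) (energy K y z))
    (η := η) (by exact_mod_cast hη)
  have p1 : 0 < μ * (tau x z).toReal := by positivity
  have p2 : μ * (tau x z).toReal < (tau x z).toReal := by nlinarith
  obtain ⟨δ, hδ, hb⟩ := Model.polar_bound_near_midpoint (α := energy K x y) (β := energy K y z)
    (G := √(gram K (energy K x z) (energy K x y) (energy K y z)))
    (Model.inRange_toReal h) p1 p2 hη'
  -- The bound by `η` serves the case in which `m'` and `y'` are causally ordered oppositely to `m`
  -- and `y`.
  refine ⟨min (min δ η) (min (μ * (tau x z).toReal) ((tau x z).toReal - μ * (tau x z).toReal)),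
    lt_min (lt_min hδ (by exact_mod_cast hη)) (lt_min p1 (by linarith)),
    fun ε hε x' y' z' ht m hm hmid hrel m' hm' => ?_⟩
  rw [lt_min_iff, lt_min_iff, lt_min_iff] at hε
  obtain ⟨q1, q2, q3, q4⟩ := hmid.spec h0 h1 h.ne_top
  obtain ⟨b1, b2, b3, b4, b5, b6⟩ := ht.bounds h
  have cxz' := Model.causal_trans ht.causal_xy ht.causal_yz
  have hp' : 0 < Model.tau K x' z' := by
    rw [ht.tau_xz]; exact tau_pos_of_chron (chron_trans _ _ _ hxy hyz)
  obtain ⟨r1, r2, r3, r4⟩ := hm'.model_spec h0 h1 hp'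
  have hxm : chron x m := chron_of_toReal_pos (by rw [abs_lt] at q3; linarith [hε.2.1])
  have hmz : chron m z := chron_of_toReal_pos (by rw [abs_lt] at q4; linarith [hε.2.2])
  have hE := Model.E_eq_stewart r1 r2 b1 (ENNReal.toReal_pos hp'.ne' b1.ne_top)
    (by rw [r3, r4]; ring) y'
  rw [r3, ht.tau_xz, b5, Model.E_comm K z', b6] at hE
  rw [ht.tau_xz] at r3 r4
  rw [abs_lt] at q3 q4
  rcases hrel with hym | hmy
  · have key := four_point_opposite hxy hym hmz h (H x hx y hy m hm z hz hxy hym hmz h).1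
    rw [Model.polar_comm, mul_comm (√_)] at key
    have key := hb _ _ (abs_lt.2 q3 |>.trans hε.1.1) (abs_lt.2 q4 |>.trans hε.1.1) _ key
    constructor
    · by_cases hc : Model.causal K y' m'
      · have ty := Model.tau_lt_left hc r2 b3
        refine ENNReal.le_add_coe_of_toReal ty.ne_top fun _ => ?_
        refine hs _ (Model.inRange_tau ty) ?_ _ ENNReal.toReal_nonneg key
        rw [← Model.E_eq_md hc ty, Model.E_comm, hE]
      · rw [Model.tau_eq_zero hc]; exact zero_le
    · by_cases hc : Model.causal K m' y'
      · have ty := Model.tau_lt_right r1 hc b2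
        refine ENNReal.le_add_coe_of_toReal ty.ne_top fun _ => ?_
        -- Although `y ≪ m`, here `m'` precedes `y'`. Then `τ(m', y') ≤ τ(x, y) - μ τ(x, z) ≤ τ(x,
        -- m) - μ τ(x, z) < ε`, so the excess is itself within the allowed error.
        have e1 := Model.toReal_add_le r1 hc b2
        have e2 := toReal_tau_add_le cxy (causal_of_chron _ _ hym) q1
        have : 0 ≤ (tau y m).toReal := ENNReal.toReal_nonneg
        have : 0 ≤ (tau m y).toReal := ENNReal.toReal_nonneg
        rw [r3, ht.tau_xy] at e1
        linarith [hε.1.2]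
      · rw [Model.tau_eq_zero hc]; exact zero_le
  · have key := four_point_opposite hxm hmy hyz h (H x hx m hm y hy z hz hxm hmy hyz h).1
    have key := hb _ _ (abs_lt.2 q3 |>.trans hε.1.1) (abs_lt.2 q4 |>.trans hε.1.1) _ key
    constructor
    · by_cases hc : Model.causal K y' m'
      · have ty := Model.tau_lt_left hc r2 b3
        refine ENNReal.le_add_coe_of_toReal ty.ne_top fun _ => ?_
        have e1 := Model.toReal_add_le hc r2 b3
        have e2 := toReal_tau_add_le (causal_of_chron _ _ hmy) cyz q2
        have : 0 ≤ (tau y m).toReal := ENNReal.toReal_nonneg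
        have : 0 ≤ (tau m y).toReal := ENNReal.toReal_nonneg
        rw [r4, ht.tau_yz] at e1
        linarith [hε.1.2]
      · rw [Model.tau_eq_zero hc]; exact zero_le
    · by_cases hc : Model.causal K m' y'
      · have ty := Model.tau_lt_right r1 hc b2
        refine ENNReal.le_add_coe_of_toReal ty.ne_top fun _ => ?_
        refine hs _ (Model.inRange_tau ty) ?_ _ ENNReal.toReal_nonneg key
        rw [← Model.E_eq_md hc ty, hE]
      · rw [Model.tau_eq_zero hc]; exact zero_le

theorem upperEpsMuBound_of_fourPoint (h : UpperFourPointBound X K) : UpperEpsMuBound X K := by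
  intro p
  obtain ⟨U, hU, hp, hcont, H⟩ := h p
  have H : FourPointOn K U := H
  refine ⟨U, hU, hp, hcont, fun x hx y hy z hz hxy hyz hxz μ h0 h1 => ?_⟩
  let P : ℝ≥0 → ℝ≥0 → Prop := fun ε δ => ∀ x' y' z', IsComparisonTriangle K x y z x' y' z' →
    EpsMuEstimate K U μ ε δ x y z x' y' z' ∧ EpsMuEstimate K U μ ε δ y z x y' z' x' ∧
      EpsMuEstimate K U μ ε δ x z y x' z' y'
  have hmono : ∀ ε δ δ', δ ≤ δ' → P ε δ → P ε δ' := fun ε δ δ' hd h x' y' z' ht =>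
    ⟨(h x' y' z' ht).1.mono hd, (h x' y' z' ht).2.1.mono hd, (h x' y' z' ht).2.2.mono hd⟩
  -- For large `ε` the crude error `τ(x, z)` suffices, since every model separation in the triangle
  -- is at most that of its long side.
  have hbound : ∀ ε, ∃ B, P ε B := by
    refine fun ε => ⟨(tau x z).toNNReal, fun x' y' z' ht => ?_⟩
    obtain ⟨b1, b2, b3, -⟩ := ht.bounds hxz
    have e : ((tau x z).toNNReal : ℝ≥0∞) = Model.tau K x' z' := by
      rw [ENNReal.coe_toNNReal hxz.ne_top, ht.tau_xz]
    have pxy : 0 < Model.tau K x' y' := by rw [ht.tau_xy]; exact tau_pos_of_chron hxy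
    have pyz : 0 < Model.tau K y' z' := by rw [ht.tau_yz]; exact tau_pos_of_chron hyz
    have pxz : 0 < Model.tau K x' z' := by
      rw [ht.tau_xz]; exact tau_pos_of_chron (chron_trans _ _ _ hxy hyz)
    have cxz := Model.causal_trans ht.causal_xy ht.causal_yz
    refine ⟨fun m _ _ _ m' hm' => ?_, fun m _ _ _ m' hm' => ?_, fun m _ _ _ m' hm' => ?_⟩ <;>
      rw [e]
    · obtain ⟨r1, r2, -⟩ := hm'.model_spec h0 h1 pxy
      have r3 := Model.causal_trans r2 ht.causal_yz
      exact ⟨(Model.tau_le_of_diamond cxz r3 b1).trans le_add_self,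
        (Model.tau_le_of_diamond r1 (Model.causal_refl K z') b1).trans le_add_self⟩
    · obtain ⟨r1, r2, -⟩ := hm'.model_spec h0 h1 pyz
      have r3 := Model.causal_trans ht.causal_xy r1
      exact ⟨(Model.tau_le_of_diamond (Model.causal_refl K x') r2 b1).trans le_add_self,
        (Model.tau_le_of_diamond r3 cxz b1).trans le_add_self⟩
    · obtain ⟨r1, r2, -⟩ := hm'.model_spec h0 h1 pxz
      exact ⟨(Model.tau_le_of_diamond ht.causal_xy r2 b1).trans le_add_self,
        (Model.tau_le_of_diamond r1 ht.causal_yz b1).trans le_add_self⟩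
  have hlim : ∀ η : ℝ≥0, 0 < η → ∃ δ : ℝ, 0 < δ ∧ ∀ ε : ℝ≥0, (ε : ℝ) < δ → P ε η := by
    intro η hη
    obtain ⟨δ₁, d1, e1⟩ := estimate_past_side H hx hy hz hxy hyz hxz h0 h1 hη
    obtain ⟨δ₂, d2, e2⟩ := estimate_future_side H hx hy hz hxy hyz hxz h0 h1 hη
    obtain ⟨δ₃, d3, e3⟩ := estimate_long_side H hx hy hz hxy hyz hxz h0 h1 hη
    refine ⟨min δ₁ (min δ₂ δ₃), lt_min d1 (lt_min d2 d3), fun ε hε x' y' z' ht => ?_⟩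
    rw [lt_min_iff, lt_min_iff] at hε
    exact ⟨e1 ε hε.1 x' y' z' ht, e2 ε hε.2.1 x' y' z' ht, e3 ε hε.2.2 x' y' z' ht⟩
  obtain ⟨f, hf, hP⟩ := exists_modulus hmono hbound hlim
  exact ⟨f, hf, fun x' y' z' ht => ⟨fun ε hε => (hP ε hε x' y' z' ht).1,
    fun ε hε => (hP ε hε x' y' z' ht).2.1, fun ε hε => (hP ε hε x' y' z' ht).2.2⟩⟩

end LorentzianPreLengthSpace

/-! ### Crossing of segments in the model spaces -/

namespace Model

theorem continuous_stewart (K l a b : ℝ) : Continuous fun s => stewart K l s a b := by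
  have := continuous_md K
  have := continuous_sn K
  unfold stewart
  fun_prop

/-- If `r` and `r'` lie on opposite sides of the line `a b`, the segment from `r` to `r'` meets
this line. -/
theorem exists_crossing_of_opposite {K : ℝ} {a b r r' : Model} (har : causal K a r)
    (hrr : causal K r r') (hrb : causal K r' b) (h : tau K a b < diamBound K)
    (hpos : 0 < tau K r r') (hv : vol K a b r * vol K a b r' ≤ 0) :
    ∃ m, causal K r m ∧ causal K m r' ∧
      (tau K r m).toReal + (tau K m r').toReal = (tau K r r').toReal ∧
      (tau K a m).toReal + (tau K m b).toReal = (tau K a b).toReal := by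
  have har' := causal_trans har hrr
  have hrb' := causal_trans hrr hrb
  have hlt := tau_lt_right har hrr (tau_lt_left har' hrb h)
  have hp := ENNReal.toReal_pos hpos.ne' hlt.ne_top
  by_cases h0 : vol K a b r = 0
  · exact ⟨r, causal_refl K r, hrr, by simp [tau_self], additive_of_vol_eq_zero har hrb' h h0⟩
  -- The volume over `a b` is linear on ambient combinations, so weights `|vol r'|` on `r` and `|vol
  -- r|` on `r'` give a point of volume zero.
  obtain ⟨s, N, hs0, hs1, hN, e1, e2⟩ := exists_ratio (inRange_tau hlt) hp
    (abs_nonneg (vol K a b r')) (abs_nonneg (vol K a b r))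
    (add_pos_of_nonneg_of_pos (abs_nonneg _) (abs_pos.2 h0))
  obtain ⟨m, c1, c2, t1, t2, hm⟩ := exists_segment_point hrr hlt hp hs0 hs1
  refine ⟨m, c1, c2, by rw [t1, t2]; ring, additive_of_vol_eq_zero (causal_trans har c1)
    (causal_trans c2 hrb) h ?_⟩
  have hsn := (sn_pos (inRange_tau hlt) hp).ne'
  have key : |vol K a b r'| * vol K a b r + |vol K a b r| * vol K a b r' = 0 := by
    rcases lt_or_gt_of_ne h0 with h0 | h0
    · have : 0 ≤ vol K a b r' := by by_contra hc; push Not at hc; nlinarith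
      rw [abs_of_neg h0, abs_of_nonneg this]; ring
    · have : vol K a b r' ≤ 0 := by by_contra hc; push Not at hc; nlinarith
      rw [abs_of_pos h0, abs_of_nonpos this]; ring
  rw [vol_comb hm]
  have h3 : N * (sn K ((tau K r r').toReal - s) * vol K a b r + sn K s * vol K a b r') = 0 := by
    rw [← key, ← e1, ← e2]; ring
  have h4 := (mul_eq_zero.1 h3).resolve_left hN.ne'
  rw [div_mul_eq_mul_div, div_mul_eq_mul_div, ← add_div, h4, zero_div]

/-- By the subtraction formula the defect is at most `-sn (τ(p, q)) * sn (τ(r, q))`. The addition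
formula gives the opposite sign when the middle argument lies causally between the other two. -/
theorem defect_neg {K : ℝ} {p q r : Model} (hpr : causal K p r) (hrq : causal K r q)
    (h : tau K p q < diamBound K) (hrq0 : 0 < tau K r q) : defect K p q r < 0 := by
  have l1 := tau_lt_left hpr hrq h
  have l2 := tau_lt_right hpr hrq h
  have hp := ENNReal.toReal_pos hrq0.ne' l2.ne_top
  have hadd := toReal_add_le hpr hrq h
  rw [defect, E_comm K q r, E_eq_md hpr l1, E_eq_md hrq l2, E_eq_md (causal_trans hpr hrq) h]
  set a := (tau K p r).toReal
  set b := (tau K r q).toReal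
  set c := (tau K p q).toReal
  have ha : 0 ≤ a := ENNReal.toReal_nonneg
  have h1 : md K a ≤ md K (c - b) := md_le_md ha
    ((inRange_tau h).mono (by linarith) (by linarith)) (by linarith)
  have h2 := sn_pos (inRange_tau l2) hp
  have h3 := sn_pos (inRange_tau h) (by linarith)
  rw [md_sub] at h1
  nlinarith [mul_pos h2 h3]

theorem defect_nonneg {K : ℝ} {p q r : Model} (hpq : causal K p q) (hqr : causal K q r)
    (h : tau K p r < diamBound K) : 0 ≤ defect K p q r := by
  have l1 := tau_lt_left hpq hqr h
  have l2 := tau_lt_right hpq hqr h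
  have hadd := toReal_add_le hpq hqr h
  rw [defect, E_eq_md hpq l1, E_eq_md hqr l2, E_eq_md (causal_trans hpq hqr) h]
  have h1 := md_le_md (add_nonneg ENNReal.toReal_nonneg ENNReal.toReal_nonneg)
    (inRange_tau h) hadd
  rw [md_add] at h1
  have h2 := sn_nonneg (inRange_tau l1)
  have h3 := sn_nonneg (inRange_tau l2)
  nlinarith [mul_nonneg h2 h3]

theorem defect_self_neg {K : ℝ} {p q : Model} (hpq : causal K p q)
    (h : tau K p q < diamBound K) (h0 : 0 < tau K p q) : defect K p q p < 0 := by
  have := hh_md K (tau K p q).toReal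
  have h2 := sn_pos (inRange_tau h) (ENNReal.toReal_pos h0.ne' h.ne_top)
  rw [defect, E_self, E_comm K q p, E_eq_md hpq h]
  rw [hh] at this
  nlinarith [mul_pos h2 h2]

theorem defect_comm (K : ℝ) (p q r : Model) : defect K p q r = defect K r q p := by
  simp only [defect, E_comm K r q, E_comm K q p, E_comm K r p]; ring

/-- The quadric equation is homogeneous of degree two on its left side, so positively proportional
points on it have equal factors. -/
theorem eq_of_proportional {K α β : ℝ} {m n : Model} (hα : 0 < α) (hβ : 0 < β)
    (w1 : α * ambW K m = β * ambW K n) (w2 : α * ambT K m = β * ambT K n)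
    (w3 : α * ambX K m = β * ambX K n) : α = β := by
  have q1 := quadric K m
  have q2 := quadric K n
  have h : α ^ 2 = β ^ 2 := by
    calc α ^ 2 = (α * ambW K m) ^ 2 + K * ((α * ambX K m) ^ 2 - (α * ambT K m) ^ 2) := by
          linear_combination (-(α ^ 2)) * q1
      _ = β ^ 2 := by rw [w1, w2, w3]; linear_combination β ^ 2 * q2
  exact (pow_left_inj₀ hα.le hβ.le two_ne_zero).1 h

/-- The diagonals of a chain `p ≪ q ≪ r ≪ s` with `p` and `s` on the same side of the line
`q r` meet. -/
theorem exists_crossing_of_same {K : ℝ} {p q r s : Model} (hpq : causal K p q)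
    (hqr : causal K q r) (hrs : causal K r s) (h : tau K p s < diamBound K)
    (h0 : 0 < tau K q r) (hv : 0 ≤ vol K q r p * vol K q r s) :
    ∃ m, causal K p m ∧ causal K m r ∧ causal K q m ∧ causal K m s ∧
      (tau K p m).toReal + (tau K m r).toReal = (tau K p r).toReal ∧
      (tau K q m).toReal + (tau K m s).toReal = (tau K q s).toReal := by
  have hpr := causal_trans hpq hqr
  have hqs := causal_trans hqr hrs
  have lpr := tau_lt_left hpr hrs h
  have lqs := tau_lt_right hpq hqs h
  have lqr := tau_lt_right hpq hqr lpr
  have hqr0 := ENNReal.toReal_pos h0.ne' lqr.ne_top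
  have hpr0 : 0 < (tau K p r).toReal := by
    have := toReal_add_le hpq hqr lpr
    have : 0 ≤ (tau K p q).toReal := ENNReal.toReal_nonneg
    linarith
  have hqs0 : 0 < (tau K q s).toReal := by
    have := toReal_add_le hqr hrs lqs
    have : 0 ≤ (tau K r s).toReal := ENNReal.toReal_nonneg
    linarith
  have cyc : vol K q r p = vol K p q r := by simp only [vol]; ring
  rw [cyc] at hv
  -- the four volumes have the same sign
  have r1 := vol_defect K p q r s q
  have A1 : defect K p r q < 0 := defect_neg hpq hqr lpr h0
  have B1 : defect K q r q < 0 := defect_self_neg hqr lqr h0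
  have C1 : 0 ≤ defect K s r q := by rw [defect_comm]; exact defect_nonneg hqr hrs lqs
  have r2 := vol_defect K s r q p r
  have A2 : defect K s q r < 0 := by
    have := defect_neg (K := K) (p := rev s) (q := rev q) (r := rev r) (causal_rev.2 hrs)
      (causal_rev.2 hqr) (by rwa [tau_rev]) (by rwa [tau_rev])
    simpa only [defect, E_rev] using this
  have B2 : defect K r q r < 0 := by
    have := defect_self_neg (K := K) (p := rev r) (q := rev q)
      (causal_rev.2 hqr) (by rwa [tau_rev]) (by rwa [tau_rev])
    simpa only [defect, E_rev] using this
  have C2 : 0 ≤ defect K p q r := defect_nonneg hpq hqr lpr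
  have e1 : vol K r q p = -vol K p q r := by simp only [vol]; ring
  have e2 : vol K s q p = -vol K p q s := by simp only [vol]; ring
  have e3 : vol K s r q = -vol K q r s := by simp only [vol]; ring
  rw [e1, e2, e3] at r2
  -- If everything lies on one line, `q` itself is a common point of the diagonals.
  by_cases hz : vol K p q r = 0 ∧ vol K q r s = 0
  · have hz' : vol K p r q = 0 := by
      have : vol K p r q = -vol K p q r := by simp only [vol]; ring
      rw [this, hz.1, neg_zero]
    exact ⟨q, hpq, hqr, causal_refl K q, hqs, additive_of_vol_eq_zero hpq hqr lpr hz',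
      by simp [tau_self]⟩
  obtain ⟨ε, hε, p1, p2⟩ : ∃ ε : ℝ, ε ^ 2 = 1 ∧ 0 ≤ ε * vol K p q r ∧ 0 ≤ ε * vol K q r s := by
    by_cases hc : 0 ≤ vol K p q r ∧ 0 ≤ vol K q r s
    · exact ⟨1, by norm_num, by simpa using hc.1, by simpa using hc.2⟩
    · refine ⟨-1, by norm_num, ?_, ?_⟩
      · by_contra hn
        have hn : 0 < vol K p q r := by linarith
        have : vol K q r s < 0 := by by_contra h'; exact hc ⟨hn.le, by linarith⟩
        nlinarith
      · by_contra hn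
        have hn : 0 < vol K q r s := by linarith
        have : vol K p q r < 0 := by by_contra h'; exact hc ⟨by linarith, hn.le⟩
        nlinarith
  have hsum : 0 < ε * vol K p q r + ε * vol K q r s := by
    have hε0 : ε ≠ 0 := by rintro rfl; norm_num at hε
    rcases not_and_or.1 hz with h' | h'
    · linarith [lt_of_le_of_ne p1 (mul_ne_zero hε0 h').symm]
    · linarith [lt_of_le_of_ne p2 (mul_ne_zero hε0 h').symm]
  -- With the opposite sign, the right side of `r1` would be positive by the signs of the defects,
  -- while the left side is nonpositive. The volume of `p q s` is treated with `r2`.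
  have p3 : 0 ≤ ε * vol K p r s := by
    by_contra hn
    push Not at hn
    have : ε * vol K q r s * defect K p r q =
      ε * vol K p r s * defect K q r q + ε * vol K p q r * defect K s r q := by
      linear_combination ε * r1
    nlinarith [mul_pos_of_neg_of_neg hn B1, mul_nonneg p1 C1, mul_nonneg p2 (neg_nonneg.2 A1.le)]
  have p4 : 0 ≤ ε * vol K p q s := by
    by_contra hn
    push Not at hn
    have : ε * vol K p q r * defect K s q r =
      ε * vol K p q s * defect K r q r + ε * vol K q r s * defect K p q r := by
      linear_combination -ε * r2
    nlinarith [mul_pos_of_neg_of_neg hn B2, mul_nonneg p2 C2, mul_nonneg p1 (neg_nonneg.2 A2.le)]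
  have s1 : 0 < ε * vol K q r s + ε * vol K p q s := by
    rcases p2.lt_or_eq with h' | h'
    · linarith
    have h1 : 0 < ε * vol K p q r := by linarith
    have : ε * vol K p q r * defect K s q r =
      ε * vol K p q s * defect K r q r + ε * vol K q r s * defect K p q r := by
      linear_combination -ε * r2
    have h3 : 0 < ε * vol K p q r * -defect K s q r := mul_pos h1 (by linarith)
    by_contra hn
    have h4 : ε * vol K p q s = 0 := by linarith
    rw [h4, ← h'] at this
    linarith
  have s2 : 0 < ε * vol K p r s + ε * vol K p q r := by
    rcases p1.lt_or_eq with h' | h'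
    · linarith
    have h1 : 0 < ε * vol K q r s := by linarith
    have : ε * vol K q r s * defect K p r q =
      ε * vol K p r s * defect K q r q + ε * vol K p q r * defect K s r q := by
      linear_combination ε * r1
    have h3 : 0 < ε * vol K q r s * -defect K p r q := mul_pos h1 (by linarith)
    by_contra hn
    have h4 : ε * vol K p r s = 0 := by linarith
    rw [h4, ← h'] at this
    linarith
  -- All four coefficients in `vol_relation` now have the same sign. Its two sides are positive
  -- multiples of a point on `p r` and of a point on `q s`; on the quadric these points coincide.
  obtain ⟨i, N, hi0, hi1, hN, f1, f2⟩ := exists_ratio (inRange_tau lpr) hpr0 p2 p4 s1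
  obtain ⟨j, M, hj0, hj1, hM, g1, g2⟩ := exists_ratio (inRange_tau lqs) hqs0 p3 p1 s2
  obtain ⟨m, c1, c2, t1, t2, m1, m2, m3⟩ := exists_segment_point hpr lpr hpr0 hi0 hi1
  obtain ⟨n, d1, d2, u1, u2, n1, n2, n3⟩ := exists_segment_point hqs lqs hqs0 hj0 hj1
  have S1 := sn_pos (inRange_tau lpr) hpr0
  have S2 := sn_pos (inRange_tau lqs) hqs0
  obtain ⟨R1, R2, R3⟩ := vol_relation K p q r s
  set α := N * sn K (tau K p r).toReal with hα
  set β := M * sn K (tau K q s).toReal with hβ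
  have hα0 : 0 < α := mul_pos hN S1
  have hβ0 : 0 < β := mul_pos hM S2
  have expand : ∀ {y a b : ℝ} {L : ℝ} {t P : ℝ}, 0 < sn K L →
      y = sn K (L - t) / sn K L * a + sn K t / sn K L * b →
      P * sn K L * y = P * sn K (L - t) * a + P * sn K t * b := by
    intro y a b L t P hL hy
    rw [hy]; field_simp
  have w1 : α * ambW K m = β * ambW K n := by
    rw [hα, hβ, expand S1 m1, expand S2 n1, f1, f2, g1, g2]; linear_combination ε * R1
  have w2 : α * ambT K m = β * ambT K n := by
    rw [hα, hβ, expand S1 m2, expand S2 n2, f1, f2, g1, g2]; linear_combination ε * R2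
  have w3 : α * ambX K m = β * ambX K n := by
    rw [hα, hβ, expand S1 m3, expand S2 n3, f1, f2, g1, g2]; linear_combination ε * R3
  have hαβ := eq_of_proportional hα0 hβ0 w1 w2 w3
  rw [hαβ] at w1 w2 w3
  have hmn : m = n := eq_of_amb_eq
    (loc_of_diamond c1 (causal_trans c2 hrs) (causal_trans hpq d1) d2 h)
    (mul_left_cancel₀ hβ0.ne' w1) (mul_left_cancel₀ hβ0.ne' w2) (mul_left_cancel₀ hβ0.ne' w3)
  subst hmn
  exact ⟨m, c1, c2, d1, d2, by rw [t1, t2]; ring, by rw [u1, u2]; ring⟩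

end Model

namespace LorentzianPreLengthSpace
variable {X : Type*} [MetricSpace X] [LorentzianPreLengthSpace X]

open Model (md sn InRange stewart)

/-! ### From the triangle condition to the four-point condition -/

theorem IsCausalCurve.causal_of_le {γ : ℝ → X} (h : IsCausalCurve γ) {s t : ℝ}
    (hs : s ∈ Icc (0 : ℝ) 1) (ht : t ∈ Icc (0 : ℝ) 1) (hst : s ≤ t) :
    LorentzianPreLengthSpace.causal (γ s) (γ t) := by
  rcases hst.lt_or_eq with h' | rfl
  · exact h.causal s hs t ht h'
  · exact causal_refl _

theorem IsRealizer.tau_le_three {γ : ℝ → X} {a b : X} (h : IsRealizer γ a b) {s t : ℝ}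
    (hs : s ∈ Icc (0 : ℝ) 1) (ht : t ∈ Icc (0 : ℝ) 1) (hst : s ≤ t) :
    tau a b ≤ tau a (γ s) + tau (γ s) (γ t) + tau (γ t) b := by
  rw [← h.length]
  -- The partition `0, s, t, 1`, continued by `1` because monotonicity is required on all of `ℕ`.
  let u : ℕ → ℝ := fun n => if n = 0 then 0 else if n = 1 then s else if n = 2 then t else 1
  have hu : Monotone u := by
    refine monotone_nat_of_le_succ fun n => ?_
    match n with
    | 0 => simpa [u] using hs.1
    | 1 => simpa [u] using hst
    | 2 => simpa [u] using ht.2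
    | n + 3 => simp [u]
  have hu' : Monotone u ∧ u 0 = 0 ∧ u 3 = 1 := ⟨hu, by simp [u], by simp [u]⟩
  refine ((iInf₂_le 3 u).trans (iInf_le _ hu')).trans (le_of_eq ?_)
  simp [Finset.sum_range_succ, u, h.source, h.target]

theorem IsRealizer.causal_source {γ : ℝ → X} {a b : X} (h : IsRealizer γ a b) {s : ℝ}
    (hs : s ∈ Icc (0 : ℝ) 1) : causal a (γ s) := by
  rw [← h.source]; exact h.curve.causal_of_le (by simp) hs hs.1

theorem IsRealizer.causal_target {γ : ℝ → X} {a b : X} (h : IsRealizer γ a b) {s : ℝ}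
    (hs : s ∈ Icc (0 : ℝ) 1) : causal (γ s) b := by
  rw [← h.target]; exact h.curve.causal_of_le hs (by simp) hs.2

theorem IsRealizer.additive_three {γ : ℝ → X} {a b : X} (h : IsRealizer γ a b) {s t : ℝ}
    (hs : s ∈ Icc (0 : ℝ) 1) (ht : t ∈ Icc (0 : ℝ) 1) (hst : s ≤ t) (hab : tau a b ≠ ⊤) :
    (tau a (γ s)).toReal + (tau (γ s) (γ t)).toReal + (tau (γ t) b).toReal = (tau a b).toReal := by
  have c1 := h.causal_source hs
  have c2 := h.curve.causal_of_le hs ht hst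
  have c3 := h.causal_target ht
  have e : tau a (γ s) + tau (γ s) (γ t) + tau (γ t) b = tau a b := by
    refine le_antisymm ?_ (h.tau_le_three hs ht hst)
    exact (add_le_add_left (reverse_triangle _ _ _ c1 c2) _).trans
      (reverse_triangle _ _ _ (causal_trans _ _ _ c1 c2) c3)
  rw [← e] at hab ⊢
  obtain ⟨h12, h3⟩ := ENNReal.add_ne_top.1 hab
  obtain ⟨h1, h2⟩ := ENNReal.add_ne_top.1 h12
  rw [ENNReal.toReal_add h12 h3, ENNReal.toReal_add h1 h2]

/-- A point with `x ≪ x` has positive `τ(x, x)`, so vanishing on the diagonal must be proved: a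
positive value could be added to the finite `τ(x, y)` without changing it. -/
theorem tau_self_of_ne_top {x y : X} (hxy : causal x y) (h : tau x y ≠ ⊤) : tau x x = 0 := by
  have hx := causal_refl x
  have h1 := tau_le_of_causal_right (causal_trans _ _ _ hx hx) hxy
  have h2 := reverse_triangle x x y hx hxy
  by_contra h0
  exact absurd h2 (not_le.2 (by rw [add_comm]; exact ENNReal.lt_add_right h h0))

theorem IsRealizer.additive {γ : ℝ → X} {a b : X} (h : IsRealizer γ a b) {s : ℝ}
    (hs : s ∈ Icc (0 : ℝ) 1) (hab : tau a b ≠ ⊤) :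
    (tau a (γ s)).toReal + (tau (γ s) b).toReal = (tau a b).toReal := by
  have h1 := h.additive_three hs hs le_rfl hab
  have h2 : tau (γ s) b ≠ ⊤ :=
    ne_top_of_le_ne_top hab (tau_le_of_causal_left (h.causal_source hs) (h.causal_target hs))
  rw [tau_self_of_ne_top (h.causal_target hs) h2] at h1
  simpa using h1

/-- Continuity of `τ` along pairs of maps into `U`. -/
theorem TauContinuousBelow.continuousOn_comp {K : ℝ} {U : Set X} (h : TauContinuousBelow K U)
    {S : Set ℝ} {f g : ℝ → X} (hf : ContinuousOn f S) (hg : ContinuousOn g S)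
    (hfU : ∀ s ∈ S, f s ∈ U) (hgU : ∀ s ∈ S, g s ∈ U)
    (hD : ∀ s ∈ S, tau (f s) (g s) < diamBound K) :
    ContinuousOn (fun s => (tau (f s) (g s)).toReal) S := by
  have h1 : ContinuousOn (fun s => tau (f s) (g s)) S :=
    h.1.comp (hf.prodMk hg) fun s hs => ⟨hfU s hs, hgU s hs, hD s hs⟩
  exact (ENNReal.continuousOn_toReal).comp h1 fun s hs => (hD s hs).ne_top

theorem IsRealizer.continuousOn {γ : ℝ → X} {a b : X} (h : IsRealizer γ a b) :
    ContinuousOn γ (Icc 0 1) := by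
  obtain ⟨C, hC⟩ := h.curve.lipschitz
  exact hC.continuousOn

theorem IsRealizer.exists_param {K : ℝ} {U : Set X} (hU : TauContinuousBelow K U) {γ : ℝ → X}
    {a b : X} (h : IsRealizer γ a b) (hγ : ∀ s ∈ Icc (0 : ℝ) 1, γ s ∈ U)
    (hab : tau a b < diamBound K) {r : ℝ} (h0 : 0 ≤ r) (h1 : r ≤ (tau a b).toReal) :
    ∃ s ∈ Icc (0 : ℝ) 1, (tau a (γ s)).toReal = r := by
  have ha : a ∈ U := by rw [← h.source]; exact hγ 0 (by simp)
  have hc : ContinuousOn (fun s => (tau a (γ s)).toReal) (Icc 0 1) :=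
    hU.continuousOn_comp continuousOn_const h.continuousOn (fun _ _ => ha) hγ fun s hs =>
      (tau_le_of_causal_right (h.causal_source hs) (h.causal_target hs)).trans_lt hab
  have h2 := intermediate_value_Icc zero_le_one hc
  have h3 : tau a a = 0 := tau_self_of_ne_top
    (causal_trans _ _ _ (h.causal_source (s := 0) (by simp)) (h.causal_target (by simp))) hab.ne_top
  obtain ⟨s, hs, e⟩ := h2 (show r ∈ Icc _ _ by
    simp only [h.source, h.target, h3, ENNReal.toReal_zero]; exact ⟨h0, h1⟩)
  exact ⟨s, hs, e⟩

/-- `m'` is the point at distance `r` from `a'` on the segment from `a'` to `b'`. -/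
structure IsPointAt (K r : ℝ) (a' b' m' : Model) : Prop where
  left : Model.causal K a' m'
  right : Model.causal K m' b'
  tau_left : (Model.tau K a' m').toReal = r
  tau_right : (Model.tau K m' b').toReal = (Model.tau K a' b').toReal - r

/-- Every timelike pair in `U` has intermediate points at all distances which satisfy the
comparison with every third vertex. -/
def HasSidePoints (K : ℝ) (U : Set X) : Prop :=
  ∀ a ∈ U, ∀ b ∈ U, chron a b → tau a b < diamBound K → ∀ r, 0 ≤ r → r ≤ (tau a b).toReal →
    ∃ m ∈ U, causal a m ∧ causal m b ∧
      (∀ c ∈ U, causal b c → tau a c < diamBound K → ∀ a' b' c',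
        IsComparisonTriangle K a b c a' b' c' → ∀ m', IsPointAt K r a' b' m' →
          Model.tau K m' c' ≤ tau m c) ∧
      (∀ c ∈ U, causal c a → tau c b < diamBound K → ∀ a' b' c',
        IsComparisonTriangle K c a b c' a' b' → ∀ m', IsPointAt K r a' b' m' →
          Model.tau K c' m' ≤ tau c m) ∧
      (∀ c ∈ U, causal a c → causal c b → ∀ a' b' c',
        IsComparisonTriangle K a c b a' c' b' → ∀ m', IsPointAt K r a' b' m' →
          Model.tau K c' m' ≤ tau c m ∧ Model.tau K m' c' ≤ tau m c)

theorem isComparisonPoint_of_isPointAt {K r : ℝ} {a b m : X} {a' b' m' : Model}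
    (hab : tau a b < diamBound K) (e : Model.tau K a' b' = tau a b) (ham : causal a m)
    (hmb : causal m b) (h1 : (tau a m).toReal = r)
    (h2 : (tau a m).toReal + (tau m b).toReal = (tau a b).toReal) (h : IsPointAt K r a' b' m') :
    IsComparisonPoint K a b m a' b' m' := by
  have hab' : Model.tau K a' b' < diamBound K := by rwa [e]
  refine ⟨h.left, h.right, eq_of_toReal_eq (Model.tau_lt_left h.left h.right hab').ne_top
    ((tau_le_of_causal_right ham hmb).trans_lt hab).ne_top (by rw [h.tau_left, h1]),
    eq_of_toReal_eq (Model.tau_lt_right h.left h.right hab').ne_top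
    ((tau_le_of_causal_left ham hmb).trans_lt hab).ne_top ?_⟩
  rw [h.tau_right, e]; linarith

/-- Continuity of `τ` along a realizer supplies a point at every distance. Only these points are
retained, not the curve, which makes the property easy to reverse in time. -/
theorem exists_hasSidePoints {K : ℝ} (H : UpperTriangleBound X K) (p : X) :
    ∃ U : Set X, IsOpen U ∧ p ∈ U ∧ TauContinuousBelow K U ∧ HasSidePoints K U ∧
      ∀ x ∈ U, ∀ y ∈ U, chron x y → ∃ γ : ℝ → X, IsRealizer γ x y := by
  obtain ⟨U, hU, hp, hc, hr, ht⟩ := H p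
  refine ⟨U, hU, hp, hc, ?_, fun x hx y hy h => (hr x hx y hy h).imp fun γ h => h.1⟩
  intro a ha b hb hab hlt r h0 h1
  obtain ⟨γ, hγ, hγU⟩ := hr a ha b hb hab
  obtain ⟨s, hs, e⟩ := hγ.exists_param hc hγU hlt h0 h1
  have hadd := hγ.additive hs hlt.ne_top
  have c1 := hγ.causal_source hs
  have c2 := hγ.causal_target hs
  refine ⟨γ s, hγU s hs, c1, c2, ?_, ?_, ?_⟩
  · intro c hcU hbc hac a' b' c' T m' hm
    exact ((ht a ha b hb c hcU (causal_of_chron _ _ hab) hbc hac a' b' c' T).1 hab γ hγ hγU s hs m'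
      (isComparisonPoint_of_isPointAt hlt T.tau_xy c1 c2 e hadd hm)).2
  · intro c hcU hca hcb a' b' c' T m' hm
    exact ((ht c hcU a ha b hb hca (causal_of_chron _ _ hab) hcb c' a' b' T).2.1 hab γ hγ hγU s hs
      m' (isComparisonPoint_of_isPointAt hlt T.tau_yz c1 c2 e hadd hm)).1
  · intro c hcU hac hcb a' b' c' T m' hm
    exact (ht a ha c hcU b hb hac hcb hlt a' c' b' T).2.2 hab γ hγ hγU s hs m'
      (isComparisonPoint_of_isPointAt hlt T.tau_xz c1 c2 e hadd hm)

/-! ### Time reversal of the space -/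

/-- The time reversed space. -/
abbrev reversed (X : Type*) [MetricSpace X] [LorentzianPreLengthSpace X] :
    LorentzianPreLengthSpace X where
  causal x y := causal y x
  chron x y := chron y x
  tau x y := tau y x
  causal_refl := causal_refl
  causal_trans x y z h1 h2 := causal_trans z y x h2 h1
  chron_trans x y z h1 h2 := chron_trans z y x h2 h1
  causal_of_chron x y := causal_of_chron y x
  lowerSemicontinuous_tau := lowerSemicontinuous_tau.comp continuous_swap
  reverse_triangle x y z h1 h2 := by rw [add_comm]; exact reverse_triangle z y x h2 h1
  tau_eq_zero x y := tau_eq_zero y x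
  tau_pos_iff x y := tau_pos_iff y x

theorem IsComparisonTriangle.reverse {K : ℝ} {x y z : X} {x' y' z' : Model}
    (h : IsComparisonTriangle K x y z x' y' z') :
    @IsComparisonTriangle X _ (reversed X) K z y x (Model.rev z') (Model.rev y') (Model.rev x') :=
  @IsComparisonTriangle.mk X _ (reversed X) _ _ _ _ _ _ _
    (Model.causal_rev.2 h.causal_yz) (Model.causal_rev.2 h.causal_xy)
    ((Model.tau_rev _ _ _).trans h.tau_yz) ((Model.tau_rev _ _ _).trans h.tau_xy)
    ((Model.tau_rev _ _ _).trans h.tau_xz)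

theorem IsComparisonTriangle.of_reverse {K : ℝ} {x y z : X} {x' y' z' : Model}
    (h : @IsComparisonTriangle X _ (reversed X) K z y x z' y' x') :
    IsComparisonTriangle K x y z (Model.rev x') (Model.rev y') (Model.rev z') :=
  ⟨Model.causal_rev.2 (@IsComparisonTriangle.causal_yz X _ (reversed X) _ _ _ _ _ _ _ h),
    Model.causal_rev.2 (@IsComparisonTriangle.causal_xy X _ (reversed X) _ _ _ _ _ _ _ h),
    (Model.tau_rev _ _ _).trans (@IsComparisonTriangle.tau_yz X _ (reversed X) _ _ _ _ _ _ _ h),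
    (Model.tau_rev _ _ _).trans (@IsComparisonTriangle.tau_xy X _ (reversed X) _ _ _ _ _ _ _ h),
    (Model.tau_rev _ _ _).trans (@IsComparisonTriangle.tau_xz X _ (reversed X) _ _ _ _ _ _ _ h)⟩

theorem IsPointAt.rev {K r : ℝ} {a b m : Model} (h : IsPointAt K r a b m) :
    IsPointAt K ((Model.tau K a b).toReal - r) (Model.rev b) (Model.rev a) (Model.rev m) :=
  ⟨Model.causal_rev.2 h.right, Model.causal_rev.2 h.left, by rw [Model.tau_rev, h.tau_right],
    by rw [Model.tau_rev, Model.tau_rev, h.tau_left]; ring⟩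

theorem HasSidePoints.reverse {K : ℝ} {U : Set X} (H : HasSidePoints K U) :
    @HasSidePoints X _ (reversed X) K U := by
  intro a ha b hb hab hlt r h0 h1
  obtain ⟨m, hm, c1, c2, p1, p2, p3⟩ := H b hb a ha hab hlt ((tau b a).toReal - r)
    (sub_nonneg.2 h1) (sub_le_self _ h0)
  refine ⟨m, hm, c2, c1, ?_, ?_, ?_⟩
  · intro c hc hbc hac a' b' c' T m' hm
    have T' := T.of_reverse
    have := p2 c hc hbc hac _ _ _ T' (Model.rev m') (by
      have := hm.rev
      rwa [← Model.tau_rev, T'.tau_yz] at this)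
    rwa [Model.tau_rev] at this
  · intro c hc hca hcb a' b' c' T m' hm
    have T' := T.of_reverse
    have := p1 c hc hca hcb _ _ _ T' (Model.rev m') (by
      have := hm.rev
      rwa [← Model.tau_rev, T'.tau_xy] at this)
    rwa [Model.tau_rev] at this
  · intro c hc hac hcb a' b' c' T m' hm
    have T' := T.of_reverse
    have := p3 c hc hcb hac _ _ _ T' (Model.rev m') (by
      have := hm.rev
      rwa [← Model.tau_rev, T'.tau_xz] at this)
    rw [Model.tau_rev, Model.tau_rev] at this
    exact ⟨this.2, this.1⟩

end LorentzianPreLengthSpace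

/-! ### Four-point comparison from crossings -/

namespace LorentzianPreLengthSpace
variable {X : Type*} [MetricSpace X] [LorentzianPreLengthSpace X]

open Model (md sn InRange stewart)

/-- The point at distance `s` from `a'` on a segment through `p'`, placed beyond `p'`. -/
theorem exists_isPointAt_beyond {K s : ℝ} {a p b : Model} (hap : Model.causal K a p)
    (hpb : Model.causal K p b) (h : Model.tau K a b < diamBound K)
    (hadd : (Model.tau K a p).toReal + (Model.tau K p b).toReal = (Model.tau K a b).toReal)
    (hs : (Model.tau K a p).toReal ≤ s) (hs' : s < (Model.tau K a b).toReal) :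
    ∃ m, IsPointAt K s a b m ∧ Model.causal K p m ∧
      (Model.tau K p m).toReal = s - (Model.tau K a p).toReal := by
  have hlt := Model.tau_lt_right hap hpb h
  obtain ⟨m, c1, c2, t1, t2, -⟩ := Model.exists_segment_point (r := s - (Model.tau K a p).toReal)
    hpb hlt (by linarith) (by linarith) (by linarith)
  have ham := Model.causal_trans hap c1
  have u1 := Model.toReal_add_le hap c1 (Model.tau_lt_left ham c2 h)
  have u2 := Model.toReal_add_le ham c2 h
  exact ⟨m, ⟨ham, c2, by linarith, by linarith⟩, c1, t1⟩

theorem IsPointAt.E_eq {K r : ℝ} {a b m : Model} (hm : IsPointAt K r a b m)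
    (h : Model.tau K a b < diamBound K) (h0 : 0 < (Model.tau K a b).toReal) (c : Model) :
    Model.E K m c = stewart K (Model.tau K a b).toReal r (Model.E K a c) (Model.E K b c) := by
  rw [Model.E_eq_stewart hm.left hm.right h h0 (by rw [hm.tau_left, hm.tau_right]; ring) c,
    hm.tau_left]

/-- Lower bound for `τ(x₂, x₃)` when the segment `y₂ y₃` crosses `y₁ y₄` before `y₃`. -/
theorem HasSidePoints.add_le_of_crossing {K : ℝ} {U : Set X} (H : HasSidePoints K U)
    {x₁ x₂ x₃ x₄ : X} (hx₁ : x₁ ∈ U) (hx₂ : x₂ ∈ U) (hx₃ : x₃ ∈ U) (hx₄ : x₄ ∈ U)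
    (h12 : chron x₁ x₂) (h23 : chron x₂ x₃) (h34 : chron x₃ x₄) (h : tau x₁ x₄ < diamBound K)
    {y₁ y₂ y₃ y₄ m : Model} (T2 : IsComparisonTriangle K x₁ x₂ x₄ y₁ y₂ y₄)
    (T3 : IsComparisonTriangle K x₁ x₃ x₄ y₁ y₃ y₄) (h2m : Model.causal K y₂ m)
    (hm3 : Model.causal K m y₃)
    (hadd : (Model.tau K y₁ m).toReal + (Model.tau K m y₄).toReal = (Model.tau K y₁ y₄).toReal)
    (hpos : 0 < (Model.tau K m y₃).toReal) :
    (Model.tau K y₂ m).toReal + (Model.tau K m y₃).toReal ≤ (tau x₂ x₃).toReal := by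
  have c12 := causal_of_chron _ _ h12
  have c23 := causal_of_chron _ _ h23
  have c34 := causal_of_chron _ _ h34
  have c13 := causal_trans _ _ _ c12 c23
  have c24 := causal_trans _ _ _ c23 c34
  have t13 := (tau_le_of_causal_right c13 c34).trans_lt h
  have t23 := (tau_le_of_causal_left c12 c23).trans_lt t13
  obtain ⟨L, -, -, -, -, -⟩ := T2.bounds h
  have d1m := Model.causal_trans T2.causal_xy h2m
  have dm4 := Model.causal_trans hm3 T3.causal_yz
  have l1m := Model.tau_lt_left d1m dm4 L
  have lm4 := Model.tau_lt_right d1m dm4 L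
  have l13 := Model.tau_lt_left T3.causal_xy T3.causal_yz L
  have lm3 := Model.tau_lt_left hm3 T3.causal_yz lm4
  have a1 := Model.toReal_add_le d1m hm3 l13
  have a2 := Model.toReal_add_le T3.causal_xy T3.causal_yz L
  have p34 : 0 < (Model.tau K y₃ y₄).toReal := by
    rw [T3.tau_yz]; exact toReal_tau_pos h34 ((tau_le_of_causal_left c13 c34).trans_lt h).ne_top
  have n1m : 0 ≤ (Model.tau K y₁ m).toReal := ENNReal.toReal_nonneg
  have hl0 : 0 < (Model.tau K y₁ y₄).toReal := by linarith
  have hch : chron x₁ x₄ := chron_trans _ _ _ (chron_trans _ _ _ h12 h23) h34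
  set l := (Model.tau K y₁ y₄).toReal with hl
  set s₀ := (Model.tau K y₁ m).toReal with hs₀
  have hsl : s₀ < l := by linarith
  set F : ℝ → ℝ := fun s => stewart K l s (Model.E K y₁ y₃) (Model.E K y₄ y₃) with hF
  have hFc : Continuous F := Model.continuous_stewart _ _ _ _
  have hF0 : F s₀ = Model.E K m y₃ := (Model.E_eq_stewart d1m dm4 L hl0 hadd y₃).symm
  rw [Model.E_eq_md hm3 lm3] at hF0
  -- The point `n` lies strictly beyond `m`, which makes the model separation from `y₂` to `n`
  -- positive even if `y₂` and `m` are null related. For `s` near `s₀` the energy from `n` to `y₃`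
  -- is still positive.
  have key : ∀ᶠ s in 𝓝[>] s₀, F s ≤ md K ((tau x₂ x₃).toReal - (Model.tau K y₂ m).toReal) ∧
      (Model.tau K y₂ m).toReal ≤ (tau x₂ x₃).toReal := by
    have e1 : ∀ᶠ s in 𝓝[>] s₀, 0 < F s := by
      refine (hFc.tendsto s₀).mono_left nhdsWithin_le_nhds |>.eventually (lt_mem_nhds ?_)
      rw [hF0]; exact Model.md_pos (Model.inRange_tau lm3) hpos
    have e2 : ∀ᶠ s in 𝓝[>] s₀, s < s₀ + (Model.tau K m y₃).toReal :=
      nhdsWithin_le_nhds (gt_mem_nhds (by linarith))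
    have e3 : ∀ᶠ s in 𝓝[>] s₀, s < l := nhdsWithin_le_nhds (gt_mem_nhds hsl)
    filter_upwards [e1, e2, e3, self_mem_nhdsWithin] with s f1 f2 f3 f4
    rw [mem_Ioi] at f4
    obtain ⟨n, hn, hmn, tn⟩ := exists_isPointAt_beyond d1m dm4 L hadd f4.le f3
    obtain ⟨w, hw, cw1, cw4, -, -, hcmp⟩ := H x₁ hx₁ x₄ hx₄ hch h s (n1m.trans f4.le)
      (by rw [← T2.tau_xz]; exact f3.le)
    have i2 := (hcmp x₂ hx₂ c12 c24 _ _ _ T2 n hn).1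
    have i3 := (hcmp x₃ hx₃ c13 c34 _ _ _ T3 n hn).2
    have d2n := Model.causal_trans h2m hmn
    have l24 := Model.tau_lt_right T2.causal_xy T2.causal_yz L
    have l2n := Model.tau_lt_left d2n hn.right l24
    have j2 := Model.toReal_add_le h2m hmn l2n
    have hEn : Model.E K n y₃ = F s := hn.E_eq L hl0 y₃
    have dn3 : Model.causal K n y₃ := by
      refine (Model.causal_or_of_E_nonneg (Model.loc_of_diamond hn.left hn.right T3.causal_xy
        T3.causal_yz L) (by rw [hEn]; exact f1.le)).resolve_right fun hc => ?_
      have := Model.toReal_add_le T3.causal_xy hc (Model.tau_lt_left hn.left hn.right L)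
      rw [hn.tau_left] at this
      have : 0 ≤ (Model.tau K y₃ n).toReal := ENNReal.toReal_nonneg
      linarith
    have ln3 := Model.tau_lt_left dn3 T3.causal_yz (Model.tau_lt_right hn.left hn.right L)
    have lw3 : tau w x₃ ≠ ⊤ := by
      by_cases hc : causal w x₃
      · exact ((tau_le_of_causal_left cw1 hc).trans_lt t13).ne_top
      · simp [tau_eq_zero _ _ hc]
    have l2w : tau x₂ w ≠ ⊤ := by
      by_cases hc : causal x₂ w
      · exact ((tau_le_of_causal_left c12 hc).trans (tau_le_of_causal_right cw1 cw4)).trans_lt h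
          |>.ne_top
      · simp [tau_eq_zero _ _ hc]
    have i2' := ENNReal.toReal_mono l2w i2
    have i3' := ENNReal.toReal_mono lw3 i3
    have n2m : 0 ≤ (Model.tau K y₂ m).toReal := ENNReal.toReal_nonneg
    -- Positivity of the model separations passes to `X` through the comparison. The relations `x₂ ≤
    -- w` and, below, `w ≤ x₃` are needed for the reverse triangle inequality.
    have c2w : causal x₂ w := causal_of_chron _ _ (chron_of_toReal_pos (by linarith))
    have pn3 : 0 < (Model.tau K n y₃).toReal := by
      refine ENNReal.toReal_nonneg.lt_of_ne' fun h0 => ?_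
      rw [← hEn, Model.E_eq_md dn3 ln3, h0, Model.md_zero] at f1
      exact lt_irrefl _ f1
    have cw3 : causal w x₃ := causal_of_chron _ _ (chron_of_toReal_pos (by linarith))
    have k := toReal_tau_add_le c2w cw3 t23.ne_top
    rw [← hEn, Model.E_eq_md dn3 ln3]
    exact ⟨Model.md_le_md pn3.le ((Model.inRange_toReal t23).mono (by linarith) (by linarith))
      (by linarith), by linarith⟩
  have lim := le_of_tendsto ((hFc.tendsto s₀).mono_left nhdsWithin_le_nhds)
    (key.mono fun _ h => h.1)
  obtain ⟨-, -, hle⟩ := key.exists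
  rw [hF0] at lim
  linarith [Model.le_of_md_le (Model.inRange_tau lm3) (sub_nonneg.2 hle) lim]

theorem HasSidePoints.tau_le_of_opposite {K : ℝ} {U : Set X} (H : HasSidePoints K U)
    {x₁ x₂ x₃ x₄ : X} (hx₁ : x₁ ∈ U) (hx₂ : x₂ ∈ U) (hx₃ : x₃ ∈ U) (hx₄ : x₄ ∈ U)
    (h12 : chron x₁ x₂) (h23 : chron x₂ x₃) (h34 : chron x₃ x₄) (h : tau x₁ x₄ < diamBound K)
    {y₁ y₂ y₃ y₄ : Model} (T2 : IsComparisonTriangle K x₁ x₂ x₄ y₁ y₂ y₄)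
    (T3 : IsComparisonTriangle K x₁ x₃ x₄ y₁ y₃ y₄) (hs : Model.OppositeSides K y₁ y₄ y₂ y₃) :
    Model.tau K y₂ y₃ ≤ tau x₂ x₃ := by
  rcases eq_zero_or_pos (Model.tau K y₂ y₃) with h0 | h0
  · rw [h0]; exact bot_le
  have c12 := causal_of_chron _ _ h12
  have c23 := causal_of_chron _ _ h23
  have c34 := causal_of_chron _ _ h34
  have t13 := (tau_le_of_causal_right (causal_trans _ _ _ c12 c23) c34).trans_lt h
  have t23 := (tau_le_of_causal_left c12 c23).trans_lt t13
  have d23 := Model.causal_of_tau_pos h0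
  obtain ⟨L, -, -, -, -, -⟩ := T2.bounds h
  have l23 := Model.tau_lt_left d23 T3.causal_yz (Model.tau_lt_right T2.causal_xy T2.causal_yz L)
  obtain ⟨m, h2m, hm3, ha, hb⟩ := Model.exists_crossing_of_opposite T2.causal_xy d23 T3.causal_yz L
    h0 (Model.side_mul_nonpos.1 hs)
  rw [← ENNReal.toReal_le_toReal l23.ne_top t23.ne_top, ← ha]
  by_cases hpos : 0 < (Model.tau K m y₃).toReal
  · exact H.add_le_of_crossing hx₁ hx₂ hx₃ hx₄ h12 h23 h34 h T2 T3 h2m hm3 hb hpos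
  · have hz : (Model.tau K m y₃).toReal = 0 :=
      le_antisymm (not_lt.1 hpos) ENNReal.toReal_nonneg
    have hp := ENNReal.toReal_pos h0.ne' l23.ne_top
    -- No room is left between `m` and `y₃`, but then the separation from `y₂` to `m` is positive.
    -- Reversing time exchanges the two ends.
    have := @HasSidePoints.add_le_of_crossing X _ (reversed X) K U H.reverse x₄ x₃ x₂ x₁ hx₄ hx₃
      hx₂ hx₁ h34 h23 h12 h _ _ _ _ (Model.rev m) T3.reverse T2.reverse (Model.causal_rev.2 hm3)
      (Model.causal_rev.2 h2m) (by simp only [Model.tau_rev]; linarith)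
      (by rw [Model.tau_rev]; linarith)
    simp only [Model.tau_rev] at this
    rw [add_comm]
    exact this

theorem exists_comparisonTriangle {K : ℝ} {x y z : X} (hxy : chron x y) (hyz : chron y z)
    (h : tau x z < diamBound K) : ∃ x' y' z', IsComparisonTriangle K x y z x' y' z' := by
  have cxy := causal_of_chron _ _ hxy
  have cyz := causal_of_chron _ _ hyz
  have txy := (tau_le_of_causal_right cxy cyz).trans_lt h
  have tyz := (tau_le_of_causal_left cxy cyz).trans_lt h
  have pxy := toReal_tau_pos hxy txy.ne_top
  have pyz := toReal_tau_pos hyz tyz.ne_top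
  have hadd := toReal_tau_add_le cxy cyz h.ne_top
  obtain ⟨b1, b2, b3⟩ := Model.causal_axis (Model.inRange_toReal h)
  obtain ⟨y', u1, u2, u3, u4, -⟩ := Model.exists_point_between (ε := 1) (Model.inRange_toReal h)
    (by linarith) pxy.le pyz hadd (by norm_num)
  exact ⟨_, y', _, u1, u2, eq_of_toReal_eq (Model.tau_lt_left u1 u2 b2).ne_top txy.ne_top u3,
    eq_of_toReal_eq (Model.tau_lt_right u1 u2 b2).ne_top tyz.ne_top u4,
    eq_of_toReal_eq b2.ne_top h.ne_top b3⟩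

/-- Upper bound for `τ(x₁, x₄)` when the diagonals of `y₁ y₂ y₃ y₄` cross before `y₃`. -/
theorem HasSidePoints.le_of_crossing {K : ℝ} {U : Set X} (H : HasSidePoints K U)
    {x₁ x₂ x₃ x₄ : X} (hx₁ : x₁ ∈ U) (hx₂ : x₂ ∈ U) (hx₃ : x₃ ∈ U) (hx₄ : x₄ ∈ U)
    (h12 : chron x₁ x₂) (h23 : chron x₂ x₃) (h34 : chron x₃ x₄) (h : tau x₁ x₄ < diamBound K)
    {y₁ y₂ y₃ y₄ m : Model} (T1 : IsComparisonTriangle K x₁ x₂ x₃ y₁ y₂ y₃)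
    (T2 : IsComparisonTriangle K x₂ x₃ x₄ y₂ y₃ y₄) (L : Model.tau K y₁ y₄ < diamBound K)
    (h1m : Model.causal K y₁ m) (hm3 : Model.causal K m y₃) (h2m : Model.causal K y₂ m)
    (hm4 : Model.causal K m y₄)
    (ha : (Model.tau K y₁ m).toReal + (Model.tau K m y₃).toReal = (Model.tau K y₁ y₃).toReal)
    (hb : (Model.tau K y₂ m).toReal + (Model.tau K m y₄).toReal = (Model.tau K y₂ y₄).toReal)
    (hpos : 0 < (Model.tau K m y₃).toReal) :
    (tau x₁ x₄).toReal ≤ (Model.tau K y₁ y₄).toReal := by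
  have c12 := causal_of_chron _ _ h12
  have c23 := causal_of_chron _ _ h23
  have c34 := causal_of_chron _ _ h34
  have c13 := causal_trans _ _ _ c12 c23
  have c24 := causal_trans _ _ _ c23 c34
  have t13 := (tau_le_of_causal_right c13 c34).trans_lt h
  have t24 := (tau_le_of_causal_left c12 c24).trans_lt h
  have t34 := (tau_le_of_causal_left c13 c34).trans_lt h
  have h13 := chron_trans _ _ _ h12 h23
  have d13 := Model.causal_trans h1m hm3
  have d14 := Model.causal_trans h1m hm4
  have l13 := Model.tau_lt_left d13 T2.causal_yz L
  have lm4 := Model.tau_lt_right h1m hm4 L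
  have n1m : 0 ≤ (Model.tau K y₁ m).toReal := ENNReal.toReal_nonneg
  have n2m : 0 ≤ (Model.tau K y₂ m).toReal := ENNReal.toReal_nonneg
  have nm4 : 0 ≤ (Model.tau K m y₄).toReal := ENNReal.toReal_nonneg
  have hl0 : 0 < (Model.tau K y₁ y₃).toReal := by linarith
  have e34 : Model.E K y₃ y₄ = energy K x₃ x₄ := (T2.bounds t24).2.2.2.2.2
  have e24 : (Model.tau K y₂ y₄).toReal = (tau x₂ x₄).toReal := by rw [T2.tau_xz]
  -- The triangle `y₁ y₃ y₄` need not be a comparison triangle, since its side `y₁ y₄` is what is to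
  -- be estimated. A genuine one for `x₁ x₃ x₄` shares the other two side lengths.
  obtain ⟨z₁, z₃, z₄, Z⟩ := exists_comparisonTriangle h13 h34 h
  obtain ⟨Z14, Z13, Z34, EZ14, EZ13, EZ34⟩ := Z.bounds h
  have eL : (Model.tau K z₁ z₃).toReal = (Model.tau K y₁ y₃).toReal := by
    rw [Z.tau_xy, T1.tau_xz]
  set l := (Model.tau K y₁ y₃).toReal with hl
  set s₀ := (Model.tau K y₁ m).toReal with hs₀
  have hsl : s₀ < l := by linarith
  set F : ℝ → ℝ := fun s => stewart K l s (energy K x₁ x₄) (energy K x₃ x₄) with hF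
  have hFc : Continuous F := Model.continuous_stewart _ _ _ _
  -- Comparison with `x₂` bounds `τ(x₂, w)` from below, so `τ(w, x₄) ≤ τ(x₂, x₄) - τ(y₂, m) = τ(m,
  -- y₄)`. Comparison in `z₁ z₃ z₄` bounds the same `τ(w, x₄)` from below.
  have key : ∀ᶠ s in 𝓝[>] s₀, F s ≤ md K (Model.tau K m y₄).toReal := by
    have e3 : ∀ᶠ s in 𝓝[>] s₀, s < l := nhdsWithin_le_nhds (gt_mem_nhds hsl)
    filter_upwards [e3, self_mem_nhdsWithin] with s f3 f4
    rw [mem_Ioi] at f4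
    obtain ⟨n, hn, hmn, tn⟩ := exists_isPointAt_beyond h1m hm3 l13 ha f4.le f3
    obtain ⟨q, q1, q3, tq1, tq3, -⟩ := Model.exists_segment_point (r := s) Z.causal_xy Z13
      (by rw [eL]; exact hl0) (n1m.trans f4.le) (by rw [eL]; exact f3.le)
    have hq : IsPointAt K s z₁ z₃ q := ⟨q1, q3, tq1, tq3⟩
    obtain ⟨w, hw, cw1, cw3, hfut, -, hcmp⟩ := H x₁ hx₁ x₃ hx₃ h13 t13 s (n1m.trans f4.le)
      (by rw [← T1.tau_xz]; exact f3.le)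
    have i2 := (hcmp x₂ hx₂ c12 c23 _ _ _ T1 n hn).1
    have i4 := hfut x₄ hx₄ c34 h _ _ _ Z q hq
    have cw4 := causal_trans _ _ _ cw3 c34
    have dq4 := Model.causal_trans q3 Z.causal_yz
    have lq4 := Model.tau_lt_right q1 dq4 Z14
    have l2n := Model.tau_lt_left (Model.causal_trans h2m hmn) hn.right
      (Model.tau_lt_right T1.causal_xy T1.causal_yz l13)
    have j2 := Model.toReal_add_le h2m hmn l2n
    have l2w : tau x₂ w ≠ ⊤ := by
      by_cases hc : causal x₂ w
      · exact ((tau_le_of_causal_left c12 hc).trans (tau_le_of_causal_right cw1 cw3)).trans_lt t13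
          |>.ne_top
      · simp [tau_eq_zero _ _ hc]
    have lw4 := (tau_le_of_causal_left cw1 cw4).trans_lt h
    have i2' := ENNReal.toReal_mono l2w i2
    have i4' := ENNReal.toReal_mono lw4.ne_top i4
    have c2w : causal x₂ w := causal_of_chron _ _ (chron_of_toReal_pos (by linarith))
    have k := toReal_tau_add_le c2w cw4 t24.ne_top
    have hE := hq.E_eq Z13 (by rw [eL]; exact hl0) z₄
    rw [eL, EZ14, EZ34, Model.E_eq_md dq4 lq4] at hE
    simp only [hF]
    rw [← hE]
    exact Model.md_le_md ENNReal.toReal_nonneg (Model.inRange_tau lm4) (by linarith)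
  have lim := le_of_tendsto ((hFc.tendsto s₀).mono_left nhdsWithin_le_nhds) key
  have hm := Model.E_eq_stewart h1m hm3 l13 hl0 ha y₄
  rw [Model.E_eq_md hm4 lm4, e34] at hm
  rw [hm] at lim
  have S := Model.sn_pos (Model.inRange_tau l13) hl0
  have S' : 0 < sn K (l - s₀) := Model.sn_pos ((Model.inRange_tau l13).mono (by linarith)
    (by linarith)) (by linarith)
  simp only [hF, stewart] at lim
  rw [div_le_div_iff_of_pos_right S] at lim
  -- Both sides of the limit are Stewart values differing only in the energy at the first endpoint,
  -- whose weight `sn (l - s₀)` is positive.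
  have hE : energy K x₁ x₄ ≤ Model.E K y₁ y₄ := le_of_mul_le_mul_left (by linarith) S'
  rw [Model.E_eq_md d14 L] at hE
  exact Model.le_of_md_le (Model.inRange_toReal h) ENNReal.toReal_nonneg hE

theorem HasSidePoints.tau_le_of_same {K : ℝ} {U : Set X} (H : HasSidePoints K U)
    {x₁ x₂ x₃ x₄ : X} (hx₁ : x₁ ∈ U) (hx₂ : x₂ ∈ U) (hx₃ : x₃ ∈ U) (hx₄ : x₄ ∈ U)
    (h12 : chron x₁ x₂) (h23 : chron x₂ x₃) (h34 : chron x₃ x₄) (h : tau x₁ x₄ < diamBound K)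
    {y₁ y₂ y₃ y₄ : Model} (T1 : IsComparisonTriangle K x₁ x₂ x₃ y₁ y₂ y₃)
    (T2 : IsComparisonTriangle K x₂ x₃ x₄ y₂ y₃ y₄) (hs : Model.SameSide K y₂ y₃ y₁ y₄) :
    tau x₁ x₄ ≤ Model.tau K y₁ y₄ := by
  by_cases L : Model.tau K y₁ y₄ < diamBound K
  swap
  · exact h.le.trans (not_lt.1 L)
  have h0 : 0 < Model.tau K y₂ y₃ := by rw [T1.tau_yz]; exact tau_pos_of_chron h23
  have l13 := Model.tau_lt_left (Model.causal_trans T1.causal_xy T1.causal_yz) T2.causal_yz L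
  have l23 := Model.tau_lt_right T1.causal_xy T1.causal_yz l13
  obtain ⟨m, h1m, hm3, h2m, hm4, ha, hb⟩ := Model.exists_crossing_of_same T1.causal_xy T1.causal_yz
    T2.causal_yz L h0 (Model.side_mul_nonneg.1 hs)
  rw [← ENNReal.toReal_le_toReal h.ne_top L.ne_top]
  by_cases hpos : 0 < (Model.tau K m y₃).toReal
  · exact H.le_of_crossing hx₁ hx₂ hx₃ hx₄ h12 h23 h34 h T1 T2 L h1m hm3 h2m hm4 ha hb hpos
  · have hz : (Model.tau K m y₃).toReal = 0 :=
      le_antisymm (not_lt.1 hpos) ENNReal.toReal_nonneg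
    have a2 := Model.toReal_add_le T1.causal_xy T1.causal_yz l13
    have p23 := ENNReal.toReal_pos h0.ne' l23.ne_top
    have hl0 : 0 < (Model.tau K y₁ y₃).toReal := by
      linarith [(ENNReal.toReal_nonneg : 0 ≤ (Model.tau K y₁ y₂).toReal)]
    -- If `m` sits at the end `y₃` of its segment, Stewart's formula gives it the same energy to
    -- `y₂` as `y₃` has. Hence there is room on the other side and time can be reversed.
    have hp2 : 0 < (Model.tau K y₂ m).toReal := by
      have hE := Model.E_eq_stewart h1m hm3 l13 hl0 ha y₂
      have S := Model.sn_pos (Model.inRange_tau l13) hl0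
      have hst : stewart K (Model.tau K y₁ y₃).toReal (Model.tau K y₁ m).toReal (Model.E K y₁ y₂)
          (Model.E K y₃ y₂) = Model.E K y₃ y₂ := by
        have : (Model.tau K y₁ m).toReal = (Model.tau K y₁ y₃).toReal := by linarith
        rw [this, stewart, sub_self, Model.sn_zero]
        field_simp
        ring
      have l2m := Model.tau_lt_left h2m hm3 l23
      rw [hst, Model.E_comm, Model.E_comm K y₃, Model.E_eq_md h2m l2m,
        Model.E_eq_md T1.causal_yz l23] at hE
      rw [Model.md_inj (Model.inRange_tau l2m) (Model.inRange_tau l23) hE]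
      exact p23
    have := @HasSidePoints.le_of_crossing X _ (reversed X) K U H.reverse x₄ x₃ x₂ x₁ hx₄ hx₃
      hx₂ hx₁ h34 h23 h12 h _ _ _ _ (Model.rev m) T2.reverse T1.reverse (by rwa [Model.tau_rev])
      (Model.causal_rev.2 hm4) (Model.causal_rev.2 h2m) (Model.causal_rev.2 hm3)
      (Model.causal_rev.2 h1m) (by simp only [Model.tau_rev]; linarith)
      (by simp only [Model.tau_rev]; linarith) (by rwa [Model.tau_rev])
    rw [Model.tau_rev] at this
    exact this

theorem upperFourPointBound_of_triangle {K : ℝ} (H : UpperTriangleBound X K) :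
    UpperFourPointBound X K ∧ LocallyHasRealizers X := by
  refine ⟨fun p => ?_, fun p => ?_⟩
  · obtain ⟨U, hU, hp, hc, hs, -⟩ := exists_hasSidePoints H p
    exact ⟨U, hU, hp, hc, fun x₁ hx₁ x₂ hx₂ x₃ hx₃ x₄ hx₄ h12 h23 h34 h =>
      ⟨fun _ _ _ _ T2 T3 hv => hs.tau_le_of_opposite hx₁ hx₂ hx₃ hx₄ h12 h23 h34 h T2 T3 hv,
       fun _ _ _ _ T1 T2 hv => hs.tau_le_of_same hx₁ hx₂ hx₃ hx₄ h12 h23 h34 h T1 T2 hv⟩⟩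
  · obtain ⟨U, hU, hp, -, -, hr⟩ := exists_hasSidePoints H p
    exact ⟨U, hU, hp, hr⟩

end LorentzianPreLengthSpace

/-! ### From the `ε`-`μ` triangle condition to the triangle condition -/

theorem Model.tendsto_stewart {K : ℝ} {ι : Type*} {F : Filter ι} {l s a b : ι → ℝ}
    {l₀ s₀ a₀ b₀ : ℝ} (hl : Tendsto l F (𝓝 l₀)) (hs : Tendsto s F (𝓝 s₀)) (ha : Tendsto a F (𝓝 a₀))
    (hb : Tendsto b F (𝓝 b₀)) (h0 : Model.sn K l₀ ≠ 0) :
    Tendsto (fun i => Model.stewart K (l i) (s i) (a i) (b i)) F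
      (𝓝 (Model.stewart K l₀ s₀ a₀ b₀)) := by
  have hsn : ∀ {f : ι → ℝ} {x : ℝ}, Tendsto f F (𝓝 x) →
      Tendsto (fun i => Model.sn K (f i)) F (𝓝 (Model.sn K x)) := fun h =>
    ((Model.continuous_sn K).tendsto _).comp h
  have hmd : ∀ {f : ι → ℝ} {x : ℝ}, Tendsto f F (𝓝 x) →
      Tendsto (fun i => Model.md K (f i)) F (𝓝 (Model.md K x)) := fun h =>
    ((Model.continuous_md K).tendsto _).comp h
  exact (((((hsn (hl.sub hs)).mul ha).add ((hsn hs).mul hb)).add ((hsn hl).mul (hmd hs))).sub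
    ((hsn hs).mul (hmd hl))).div (hsn hl) h0

theorem diamBound_pos (K : ℝ) : 0 < diamBound K := by
  unfold diamBound
  split_ifs with h
  · have : 0 < √(-K) := Real.sqrt_pos.2 (by linarith)
    exact ENNReal.ofReal_pos.2 (by positivity)
  · exact ENNReal.zero_lt_top

namespace LorentzianPreLengthSpace
variable {X : Type*} [MetricSpace X] [LorentzianPreLengthSpace X]

open Model (md sn InRange stewart)

theorem chron_of_chron_causal {x y z : X} (h1 : chron x y) (h2 : causal y z) : chron x z :=
  (tau_pos_iff _ _).1 ((tau_pos_of_chron h1).trans_le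
    (tau_le_of_causal_right (causal_of_chron _ _ h1) h2))

theorem chron_of_causal_chron {x y z : X} (h1 : causal x y) (h2 : chron y z) : chron x z :=
  (tau_pos_iff _ _).1 ((tau_pos_of_chron h2).trans_le
    (tau_le_of_causal_left h1 (causal_of_chron _ _ h2)))

theorem tau_lt_of_between {K : ℝ} {x u v z : X} (hxu : causal x u) (hvz : causal v z)
    (h : tau x z < diamBound K) : tau u v < diamBound K := by
  by_cases hc : causal u v
  · exact ((tau_le_of_causal_right hc hvz).trans
      (tau_le_of_causal_left hxu (causal_trans _ _ _ hc hvz))).trans_lt h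
  · rw [tau_eq_zero _ _ hc]; exact diamBound_pos K

theorem energy_nonneg (K : ℝ) (x y : X) : 0 ≤ energy K x y := Model.md_nonneg K _

/-! ### Timelike sides -/

/-- The properties of a timelike distance realizer in `U` that are used below; they are invariant
under time reversal. -/
structure TimelikeSide (U : Set X) (a b : X) (γ : ℝ → X) : Prop where
  mem : ∀ s ∈ Icc (0 : ℝ) 1, γ s ∈ U
  continuousOn : ContinuousOn γ (Icc 0 1)
  source : γ 0 = a
  target : γ 1 = b
  mono : ∀ s ∈ Icc (0 : ℝ) 1, ∀ t ∈ Icc (0 : ℝ) 1, s ≤ t → causal (γ s) (γ t)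
  additive : ∀ s ∈ Icc (0 : ℝ) 1, ∀ t ∈ Icc (0 : ℝ) 1, s ≤ t →
    (tau a (γ s)).toReal + (tau (γ s) (γ t)).toReal + (tau (γ t) b).toReal = (tau a b).toReal
  timelike : ∀ s ∈ Icc (0 : ℝ) 1, ∀ t ∈ Icc (0 : ℝ) 1, s < t → γ s ≠ γ t → chron (γ s) (γ t)

theorem IsRealizer.timelikeSide (hreg : Regular X) {U : Set X} {a b : X} {γ : ℝ → X}
    (h : IsRealizer γ a b) (hU : ∀ s ∈ Icc (0 : ℝ) 1, γ s ∈ U) (hab : chron a b)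
    (ht : tau a b ≠ ⊤) : TimelikeSide U a b γ where
  mem := hU
  continuousOn := h.continuousOn
  source := h.source
  target := h.target
  mono _ hs _ ht hst := h.curve.causal_of_le hs ht hst
  additive _ hs _ ht' hst := h.additive_three hs ht' hst ht
  timelike := hreg a b γ hab h

theorem one_sub_mem {s : ℝ} (hs : s ∈ Icc (0 : ℝ) 1) : 1 - s ∈ Icc (0 : ℝ) 1 :=
  ⟨by linarith [hs.2], by linarith [hs.1]⟩

theorem TimelikeSide.reverse {U : Set X} {a b : X} {γ : ℝ → X} (h : TimelikeSide U a b γ) :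
    @TimelikeSide X _ (reversed X) U b a (fun s => γ (1 - s)) :=
  @TimelikeSide.mk X _ (reversed X) U b a _
    (fun s hs => h.mem _ (one_sub_mem hs))
    (h.continuousOn.comp (by fun_prop) fun s hs => one_sub_mem hs)
    (by simpa using h.target) (by simpa using h.source)
    (fun s hs t ht hst => h.mono _ (one_sub_mem ht) _ (one_sub_mem hs) (by linarith))
    (fun s hs t ht hst => by
      have := h.additive _ (one_sub_mem ht) _ (one_sub_mem hs) (by linarith)
      change (tau (γ (1 - s)) b).toReal + (tau (γ (1 - t)) (γ (1 - s))).toReal +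
        (tau a (γ (1 - t))).toReal = (tau a b).toReal
      linarith)
    (fun s hs t ht hst hne => h.timelike _ (one_sub_mem ht) _ (one_sub_mem hs) (by linarith)
      hne.symm)

section TimelikeSide
variable {U : Set X} {a b : X} {γ : ℝ → X}

theorem TimelikeSide.causal_source (h : TimelikeSide U a b γ) {s : ℝ} (hs : s ∈ Icc (0 : ℝ) 1) :
    causal a (γ s) := by
  rw [← h.source]; exact h.mono 0 (by simp) s hs hs.1

theorem TimelikeSide.causal_target (h : TimelikeSide U a b γ) {s : ℝ} (hs : s ∈ Icc (0 : ℝ) 1) :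
    causal (γ s) b := by
  rw [← h.target]; exact h.mono s hs 1 (by simp) hs.2

theorem TimelikeSide.split (h : TimelikeSide U a b γ) (hab : tau a b ≠ ⊤) {s : ℝ}
    (hs : s ∈ Icc (0 : ℝ) 1) : (tau a (γ s)).toReal + (tau (γ s) b).toReal = (tau a b).toReal := by
  have h1 := h.additive s hs s hs le_rfl
  have h2 : tau (γ s) b ≠ ⊤ :=
    ne_top_of_le_ne_top hab (tau_le_of_causal_left (h.causal_source hs) (h.causal_target hs))
  rw [tau_self_of_ne_top (h.causal_target hs) h2] at h1
  simpa using h1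

theorem TimelikeSide.tau_source_add (h : TimelikeSide U a b γ) (hab : tau a b ≠ ⊤) {s t : ℝ}
    (hs : s ∈ Icc (0 : ℝ) 1) (ht : t ∈ Icc (0 : ℝ) 1) (hst : s ≤ t) :
    (tau a (γ s)).toReal + (tau (γ s) (γ t)).toReal = (tau a (γ t)).toReal := by
  linarith [h.additive s hs t ht hst, h.split hab ht]

/-- This is where regularity enters for endpoints: a point of the side different from `a` is in the
timelike future of `a`, so its separation from `a` is positive. -/
theorem TimelikeSide.eq_source (h : TimelikeSide U a b γ) (hab : tau a b ≠ ⊤) {s : ℝ}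
    (hs : s ∈ Icc (0 : ℝ) 1) (h0 : (tau a (γ s)).toReal = 0) : γ s = a := by
  by_contra hne
  have hs0 : 0 < s := hs.1.lt_of_ne (by rintro rfl; exact hne h.source)
  have hc := h.timelike 0 (by simp) s hs hs0 (by rw [h.source]; exact Ne.symm hne)
  rw [h.source] at hc
  exact (toReal_tau_pos hc (ne_top_of_le_ne_top hab
    (tau_le_of_causal_right (h.causal_source hs) (h.causal_target hs)))).ne' h0

theorem TimelikeSide.eq_target (h : TimelikeSide U a b γ) (hab : tau a b ≠ ⊤) {s : ℝ}
    (hs : s ∈ Icc (0 : ℝ) 1) (h0 : (tau (γ s) b).toReal = 0) : γ s = b := by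
  have := @TimelikeSide.eq_source X _ (reversed X) U b a _ h.reverse hab (1 - s) (one_sub_mem hs)
  simp only [sub_sub_cancel] at this
  exact this h0

theorem TimelikeSide.mem_source (h : TimelikeSide U a b γ) : a ∈ U := by
  rw [← h.source]; exact h.mem 0 (by simp)

theorem TimelikeSide.mem_target (h : TimelikeSide U a b γ) : b ∈ U := by
  rw [← h.target]; exact h.mem 1 (by simp)

/-- The first parameter at which the side reaches its endpoint. -/
theorem TimelikeSide.exists_first (h : TimelikeSide U a b γ) (hab : chron a b)
    (ht : tau a b ≠ ⊤) :
    ∃ t₀ ∈ Icc (0 : ℝ) 1, 0 < t₀ ∧ γ t₀ = b ∧ ∀ t, 0 ≤ t → t < t₀ → chron (γ t) b := by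
  have hcl : IsClosed (Icc (0 : ℝ) 1 ∩ γ ⁻¹' {b}) :=
    h.continuousOn.preimage_isClosed_of_isClosed isClosed_Icc isClosed_singleton
  have hcp : IsCompact (Icc (0 : ℝ) 1 ∩ γ ⁻¹' {b}) :=
    isCompact_Icc.of_isClosed_subset hcl inter_subset_left
  obtain ⟨t₀, ⟨hm, he⟩, hl⟩ := hcp.exists_isLeast ⟨1, by simp, h.target⟩
  have he : γ t₀ = b := he
  refine ⟨t₀, hm, hm.1.lt_of_ne ?_, he, fun t h0 hlt => ?_⟩
  · rintro rfl
    rw [h.source] at he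
    subst he
    exact (tau_pos_of_chron hab).ne' (tau_self_of_ne_top (causal_refl a) ht)
  · have hmt : t ∈ Icc (0 : ℝ) 1 := ⟨h0, by linarith [hm.2]⟩
    have := h.timelike t hmt t₀ hm hlt fun hc => absurd (hl ⟨hmt, hc.trans he⟩) (not_le.2 hlt)
    rwa [he] at this

theorem TimelikeSide.continuousOn_tau_left {K : ℝ} (h : TimelikeSide U a b γ)
    (hU : TauContinuousBelow K U) {c : X} (hc : c ∈ U)
    (hD : ∀ s ∈ Icc (0 : ℝ) 1, tau (γ s) c < diamBound K) :
    ContinuousOn (fun s => (tau (γ s) c).toReal) (Icc 0 1) :=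
  hU.continuousOn_comp h.continuousOn continuousOn_const h.mem (fun _ _ => hc) hD

theorem TimelikeSide.continuousOn_tau_right {K : ℝ} (h : TimelikeSide U a b γ)
    (hU : TauContinuousBelow K U) {c : X} (hc : c ∈ U)
    (hD : ∀ s ∈ Icc (0 : ℝ) 1, tau c (γ s) < diamBound K) :
    ContinuousOn (fun s => (tau c (γ s)).toReal) (Icc 0 1) :=
  hU.continuousOn_comp continuousOn_const h.continuousOn (fun _ _ => hc) h.mem hD

end TimelikeSide

/-! ### Local comparison and its time reversal -/

/-- Comparison of exact intermediate points of `a ≪ b` that are timelike related to `c`. -/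
def MidpointComparison (K : ℝ) (U : Set X) (a b c : X) (a' b' c' : Model) : Prop :=
  ∀ m ∈ U, causal a m → causal m b → 0 < (tau a m).toReal → 0 < (tau m b).toReal →
    (tau a m).toReal + (tau m b).toReal = (tau a b).toReal → (chron c m ∨ chron m c) →
    ∀ m', IsPointAt K (tau a m).toReal a' b' m' →
      Model.tau K c' m' ≤ tau c m ∧ Model.tau K m' c' ≤ tau m c

/-- The local form of the `ε`-`μ` condition in a space with timelike realizers. -/
structure LocalComparison (K : ℝ) (U : Set X) : Prop where
  continuity : TauContinuousBelow K U
  sides : ∀ a ∈ U, ∀ b ∈ U, chron a b → tau a b < diamBound K → ∃ γ, TimelikeSide U a b γ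
  midpoints : ∀ x ∈ U, ∀ y ∈ U, ∀ z ∈ U, chron x y → chron y z → tau x z < diamBound K →
    ∀ x' y' z', IsComparisonTriangle K x y z x' y' z' →
      MidpointComparison K U x y z x' y' z' ∧ MidpointComparison K U y z x y' z' x' ∧
      MidpointComparison K U x z y x' z' y'

theorem TauContinuousBelow.reverse {K : ℝ} {U : Set X} (h : TauContinuousBelow K U) :
    @TauContinuousBelow X _ (reversed X) K U := by
  have hs : {p : X × X | p.1 ∈ U ∧ p.2 ∈ U ∧ tau p.2 p.1 < diamBound K} =
      Prod.swap ⁻¹' {p : X × X | p.1 ∈ U ∧ p.2 ∈ U ∧ tau p.1 p.2 < diamBound K} := by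
    ext p; simp only [mem_ofPred_eq, mem_preimage, Prod.fst_swap, Prod.snd_swap]; tauto
  constructor
  · change ContinuousOn (fun p : X × X => tau p.2 p.1)
      {p : X × X | p.1 ∈ U ∧ p.2 ∈ U ∧ tau p.2 p.1 < diamBound K}
    rw [hs]
    exact h.1.comp continuous_swap.continuousOn (mapsTo_preimage _ _)
  · change IsOpen {p : X × X | p.1 ∈ U ∧ p.2 ∈ U ∧ tau p.2 p.1 < diamBound K}
    rw [hs]
    exact h.2.preimage continuous_swap

theorem MidpointComparison.reverse {K : ℝ} {U : Set X} {a b c : X} {a' b' c' : Model}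
    (h : MidpointComparison K U a b c (Model.rev a') (Model.rev b') (Model.rev c'))
    (e : Model.tau K b' a' = tau a b) :
    @MidpointComparison X _ (reversed X) K U b a c b' a' c' := by
  intro m hm hbm hma p1 p2 hadd hr m' hm'
  change 0 < (tau m b).toReal at p1
  change 0 < (tau a m).toReal at p2
  change (tau m b).toReal + (tau a m).toReal = (tau a b).toReal at hadd
  have := h m hm hma hbm p2 p1 (by linarith) hr.symm (Model.rev m') (by
    have h1 := hm'.rev
    have h2 : (Model.tau K b' a').toReal - (tau m b).toReal = (tau a m).toReal := by
      rw [e]; linarith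
    change IsPointAt K ((Model.tau K b' a').toReal - (tau m b).toReal) _ _ _ at h1
    rwa [h2] at h1)
  rw [Model.tau_rev, Model.tau_rev] at this
  exact this.symm

theorem LocalComparison.reverse {K : ℝ} {U : Set X} (h : LocalComparison K U) :
    @LocalComparison X _ (reversed X) K U := by
  refine @LocalComparison.mk X _ (reversed X) K U h.continuity.reverse ?_ ?_
  · intro a ha b hb hab hlt
    obtain ⟨γ, hγ⟩ := h.sides b hb a ha hab hlt
    exact ⟨_, hγ.reverse⟩
  · intro x hx y hy z hz hxy hyz hlt x' y' z' T
    have T' := T.of_reverse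
    obtain ⟨h1, h2, h3⟩ := h.midpoints z hz y hy x hx hyz hxy hlt _ _ _ T'
    have e1 := T'.tau_xy
    have e2 := T'.tau_yz
    have e3 := T'.tau_xz
    rw [Model.tau_rev] at e1 e2 e3
    exact ⟨h2.reverse e2, h1.reverse e1, h3.reverse e3⟩

end LorentzianPreLengthSpace

theorem Model.tendsto_md {K : ℝ} {ι : Type*} {F : Filter ι} {f : ι → ℝ} {t : ℝ}
    (h : Tendsto f F (𝓝 t)) : Tendsto (fun i => md K (f i)) F (𝓝 (md K t)) :=
  ((Model.continuous_md K).tendsto _).comp h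

/-! ### Comparison along the sides of a triangle -/

namespace LorentzianPreLengthSpace
variable {X : Type*} [MetricSpace X] [LorentzianPreLengthSpace X]

open Model (md sn InRange stewart)

variable {K : ℝ} {U : Set X} {x y z : X} {γ : ℝ → X}

theorem exists_isPointAt {a b : Model} (hc : Model.causal K a b)
    (h : Model.tau K a b < diamBound K) (h0 : 0 < (Model.tau K a b).toReal) {r : ℝ} (hr : 0 ≤ r)
    (hr' : r ≤ (Model.tau K a b).toReal) : ∃ m, IsPointAt K r a b m := by
  obtain ⟨m, h1, h2, h3, h4, -⟩ := Model.exists_segment_point hc h h0 hr hr'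
  exact ⟨m, h1, h2, h3, h4⟩

theorem IsPointAt.E_eq_energy {x' y' z' m' : Model} {r : ℝ} (T : IsComparisonTriangle K x y z x' y' z')
    (h : tau x z < diamBound K) (h0 : 0 < (tau x z).toReal) (hm : IsPointAt K r x' z' m') :
    Model.E K m' y' = stewart K (tau x z).toReal r (energy K x y) (energy K y z) := by
  obtain ⟨L, -, -, -, E2, E3⟩ := T.bounds h
  rw [hm.E_eq L (by rw [T.tau_xz]; exact h0), T.tau_xz, E2, Model.E_comm, E3]

/-- On a short side the point is automatically timelike related to the opposite vertex, since `m ≤ y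
≪ z`. Stating the result in energies removes the comparison triangle, so that limits can be taken.
-/
theorem LocalComparison.stewart_le_energy_of_chron (H : LocalComparison K U) (hx : x ∈ U)
    (hy : y ∈ U) (hz : z ∈ U) (hxy : chron x y) (hyz : chron y z) (h : tau x z < diamBound K)
    {m : X} (hm : m ∈ U) (hxm : causal x m) (hmy : causal m y) (p1 : 0 < (tau x m).toReal)
    (p2 : 0 < (tau m y).toReal)
    (hadd : (tau x m).toReal + (tau m y).toReal = (tau x y).toReal) :
    stewart K (tau x y).toReal (tau x m).toReal (energy K x z) (energy K y z) ≤ energy K m z := by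
  obtain ⟨x', y', z', T⟩ := exists_comparisonTriangle hxy hyz h
  obtain ⟨L, L1, L2, E1, E2, E3⟩ := T.bounds h
  have h0 : 0 < (Model.tau K x' y').toReal := by rw [T.tau_xy]; linarith
  obtain ⟨m', hm'⟩ := exists_isPointAt T.causal_xy L1 h0 p1.le (by rw [T.tau_xy]; linarith)
  have hc := ((H.midpoints x hx y hy z hz hxy hyz h _ _ _ T).1 m hm hxm hmy p1 p2 hadd
    (Or.inr (chron_of_causal_chron hmy hyz)) m' hm').2
  have hE := hm'.E_eq L1 h0 z'
  have d := Model.causal_trans hm'.right T.causal_yz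
  have tmz := tau_lt_of_between hxm (causal_refl z) h
  rw [T.tau_xy, E1, E3, Model.E_eq_md d (Model.tau_lt_right hm'.left d L)] at hE
  rw [← hE]
  exact Model.md_le_md ENNReal.toReal_nonneg (Model.inRange_toReal tmz)
    (ENNReal.toReal_mono tmz.ne_top hc)

/-- A null side `y z` is treated by replacing `y` with points of the side `x y` just before it
reaches `y`. These are in the timelike past of `z`, and both sides of the inequality are continuous.
-/
theorem LocalComparison.stewart_le_energy (H : LocalComparison K U)
    (hz : z ∈ U) (hγ : TimelikeSide U x y γ) (hxy : chron x y) (hyz : causal y z)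
    (h : tau x z < diamBound K) {s : ℝ} (hs : s ∈ Icc (0 : ℝ) 1) (p1 : 0 < (tau x (γ s)).toReal)
    (p2 : 0 < (tau (γ s) y).toReal) :
    stewart K (tau x y).toReal (tau x (γ s)).toReal (energy K x z) (energy K y z) ≤
      energy K (γ s) z := by
  have hx := hγ.mem_source
  have txy := (tau_le_of_causal_right (causal_of_chron _ _ hxy) hyz).trans_lt h
  have hxy0 := toReal_tau_pos hxy txy.ne_top
  have hspl := hγ.split txy.ne_top hs
  obtain ⟨t₀, ht₀, -, e₀, hlt⟩ := hγ.exists_first hxy txy.ne_top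
  have hst : s < t₀ := by
    by_contra hc
    have := hγ.tau_source_add txy.ne_top ht₀ hs (not_lt.1 hc)
    rw [e₀] at this
    linarith [(ENNReal.toReal_nonneg : 0 ≤ (tau y (γ s)).toReal)]
  have hsub : Ioo s t₀ ⊆ Icc (0 : ℝ) 1 := fun t ht => ⟨hs.1.trans ht.1.le, ht.2.le.trans ht₀.2⟩
  have : (𝓝[Ioo s t₀] t₀).NeBot := right_nhdsWithin_Ioo_neBot hst
  have l1 : Tendsto (fun t => (tau x (γ t)).toReal) (𝓝[Ioo s t₀] t₀) (𝓝 (tau x y).toReal) := by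
    have := (hγ.continuousOn_tau_right H.continuity hx (fun t ht =>
      (tau_le_of_causal_right (hγ.causal_source ht) (hγ.causal_target ht)).trans_lt txy)) t₀ ht₀
    simpa only [ContinuousWithinAt, e₀] using this.mono hsub
  have l2 : Tendsto (fun t => (tau (γ t) z).toReal) (𝓝[Ioo s t₀] t₀) (𝓝 (tau y z).toReal) := by
    have := (hγ.continuousOn_tau_left H.continuity hz (fun t ht =>
      tau_lt_of_between (hγ.causal_source ht) (causal_refl z) h)) t₀ ht₀
    simpa only [ContinuousWithinAt, e₀] using this.mono hsub
  refine le_of_tendsto (Model.tendsto_stewart l1 tendsto_const_nhds tendsto_const_nhds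
    (Model.tendsto_md l2) (Model.sn_pos (Model.inRange_toReal txy) hxy0).ne') ?_
  filter_upwards [self_mem_nhdsWithin, l1.eventually (lt_mem_nhds
    (show (tau x (γ s)).toReal < (tau x y).toReal by linarith))] with t ht hlt'
  have htm := hsub ht
  have hadd := hγ.tau_source_add txy.ne_top hs htm ht.1.le
  exact H.stewart_le_energy_of_chron hx (hγ.mem t htm) hz
    (chron_of_toReal_pos (p1.trans hlt'))
    (chron_of_chron_causal (hlt t htm.1 ht.2) hyz) h (hγ.mem s hs) (hγ.causal_source hs)
    (hγ.mono s hs t htm ht.1.le) p1 (by linarith) hadd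

/-- Comparison for a short side issuing from the first vertex. -/
theorem LocalComparison.tau_le_past_side (H : LocalComparison K U)
    (hz : z ∈ U) (hγ : TimelikeSide U x y γ) (hxy : chron x y) (hyz : causal y z)
    (h : tau x z < diamBound K) {x' y' z' m' : Model} (T : IsComparisonTriangle K x y z x' y' z')
    {s : ℝ} (hs : s ∈ Icc (0 : ℝ) 1) (hm : IsPointAt K (tau x (γ s)).toReal x' y' m') :
    Model.tau K m' z' ≤ tau (γ s) z := by
  have txy := (tau_le_of_causal_right (causal_of_chron _ _ hxy) hyz).trans_lt h
  have hxy0 := toReal_tau_pos hxy txy.ne_top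
  have hspl := hγ.split txy.ne_top hs
  obtain ⟨L, L1, L2, E1, E2, E3⟩ := T.bounds h
  have h0 : 0 < (Model.tau K x' y').toReal := by rwa [T.tau_xy]
  have d := Model.causal_trans hm.right T.causal_yz
  have hE := hm.E_eq L1 h0 z'
  have lm := Model.tau_lt_right hm.left d L
  rw [T.tau_xy, E1, E3, Model.E_eq_md d lm] at hE
  have tmz := tau_lt_of_between (hγ.causal_source hs) (causal_refl z) h
  -- At zero distance from an endpoint the point is that endpoint, by regularity, and the claim is
  -- about sides of the triangle.
  rcases (ENNReal.toReal_nonneg : 0 ≤ (tau x (γ s)).toReal).eq_or_lt with p1 | p1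
  · rw [hγ.eq_source txy.ne_top hs p1.symm, ← T.tau_xz]
    exact Model.tau_le_of_diamond hm.left (Model.causal_refl K z') L
  rw [← ENNReal.toReal_le_toReal lm.ne_top tmz.ne_top]
  refine Model.le_of_md_le (Model.inRange_tau lm) ENNReal.toReal_nonneg ?_
  rw [hE]
  rcases (ENNReal.toReal_nonneg : 0 ≤ (tau (γ s) y).toReal).eq_or_lt with p2 | p2
  · have S := Model.sn_pos (Model.inRange_toReal txy) hxy0
    have hr : (tau x (γ s)).toReal = (tau x y).toReal := by linarith
    rw [hr, hγ.eq_target txy.ne_top hs p2.symm, stewart, sub_self, Model.sn_zero]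
    refine le_of_eq ?_
    simp only [energy]
    field_simp
    ring
  · exact H.stewart_le_energy hz hγ hxy hyz h hs p1 p2

/-- Comparison for the long side in a timelike triangle, for comparison points after `y'`. -/
theorem LocalComparison.tau_le_long_side_of_chron (H : LocalComparison K U)
    (hy : y ∈ U) (hγ : TimelikeSide U x z γ) (hxy : chron x y) (hyz : chron y z)
    (h : tau x z < diamBound K) {x' y' z' m' : Model} (T : IsComparisonTriangle K x y z x' y' z')
    {s : ℝ} (hs : s ∈ Icc (0 : ℝ) 1) (hm : IsPointAt K (tau x (γ s)).toReal x' z' m')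
    (p1 : 0 < (tau x (γ s)).toReal) (p2 : 0 < (tau (γ s) z).toReal)
    (hpos : 0 < Model.tau K y' m') : Model.tau K y' m' ≤ tau y (γ s) := by
  have hx := hγ.mem_source
  have hz := hγ.mem_target
  have cxy := causal_of_chron _ _ hxy
  have cyz := causal_of_chron _ _ hyz
  have hmid := (H.midpoints x hx y hy z hz hxy hyz h _ _ _ T).2.2
  by_cases hrel : chron y (γ s) ∨ chron (γ s) y
  · exact (hmid (γ s) (hγ.mem s hs) (hγ.causal_source hs) (hγ.causal_target hs) p1 p2
      (hγ.split h.ne_top hs) hrel m' hm).1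
  exfalso
  push Not at hrel
  have hxz0 : 0 < (tau x z).toReal := toReal_tau_pos (chron_trans _ _ _ hxy hyz) h.ne_top
  have txy := (tau_le_of_causal_right cxy cyz).trans_lt h
  obtain ⟨L, L1, L2, E1, E2, E3⟩ := T.bounds h
  have hlxz : 0 < (Model.tau K x' z').toReal := by rwa [T.tau_xz]
  -- The midpoint comparison in energies at points of the side after `y`; if the model energy is not
  -- positive, it holds trivially.
  have step : ∀ t ∈ Icc (0 : ℝ) 1, chron y (γ t) → 0 < (tau (γ t) z).toReal →
      stewart K (tau x z).toReal (tau x (γ t)).toReal (energy K x y) (energy K y z) ≤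
        energy K y (γ t) := by
    intro t ht hyt pt
    have hspl := hγ.split h.ne_top ht
    have tyt := tau_lt_of_between cxy (hγ.causal_target ht) h
    have txt := tau_lt_of_between (causal_refl x) (hγ.causal_target ht) h
    have hadd := toReal_tau_add_le cxy (causal_of_chron _ _ hyt) txt.ne_top
    have pyt := toReal_tau_pos hyt tyt.ne_top
    have pxy := toReal_tau_pos hxy txy.ne_top
    obtain ⟨n, hn⟩ := exists_isPointAt (Model.causal_trans T.causal_xy T.causal_yz) L hlxz
      (r := (tau x (γ t)).toReal) ENNReal.toReal_nonneg (by rw [T.tau_xz]; linarith)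
    have hc := (hmid (γ t) (hγ.mem t ht) (hγ.causal_source ht) (hγ.causal_target ht) (by linarith)
      pt hspl (Or.inl hyt) n hn).1
    have hE := hn.E_eq_energy T h hxz0
    rcases le_or_gt (Model.E K n y') 0 with hneg | hp
    · rw [← hE]; exact hneg.trans (energy_nonneg K _ _)
    have d : Model.causal K y' n := by
      refine (Model.causal_or_of_E_nonneg (Model.loc_of_diamond hn.left hn.right T.causal_xy
        T.causal_yz L) hp.le).resolve_left fun hc => ?_
      have := Model.toReal_add_le hn.left hc L1
      rw [hn.tau_left, T.tau_xy] at this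
      linarith [(ENNReal.toReal_nonneg : 0 ≤ (Model.tau K n y').toReal)]
    rw [← hE, Model.E_comm, Model.E_eq_md d
      (Model.tau_lt_left d hn.right L2)]
    exact Model.md_le_md ENNReal.toReal_nonneg (Model.inRange_toReal tyt)
      (ENNReal.toReal_mono tyt.ne_top hc)
  have cR : ContinuousOn (fun t => (tau y (γ t)).toReal) (Icc 0 1) :=
    hγ.continuousOn_tau_right H.continuity hy fun t ht =>
      tau_lt_of_between cxy (hγ.causal_target ht) h
  have cX : ContinuousOn (fun t => (tau x (γ t)).toReal) (Icc 0 1) :=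
    hγ.continuousOn_tau_right H.continuity hx fun t ht =>
      tau_lt_of_between (causal_refl x) (hγ.causal_target ht) h
  have cZ : ContinuousOn (fun t => (tau (γ t) z).toReal) (Icc 0 1) :=
    hγ.continuousOn_tau_left H.continuity hz fun t ht =>
      tau_lt_of_between (hγ.causal_source ht) (causal_refl z) h
  have hsub : Icc s 1 ⊆ Icc (0 : ℝ) 1 := Icc_subset_Icc_left hs.1
  have hcl : IsClosed (Icc s 1 ∩ (fun t => (tau y (γ t)).toReal) ⁻¹' {0}) :=
    (cR.mono hsub).preimage_isClosed_of_isClosed isClosed_Icc isClosed_singleton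
  have hcp := isCompact_Icc.of_isClosed_subset hcl inter_subset_left
  have hs0 : (tau y (γ s)).toReal = 0 := by
    have : ¬ 0 < tau y (γ s) := fun hc => hrel.1 ((tau_pos_iff _ _).1 hc)
    rw [le_antisymm (not_lt.1 this) bot_le]; simp
  -- `t₀` is the last parameter at which the side is not in the timelike future of `y`. Just after
  -- it `step` applies, and in the limit the Stewart value at `γ t₀` is at most zero.
  obtain ⟨t₀, ⟨hm₀, he₀⟩, hmax⟩ := hcp.exists_isGreatest ⟨s, ⟨le_rfl, hs.2⟩, hs0⟩
  have he₀ : (tau y (γ t₀)).toReal = 0 := he₀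
  have ht₀ := hsub hm₀
  have hyz0 : 0 < (tau y z).toReal :=
    toReal_tau_pos hyz (tau_lt_of_between cxy (causal_refl z) h).ne_top
  have hne : γ t₀ ≠ z := by
    intro hc; rw [hc] at he₀; exact hyz0.ne' he₀
  have ht1 : t₀ < 1 := hm₀.2.lt_of_ne (by rintro rfl; exact hne hγ.target)
  have hz₀ : 0 < (tau (γ t₀) z).toReal := by
    have hc := hγ.timelike t₀ ht₀ 1 (by simp) ht1 (by rwa [hγ.target])
    rw [hγ.target] at hc
    exact toReal_tau_pos hc (tau_lt_of_between (hγ.causal_source ht₀) (causal_refl z) h).ne_top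
  have : (𝓝[Ioo t₀ 1] t₀).NeBot := left_nhdsWithin_Ioo_neBot ht1
  have hsub' : Ioo t₀ 1 ⊆ Icc (0 : ℝ) 1 := fun t ht => ⟨ht₀.1.trans ht.1.le, ht.2.le⟩
  have lR := (cR t₀ ht₀).mono hsub'
  have lX := (cX t₀ ht₀).mono hsub'
  have lZ := (cZ t₀ ht₀).mono hsub'
  have hS := Model.sn_pos (Model.inRange_toReal h) hxz0
  have lim : stewart K (tau x z).toReal (tau x (γ t₀)).toReal (energy K x y) (energy K y z) ≤
      energy K y (γ t₀) := by
    refine le_of_tendsto_of_tendsto (Model.tendsto_stewart tendsto_const_nhds lX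
      tendsto_const_nhds tendsto_const_nhds hS.ne') (Model.tendsto_md lR) ?_
    filter_upwards [self_mem_nhdsWithin, lZ.eventually (lt_mem_nhds hz₀)] with t ht hlt
    refine step t (hsub' ht) (chron_of_toReal_pos ?_) hlt
    refine ENNReal.toReal_nonneg.lt_of_ne' fun hc => ?_
    exact absurd (hmax ⟨⟨hm₀.1.trans ht.1.le, ht.2.le⟩, hc⟩) (not_le.2 ht.1)
  rw [show energy K y (γ t₀) = 0 by rw [energy, he₀, Model.md_zero]] at lim
  have hspl := hγ.split h.ne_top ht₀
  have hmono := hγ.tau_source_add h.ne_top hs ht₀ hm₀.1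
  -- The model point at the height of `γ t₀` comes after `m'`, hence has positive energy from `y'`.
  -- This contradicts the limit.
  obtain ⟨n, hn, hmn, -⟩ := exists_isPointAt_beyond (s := (tau x (γ t₀)).toReal) hm.left hm.right L
    (by rw [hm.tau_left, hm.tau_right]; ring)
    (by rw [hm.tau_left]; linarith [(ENNReal.toReal_nonneg : 0 ≤ (tau (γ s) (γ t₀)).toReal)])
    (by rw [T.tau_xz]; linarith)
  have hE := hn.E_eq_energy T h hxz0
  have dm := Model.causal_of_tau_pos hpos
  have d := Model.causal_trans dm hmn
  have ln := Model.tau_lt_left d hn.right L2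
  have lm := Model.tau_lt_left dm hmn ln
  have k1 := Model.toReal_add_le dm hmn ln
  have k2 := ENNReal.toReal_pos hpos.ne' lm.ne_top
  rw [Model.E_comm, Model.E_eq_md d ln] at hE
  have k3 := Model.md_pos (Model.inRange_tau ln)
    (by linarith [(ENNReal.toReal_nonneg : 0 ≤ (Model.tau K m' n).toReal)])
  linarith

end LorentzianPreLengthSpace

/-! ### Null sides and the full triangle comparison -/

namespace LorentzianPreLengthSpace
variable {X : Type*} [MetricSpace X] [LorentzianPreLengthSpace X]

open Model (md sn InRange stewart)

variable {K : ℝ} {U : Set X} {x y z : X} {γ : ℝ → X}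

/-- The sign of the model energy decides which of the two directions is estimated. The maximum
forgets the direction and is stable under limits in `y`, during which the causal order may change.
-/
theorem LocalComparison.stewart_le_max_of_chron (H : LocalComparison K U)
    (hy : y ∈ U) (hγ : TimelikeSide U x z γ) (hxy : chron x y) (hyz : chron y z)
    (h : tau x z < diamBound K) {s : ℝ} (hs : s ∈ Icc (0 : ℝ) 1)
    (p1 : 0 < (tau x (γ s)).toReal) (p2 : 0 < (tau (γ s) z).toReal) :
    stewart K (tau x z).toReal (tau x (γ s)).toReal (energy K x y) (energy K y z) ≤
      max (energy K y (γ s)) (energy K (γ s) y) := by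
  have hspl := hγ.split h.ne_top hs
  have hxz0 : 0 < (tau x z).toReal := toReal_tau_pos (chron_trans _ _ _ hxy hyz) h.ne_top
  have cxy := causal_of_chron _ _ hxy
  have cyz := causal_of_chron _ _ hyz
  obtain ⟨x', y', z', T⟩ := exists_comparisonTriangle hxy hyz h
  obtain ⟨L, L1, L2, -, -, -⟩ := T.bounds h
  obtain ⟨m, hm⟩ := exists_isPointAt (Model.causal_trans T.causal_xy T.causal_yz) L
    (by rwa [T.tau_xz]) p1.le (by rw [T.tau_xz]; linarith)
  have hE := hm.E_eq_energy T h hxz0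
  rcases le_or_gt (Model.E K m y') 0 with hneg | hp
  · rw [← hE]; exact hneg.trans (le_max_of_le_left (energy_nonneg K _ _))
  have pos_of : ∀ {p q : Model}, Model.causal K p q → Model.tau K p q < diamBound K →
      0 < Model.E K p q → 0 < Model.tau K p q := by
    intro p q hc hl hE
    refine pos_iff_ne_zero.2 fun h0 => ?_
    rw [Model.E_eq_md hc hl, h0] at hE
    simp at hE
  rw [← hE]
  rcases Model.causal_or_of_E_nonneg (Model.loc_of_diamond hm.left hm.right T.causal_xy
    T.causal_yz L) hp.le with d | d
  · have lm := Model.tau_lt_right hm.left d L1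
    have tms := tau_lt_of_between (hγ.causal_source hs) cyz h
    have hm' := hm.rev
    rw [T.tau_xz, show (tau x z).toReal - (tau x (γ s)).toReal = (tau (γ s) z).toReal by linarith]
      at hm'
    have := @LocalComparison.tau_le_long_side_of_chron X _ (reversed X) K U z y x _ H.reverse hy
      hγ.reverse hyz hxy h _ _ _ (Model.rev m) T.reverse (1 - s) (one_sub_mem hs)
      (by simp only [sub_sub_cancel]; exact hm') (by simp only [sub_sub_cancel]; exact p2)
      (by simp only [sub_sub_cancel]; exact p1)
      (by rw [Model.tau_rev]; exact pos_of d lm hp)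
    simp only [sub_sub_cancel] at this
    rw [Model.tau_rev] at this
    refine le_max_of_le_right ?_
    rw [Model.E_eq_md d lm]
    exact Model.md_le_md ENNReal.toReal_nonneg (Model.inRange_toReal tms)
      (ENNReal.toReal_mono tms.ne_top this)
  · have lm := Model.tau_lt_left d hm.right L2
    have tms := tau_lt_of_between cxy (hγ.causal_target hs) h
    have := H.tau_le_long_side_of_chron hy hγ hxy hyz h T hs hm p1 p2
      (pos_of d lm (by rwa [Model.E_comm]))
    refine le_max_of_le_left ?_
    rw [Model.E_comm, Model.E_eq_md d lm]
    exact Model.md_le_md ENNReal.toReal_nonneg (Model.inRange_toReal tms)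
      (ENNReal.toReal_mono tms.ne_top this)

/-- The vertex `y` is approached from the past along a timelike side from `x`; its points are
timelike related to `z` even when `y` is only causally related to it. -/
theorem LocalComparison.stewart_le_max (H : LocalComparison K U)
    (hy : y ∈ U) (hγ : TimelikeSide U x z γ) (hxy : chron x y) (hyz : causal y z)
    (h : tau x z < diamBound K) {s : ℝ} (hs : s ∈ Icc (0 : ℝ) 1)
    (p1 : 0 < (tau x (γ s)).toReal) (p2 : 0 < (tau (γ s) z).toReal) :
    stewart K (tau x z).toReal (tau x (γ s)).toReal (energy K x y) (energy K y z) ≤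
      max (energy K y (γ s)) (energy K (γ s) y) := by
  have hx := hγ.mem_source
  have hz := hγ.mem_target
  have cxy := causal_of_chron _ _ hxy
  have txy := (tau_le_of_causal_right cxy hyz).trans_lt h
  have hxy0 := toReal_tau_pos hxy txy.ne_top
  have hxz0 : 0 < (tau x z).toReal := toReal_tau_pos (chron_of_chron_causal hxy hyz) h.ne_top
  obtain ⟨η, hη⟩ := H.sides x hx y hy hxy txy
  obtain ⟨t₀, ht₀, ht0, e₀, hlt⟩ := hη.exists_first hxy txy.ne_top
  have hsub : Ioo 0 t₀ ⊆ Icc (0 : ℝ) 1 := fun t ht => ⟨ht.1.le, ht.2.le.trans ht₀.2⟩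
  have : (𝓝[Ioo 0 t₀] t₀).NeBot := right_nhdsWithin_Ioo_neBot ht0
  have cz : ∀ t ∈ Icc (0 : ℝ) 1, causal (η t) z := fun t ht =>
    causal_trans _ _ _ (hη.causal_target ht) hyz
  have lft : ∀ c ∈ U, causal c z → Tendsto (fun t => (tau (η t) c).toReal) (𝓝[Ioo 0 t₀] t₀)
      (𝓝 (tau y c).toReal) := by
    intro c hc hcz
    have := (hη.continuousOn_tau_left H.continuity hc (fun t ht =>
      tau_lt_of_between (hη.causal_source ht) hcz h)) t₀ ht₀
    simpa only [ContinuousWithinAt, e₀] using this.mono hsub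
  have rgt : ∀ c ∈ U, causal x c → Tendsto (fun t => (tau c (η t)).toReal) (𝓝[Ioo 0 t₀] t₀)
      (𝓝 (tau c y).toReal) := by
    intro c hc hxc
    have := (hη.continuousOn_tau_right H.continuity hc (fun t ht =>
      tau_lt_of_between hxc (cz t ht) h)) t₀ ht₀
    simpa only [ContinuousWithinAt, e₀] using this.mono hsub
  have lx := rgt x hx (causal_refl x)
  refine le_of_tendsto_of_tendsto (Model.tendsto_stewart tendsto_const_nhds tendsto_const_nhds
    (Model.tendsto_md lx) (Model.tendsto_md (lft z hz (causal_refl z)))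
    (Model.sn_pos (Model.inRange_toReal h) hxz0).ne')
    ((Model.tendsto_md (lft _ (hγ.mem s hs) (hγ.causal_target hs))).max
      (Model.tendsto_md (rgt _ (hγ.mem s hs) (hγ.causal_source hs)))) ?_
  filter_upwards [self_mem_nhdsWithin, lx.eventually (lt_mem_nhds hxy0)] with t ht hpos
  exact H.stewart_le_max_of_chron (hη.mem t (hsub ht)) hγ (chron_of_toReal_pos hpos)
    (chron_of_chron_causal (hlt t ht.1.le ht.2) hyz) h hs p1 p2

theorem LocalComparison.stewart_le_max_of_chron_right (H : LocalComparison K U)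
    (hy : y ∈ U) (hγ : TimelikeSide U x z γ) (hxy : causal x y) (hyz : chron y z)
    (h : tau x z < diamBound K) {s : ℝ} (hs : s ∈ Icc (0 : ℝ) 1)
    (p1 : 0 < (tau x (γ s)).toReal) (p2 : 0 < (tau (γ s) z).toReal) :
    stewart K (tau x z).toReal (tau x (γ s)).toReal (energy K x y) (energy K y z) ≤
      max (energy K y (γ s)) (energy K (γ s) y) := by
  have hspl := hγ.split h.ne_top hs
  have := @LocalComparison.stewart_le_max X _ (reversed X) K U z y x _ H.reverse hy
    hγ.reverse hyz hxy h (1 - s) (one_sub_mem hs) (by simp only [sub_sub_cancel]; exact p2)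
    (by simp only [sub_sub_cancel]; exact p1)
  simp only [sub_sub_cancel] at this
  rw [max_comm, Model.stewart_symm,
    show (tau x z).toReal - (tau x (γ s)).toReal = (tau (γ s) z).toReal by linarith]
  exact this

/-- Comparison for the long side, for comparison points after `y'`. -/
theorem LocalComparison.tau_le_long_side (H : LocalComparison K U)
    (hy : y ∈ U) (hγ : TimelikeSide U x z γ) (hxz : chron x z) (hxy : causal x y)
    (hyz : causal y z) (h : tau x z < diamBound K) {x' y' z' m' : Model}
    (T : IsComparisonTriangle K x y z x' y' z') {s : ℝ} (hs : s ∈ Icc (0 : ℝ) 1)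
    (hm : IsPointAt K (tau x (γ s)).toReal x' z' m') : Model.tau K y' m' ≤ tau y (γ s) := by
  rcases eq_zero_or_pos (Model.tau K y' m') with h0 | hpos
  · rw [h0]; exact bot_le
  have hspl := hγ.split h.ne_top hs
  have hxz0 := toReal_tau_pos hxz h.ne_top
  obtain ⟨L, L1, L2, -, -, -⟩ := T.bounds h
  have d := Model.causal_of_tau_pos hpos
  have lm := Model.tau_lt_left d hm.right L2
  have lxm := Model.tau_lt_left hm.left hm.right L
  have hpos' := ENNReal.toReal_pos hpos.ne' lm.ne_top
  have hadd := Model.toReal_add_le T.causal_xy d lxm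
  rw [hm.tau_left, T.tau_xy] at hadd
  have p1 : 0 < (tau x (γ s)).toReal := by
    linarith [(ENNReal.toReal_nonneg : 0 ≤ (tau x y).toReal)]
  have hle : Model.tau K y' m' ≤ tau y z := by
    rw [← T.tau_yz]; exact Model.tau_le_of_diamond (Model.causal_refl K y') hm.right L2
  rcases (ENNReal.toReal_nonneg : 0 ≤ (tau (γ s) z).toReal).eq_or_lt with p2 | p2
  · rw [hγ.eq_target h.ne_top hs p2.symm]; exact hle
  -- A positive model separation from `y'` to the side forces `y ≪ z`, so at most the side `x y` is
  -- null.
  have hyz' : chron y z := (tau_pos_iff _ _).1 (hpos.trans_le hle)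
  have key := H.stewart_le_max_of_chron_right hy hγ hxy hyz' h hs p1 p2
  rw [← hm.E_eq_energy T h hxz0, Model.E_comm, Model.E_eq_md d lm] at key
  have tys := tau_lt_of_between hxy (hγ.causal_target hs) h
  rw [← ENNReal.toReal_le_toReal lm.ne_top tys.ne_top]
  rcases le_max_iff.1 key with k | k
  · exact Model.le_of_md_le (Model.inRange_tau lm) ENNReal.toReal_nonneg k
  · exfalso
    -- The other entry of the maximum would give `γ s ≪ y`, hence `τ(x, γ s) < τ(x, y)`, while the
    -- model says that `τ(x, y) < τ(x, γ s)`.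
    have k' := Model.le_of_md_le (Model.inRange_tau lm) ENNReal.toReal_nonneg k
    have hc := chron_of_toReal_pos (hpos'.trans_le k')
    have := toReal_tau_add_le (hγ.causal_source hs) (causal_of_chron _ _ hc)
      (tau_lt_of_between (causal_refl x) hyz h).ne_top
    linarith

theorem isPointAt_of_isComparisonPoint {a b m : X} {a' b' m' : Model}
    (h : IsComparisonPoint K a b m a' b' m') (e : Model.tau K a' b' = tau a b)
    (hadd : (tau a m).toReal + (tau m b).toReal = (tau a b).toReal) :
    IsPointAt K (tau a m).toReal a' b' m' :=
  ⟨h.causal_am, h.causal_mb, by rw [h.tau_am], by rw [h.tau_mb, e]; linarith⟩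

/-- A point on a side, seen from the endpoint. -/
theorem IsPointAt.reverse_of_side (hγ : TimelikeSide U x z γ) (h : tau x z ≠ ⊤) {x' z' m' : Model}
    (e : Model.tau K x' z' = tau x z) {s : ℝ} (hs : s ∈ Icc (0 : ℝ) 1)
    (hm : IsPointAt K (tau x (γ s)).toReal x' z' m') :
    IsPointAt K (tau (γ s) z).toReal (Model.rev z') (Model.rev x') (Model.rev m') := by
  have := hm.rev
  rwa [e, show (tau x z).toReal - (tau x (γ s)).toReal = (tau (γ s) z).toReal by
    linarith [hγ.split h hs]] at this

theorem LocalComparison.sideComparison (hreg : Regular X) (H : LocalComparison K U) (hx : x ∈ U)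
    (hy : y ∈ U) (hz : z ∈ U) (hxy : causal x y) (hyz : causal y z) (h : tau x z < diamBound K)
    {x' y' z' : Model} (T : IsComparisonTriangle K x y z x' y' z') :
    SideComparison K U x y z x' y' z' ∧ SideComparison K U y z x y' z' x' ∧
      SideComparison K U x z y x' z' y' := by
  have txy := (tau_le_of_causal_right hxy hyz).trans_lt h
  have tyz := (tau_le_of_causal_left hxy hyz).trans_lt h
  refine ⟨?_, ?_, ?_⟩
  · intro hc γ hγ hU s hs m' hm'
    have hside := hγ.timelikeSide hreg hU hc txy.ne_top
    have hm := isPointAt_of_isComparisonPoint hm' T.tau_xy (hside.split txy.ne_top hs)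
    refine ⟨?_, H.tau_le_past_side hz hside hc hyz h T hs hm⟩
    rw [Model.tau_eq_zero_of_causal (Model.causal_trans hm.right T.causal_yz)]; exact bot_le
  · intro hc γ hγ hU s hs m' hm'
    have hside := hγ.timelikeSide hreg hU hc tyz.ne_top
    have hm := isPointAt_of_isComparisonPoint hm' T.tau_yz (hside.split tyz.ne_top hs)
    constructor
    · have := @LocalComparison.tau_le_past_side X _ (reversed X) K U z y x _ H.reverse hx
        hside.reverse hc hxy h _ _ _ (Model.rev m') T.reverse (1 - s) (one_sub_mem hs)
        (by simp only [sub_sub_cancel]; exact hm.reverse_of_side hside tyz.ne_top T.tau_yz hs)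
      simp only [sub_sub_cancel] at this
      rw [Model.tau_rev] at this
      exact this
    · rw [Model.tau_eq_zero_of_causal (Model.causal_trans T.causal_xy hm.left)]; exact bot_le
  · intro hc γ hγ hU s hs m' hm'
    have hside := hγ.timelikeSide hreg hU hc h.ne_top
    have hm := isPointAt_of_isComparisonPoint hm' T.tau_xz (hside.split h.ne_top hs)
    refine ⟨H.tau_le_long_side hy hside hc hxy hyz h T hs hm, ?_⟩
    have := @LocalComparison.tau_le_long_side X _ (reversed X) K U z y x _ H.reverse hy
      hside.reverse hc hyz hxy h _ _ _ (Model.rev m') T.reverse (1 - s) (one_sub_mem hs)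
      (by simp only [sub_sub_cancel]; exact hm.reverse_of_side hside h.ne_top T.tau_xz hs)
    simp only [sub_sub_cancel] at this
    rw [Model.tau_rev] at this
    exact this

/-! ### Passage to causally convex neighbourhoods -/

/-- Strong causality provides arbitrarily small causally convex neighbourhoods. -/
theorem StronglyCausal.exists_convex (hsc : StronglyCausal X) {W : Set X} (hW : IsOpen W) {p : X}
    (hp : p ∈ W) : ∃ V ⊆ W, IsOpen V ∧ p ∈ V ∧
      ∀ a ∈ V, ∀ b ∈ V, ∀ c, causal a c → causal c b → c ∈ V := by
  -- Finite intersections of timelike diamonds form a basis, and they are causally convex by the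
  -- push-up property.
  have hB := TopologicalSpace.isTopologicalBasis_of_subbasis hsc
  obtain ⟨V, ⟨F, ⟨hfin, hF⟩, rfl⟩, hpV, hVW⟩ := hB.exists_subset_of_mem_open hp hW
  refine ⟨⋂₀ F, hVW, hB.isOpen ⟨F, ⟨hfin, hF⟩, rfl⟩, hpV, ?_⟩
  intro a ha b hb c hac hcb S hS
  obtain ⟨u, v, rfl⟩ := hF hS
  exact ⟨chron_of_chron_causal (ha _ hS).1 hac, chron_of_causal_chron hcb (hb _ hS).2⟩

theorem TauContinuousBelow.mono {V : Set X} (h : TauContinuousBelow K U) (hV : IsOpen V)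
    (hVU : V ⊆ U) : TauContinuousBelow K V := by
  refine ⟨h.1.mono fun p hp => ⟨hVU hp.1, hVU hp.2.1, hp.2.2⟩, ?_⟩
  have : {p : X × X | p.1 ∈ V ∧ p.2 ∈ V ∧ tau p.1 p.2 < diamBound K} =
      (V ×ˢ V) ∩ {p : X × X | p.1 ∈ U ∧ p.2 ∈ U ∧ tau p.1 p.2 < diamBound K} := by
    ext p
    exact ⟨fun hp => ⟨⟨hp.1, hp.2.1⟩, hVU hp.1, hVU hp.2.1, hp.2.2⟩,
      fun hp => ⟨hp.1.1, hp.1.2, hp.2.2.2⟩⟩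
  rw [this]
  exact (hV.prod hV).inter h.2

/-- An exact intermediate point is an `ε`-`μ`-midpoint for every `ε > 0`, so the error term can be
sent to zero. -/
theorem EpsMuComparison.midpoint {μ : ℝ} {f : ℝ≥0 → ℝ≥0} (hf : Tendsto f (𝓝[>] 0) (𝓝 0))
    {a b c : X} {a' b' c' : Model} (H : EpsMuComparison K U μ f a b c a' b' c') (h0 : 0 < μ)
    (h1 : μ < 1) (hab : tau a b ≠ ⊤) (e : Model.tau K a' b' = tau a b) {m : X} (hm : m ∈ U)
    (ham : causal a m) (hmb : causal m b) (e1 : (tau a m).toReal = μ * (tau a b).toReal)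
    (hadd : (tau a m).toReal + (tau m b).toReal = (tau a b).toReal) (hr : chron c m ∨ chron m c)
    {m' : Model} (hm' : IsPointAt K (tau a m).toReal a' b' m') (hl : Model.tau K a' m' ≠ ⊤)
    (hl' : Model.tau K m' b' ≠ ⊤) :
    Model.tau K c' m' ≤ tau c m ∧ Model.tau K m' c' ≤ tau m c := by
  have e2 : (tau m b).toReal = (1 - μ) * (tau a b).toReal := by linarith
  have mul_eq : ∀ {ν : ℝ} {t : ℝ≥0∞}, 0 ≤ ν → t ≠ ⊤ → t.toReal = ν * (tau a b).toReal →
      t = ENNReal.ofReal ν * tau a b := by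
    intro ν t hν ht h
    refine eq_of_toReal_eq ht (ENNReal.mul_ne_top ENNReal.ofReal_ne_top hab) ?_
    rw [ENNReal.toReal_mul, ENNReal.toReal_ofReal hν, h]
  have tam := ne_top_of_le_ne_top hab (tau_le_of_causal_right ham hmb)
  have tmb := ne_top_of_le_ne_top hab (tau_le_of_causal_left ham hmb)
  have q1 := mul_eq h0.le tam e1
  have q2 := mul_eq (by linarith) tmb e2
  have hmid : IsMuMidpoint (Model.tau K) μ a' b' m' := by
    rw [IsMuMidpoint, e]
    exact ⟨mul_eq h0.le hl (by rw [hm'.tau_left, e1]),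
      mul_eq (by linarith) hl' (by rw [hm'.tau_right, e]; linarith)⟩
  have heps : ∀ ε : ℝ≥0, 0 < ε → IsEpsMuMidpoint tau ε μ a b m := by
    intro ε hε
    have hε' : (ε : ℝ≥0∞) ≠ 0 := by exact_mod_cast hε.ne'
    rw [IsEpsMuMidpoint, ← q1, ← q2]
    exact ⟨⟨ENNReal.lt_add_right tam hε', ENNReal.lt_add_right tam hε'⟩,
      ENNReal.lt_add_right tmb hε', ENNReal.lt_add_right tmb hε'⟩
  have lim : ∀ t : ℝ≥0∞, Tendsto (fun ε => t + f ε) (𝓝[>] 0) (𝓝 t) := by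
    intro t
    have := (tendsto_const_nhds (x := t)).add (ENNReal.tendsto_coe.2 hf)
    simpa using this
  constructor
  · refine ge_of_tendsto (lim _) ?_
    filter_upwards [self_mem_nhdsWithin] with ε hε
    exact (H ε hε m hm (heps ε hε) hr m' hmid).1
  · refine ge_of_tendsto (lim _) ?_
    filter_upwards [self_mem_nhdsWithin] with ε hε
    exact (H ε hε m hm (heps ε hε) hr m' hmid).2

/-- The realizers provided locally live in `X`; causal convexity of `V` confines them to `V`, and
regularity makes them timelike sides. -/
theorem upperTriangleBound_of_epsMu (hsc : StronglyCausal X) (hreg : Regular X)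
    (H : UpperEpsMuBound X K) (hr : LocallyHasRealizers X) : UpperTriangleBound X K := by
  intro p
  obtain ⟨U₁, hU₁, hp₁, hc₁, H₁⟩ := H p
  obtain ⟨U₂, hU₂, hp₂, H₂⟩ := hr p
  obtain ⟨V, hV, hVo, hpV, hconv⟩ := hsc.exists_convex (hU₁.inter hU₂) ⟨hp₁, hp₂⟩
  have hV₁ : V ⊆ U₁ := fun a ha => (hV ha).1
  have real : ∀ x ∈ V, ∀ y ∈ V, chron x y →
      ∃ γ : ℝ → X, IsRealizer γ x y ∧ ∀ s ∈ Icc (0 : ℝ) 1, γ s ∈ V := by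
    intro x hx y hy hxy
    obtain ⟨γ, hγ⟩ := H₂ x (hV hx).2 y (hV hy).2 hxy
    exact ⟨γ, hγ, fun s hs => hconv x hx y hy _ (hγ.causal_source hs) (hγ.causal_target hs)⟩
  have loc : LocalComparison K V := by
    refine ⟨hc₁.mono hVo hV₁, ?_, ?_⟩
    · intro a ha b hb hab hlt
      obtain ⟨γ, hγ, hγV⟩ := real a ha b hb hab
      exact ⟨γ, hγ.timelikeSide hreg hγV hab hlt.ne_top⟩
    · intro x hx y hy z hz hxy hyz h x' y' z' T
      have cxy := causal_of_chron _ _ hxy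
      have cyz := causal_of_chron _ _ hyz
      obtain ⟨L, L1, L2, -, -, -⟩ := T.bounds h
      have main : ∀ {a b c : X} {a' b' c' : Model}, Model.tau K a' b' < diamBound K →
          Model.tau K a' b' = tau a b →
          (∀ μ : ℝ, 0 < μ → μ < 1 → ∃ f : ℝ≥0 → ℝ≥0, Tendsto f (𝓝[>] 0) (𝓝 0) ∧
            EpsMuComparison K U₁ μ f a b c a' b' c') → MidpointComparison K V a b c a' b' c' := by
        intro a b c a' b' c' l e hex m hm ham hmb p1 p2 hadd hrel m' hm'
        have hab0 : 0 < (tau a b).toReal := by linarith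
        have hμ : (tau a m).toReal / (tau a b).toReal < 1 := by
          rw [div_lt_one hab0]; linarith
        -- Since `μ` is arbitrary in `(0, 1)`, the ratio `τ(a, m) / τ(a, b)` covers every interior
        -- point of the side.
        obtain ⟨f, hf, hcmp⟩ := hex _ (div_pos p1 hab0) hμ
        exact hcmp.midpoint hf (div_pos p1 hab0) hμ (by rw [← e]; exact l.ne_top) e (hV₁ hm) ham hmb
          (by field_simp) hadd hrel hm' (Model.tau_lt_left hm'.left hm'.right l).ne_top
          (Model.tau_lt_right hm'.left hm'.right l).ne_top
      have get := H₁ x (hV₁ hx) y (hV₁ hy) z (hV₁ hz) hxy hyz h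
      refine ⟨main L1 T.tau_xy fun μ h0 h1 => ?_, main L2 T.tau_yz fun μ h0 h1 => ?_,
        main L T.tau_xz fun μ h0 h1 => ?_⟩ <;> obtain ⟨f, hf, hc⟩ := get μ h0 h1
      · exact ⟨f, hf, (hc _ _ _ T).1⟩
      · exact ⟨f, hf, (hc _ _ _ T).2.1⟩
      · exact ⟨f, hf, (hc _ _ _ T).2.2⟩
  exact ⟨V, hVo, hpV, loc.continuity, real, fun x hx y hy z hz hxy hyz h x' y' z' T =>
    loc.sideComparison hreg hx hy hz hxy hyz h T⟩

end LorentzianPreLengthSpace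

open LorentzianPreLengthSpace in
theorem mainTheorem1 {X : Type*} [MetricSpace X] [LorentzianPreLengthSpace X] (K : ℝ) :
    (StronglyCausal X → Regular X →
      List.TFAE [UpperTriangleBound X K,
        UpperFourPointBound X K ∧ LocallyHasRealizers X,
        UpperEpsMuBound X K ∧ LocallyHasRealizers X]) ∧
    (UpperFourPointBound X K → UpperEpsMuBound X K) := by
  refine ⟨fun hsc hreg => ?_, upperEpsMuBound_of_fourPoint⟩
  tfae_have 1 → 2 := upperFourPointBound_of_triangle
  tfae_have 2 → 3 := fun h => ⟨upperEpsMuBound_of_fourPoint h.1, h.2⟩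
  tfae_have 3 → 1 := fun h => upperTriangleBound_of_epsMu hsc hreg h.1 h.2
  tfae_finish
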